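/- Let $\Sigma\subset\mathbb{R}^3$ be a compact, closed, regular $C^2$-curve of length $L>0$ without self-intersections, with arc length parametrization $\sigma$ (identified with its $L$-periodic $C^2$-extension to $\mathbb{R}$, $|\dot\sigma|=1$), and let $L^2(\Sigma)$ be the space of complex-valued functions that are square integrable with respect to the arc length measure $d\sigma$. For $x=\sigma(s_0)\in\Sigma$ and $\delta>0$ put $I_\delta^\Sigma(x)=\{\sigma(s): s\in(s_0-\delta,s_0+\delta)\}$. For $\lambda\le 0$ and $h$ in the space $C^{0,1}(\Sigma)$ of complex-valued Lipschitz continuous functions on $\Sigma$ set $$(B_\lambda h)(x)=\lim_{\delta\searrow 0}\bigg[\int_{\Sigma\setminus I_\delta^\Sigma(x)} h(y)\,\frac{e^{-\sqrt{-\lambda}\,|x-y|}}{4\pi|x-y|}\,d\sigma(y)+h(x)\,\frac{\ln\delta}{2\pi}\bigg],\qquad x\in\Sigma,\quad \operatorname{dom} B_\lambda=C^{0,1}(\Sigma).$$ Then the following assertions hold. (i) For every $\lambda\le 0$, $B_\lambda$ is a well-defined (the limit exists for all $h\in C^{0,1}(\Sigma)$ and $x\in\Sigma$, and $B_\lambda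 h\in L^2(\Sigma)$), essentially selfadjoint operator in $L^2(\Sigma)$, and $\operatorname{dom}\overline{B_\lambda}=\operatorname{dom}\overline{B_0}$. (ii) For every $\lambda\le 0$, $\overline{B_\lambda}$ is bounded from above and has a compact resolvent. (iii) For every $\lambda\le 0$ the eigenvalues of $\overline{B_\lambda}$, counted with multiplicities, can be arranged in a nonincreasing sequence $\nu_1(\lambda)\ge\nu_2(\lambda)\ge\dots$, and they satisfy $$\nu_k(\lambda)=-\frac{\ln k}{2\pi}+O(1)\qquad\text{as } k\to+\infty .$$ (iv) For every $k\in\mathbb{N}=\{1,2,\dots\}$ the function $\lambda\mapsto\nu_k(\lambda)$ is continuous and strictly increasing on $(-\infty,0]$, and $\nu_k(\lambda)\to-\infty$ as $\lambda\to-\infty$. -/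

import Mathlib

open Filter Topology MeasureTheory Set
open scoped ENNReal InnerProductSpace

noncomputable section

/-- A compact, closed, regular `C²`-curve in `ℝ³` without self-intersections, of length `len`,
given by the `len`-periodic extension of its arc length parametrization. -/
structure ClosedCurve where
  len : ℝ
  param : ℝ → EuclideanSpace ℝ (Fin 3)
  len_pos : 0 < len
  contDiff : ContDiff ℝ 2 param
  periodic : Function.Periodic param len
  unit_speed : ∀ s, ‖deriv param s‖ = 1
  injOn : Set.InjOn param (Set.Ico 0 len)

namespace ClosedCurve

variable (C : ClosedCurve)

/-- The curve `Σ` as a subset of `ℝ³`. -/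
def carrier : Set (EuclideanSpace ℝ (Fin 3)) := Set.range C.param

/-- The parametrization as a map into `Σ`. -/
def point (s : ℝ) : C.carrier := ⟨C.param s, s, rfl⟩

/-- The arc length measure `dσ` on `Σ`. -/
def arcLength : Measure C.carrier := (volume.restrict (Set.Ico 0 C.len)).map C.point

/-- The Hilbert space `L²(Σ)` of complex-valued functions. -/
abbrev L2 : Type := Lp ℂ 2 C.arcLength

/-- The open interval `I_δ(x) = {σ(s) : s ∈ (s₀ - δ, s₀ + δ)}` in `Σ`, where `x = σ(s₀)`. -/
def interval (δ : ℝ) (x : C.carrier) : Set C.carrier :=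
  {y | ∃ s₀ s : ℝ, x = C.point s₀ ∧ y = C.point s ∧ s ∈ Set.Ioo (s₀ - δ) (s₀ + δ)}

/-- The kernel `exp(-√(-λ) |x - y|) / (4 π |x - y|)`. -/
def kernel (lam : ℝ) (x y : C.carrier) : ℝ :=
  Real.exp (-Real.sqrt (-lam) * dist x y) / (4 * Real.pi * dist x y)

/-- The bracket
`∫_{Σ \ I_δ(x)} h(y) exp(-√(-λ) |x - y|) / (4 π |x - y|) dσ(y) + h(x) ln δ / (2 π)`. -/
def truncated (lam : ℝ) (h : C.carrier → ℂ) (x : C.carrier) (δ : ℝ) : ℂ :=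
  (∫ y in (C.interval δ x)ᶜ, h y * (C.kernel lam x y : ℂ) ∂C.arcLength)
    + h x * ((Real.log δ / (2 * Real.pi) : ℝ) : ℂ)

/-- `k` is the pointwise limit, as `δ ↘ 0`, of the brackets formed with `h`. -/
def IsRegularization (lam : ℝ) (h k : C.carrier → ℂ) : Prop :=
  ∀ x, Tendsto (C.truncated lam h x) (𝓝[>] 0) (𝓝 (k x))

/-- Membership in `C^{0,1}(Σ)`. -/
def IsLip (h : C.carrier → ℂ) : Prop := ∃ K : NNReal, LipschitzWith K h

theorem continuous_point : Continuous C.point :=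
  C.contDiff.continuous.subtype_mk _

instance : IsFiniteMeasure C.arcLength := by
  unfold arcLength; infer_instance

theorem integrable_truncated (lam : ℝ) {h : C.carrier → ℂ} (hh : Continuous h)
    (x : C.carrier) {δ : ℝ} (hδ : 0 < δ) :
    IntegrableOn (fun y => h y * (C.kernel lam x y : ℂ)) (C.interval δ x)ᶜ C.arcLength := by
  obtain ⟨_, s₀, rfl⟩ := x
  change IntegrableOn (fun y => h y * (C.kernel lam (C.point s₀) y : ℂ))
    (C.interval δ (C.point s₀))ᶜ C.arcLength
  set K : Set C.carrier := C.point '' Set.Icc (s₀ + δ) (s₀ + C.len - δ) with hK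
  have hKc : IsCompact K := isCompact_Icc.image C.continuous_point
  have hsub : (C.interval δ (C.point s₀))ᶜ ⊆ K := by
    rintro ⟨_, s, rfl⟩ hy
    obtain ⟨t, ht, hts⟩ := C.periodic.exists_mem_Ico C.len_pos s s₀
    refine ⟨t, ⟨?_, ?_⟩, Subtype.ext hts.symm⟩
    · by_contra! hlt
      exact hy ⟨s₀, t, rfl, Subtype.ext hts, by linarith [ht.1], hlt⟩
    · by_contra! hlt
      refine hy ⟨s₀, t - C.len, rfl, Subtype.ext ?_, by linarith, by linarith [ht.2]⟩
      change C.param s = C.param (t - C.len)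
      rw [C.periodic.sub_eq, hts]
  have hne : ∀ y ∈ K, dist (C.point s₀) y ≠ 0 := by
    rintro _ ⟨t, ht, rfl⟩ h0
    have he : C.param s₀ = C.param t := congrArg Subtype.val (dist_eq_zero.1 h0)
    have hper : ∀ s, C.param (toIcoMod C.len_pos 0 s) = C.param s := fun s => by
      rw [toIcoMod, C.periodic.sub_zsmul_eq]
    have hmem : ∀ s, toIcoMod C.len_pos 0 s ∈ Set.Ico 0 C.len := fun s => by
      simpa using toIcoMod_mem_Ico C.len_pos 0 s
    have hm := C.injOn (hmem s₀) (hmem t) (by rw [hper, hper, he])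
    rw [toIcoMod_inj, AddCommGroup.modEq_iff_zsmul] at hm
    obtain ⟨n, hn⟩ := hm
    have hL := C.len_pos
    rw [zsmul_eq_mul] at hn
    have h1 : 0 < (n : ℝ) * C.len := by linarith [ht.1]
    have h2 : (n : ℝ) * C.len < 1 * C.len := by linarith [ht.2]
    have h3 : (0 : ℝ) < n := by
      by_contra! hc
      nlinarith
    have h4 : (n : ℝ) < 1 := lt_of_mul_lt_mul_right h2 hL.le
    have h5 : 0 < n := by exact_mod_cast h3
    have h6 : n < 1 := by exact_mod_cast h4
    omega
  have hcont : ContinuousOn (fun y => h y * (C.kernel lam (C.point s₀) y : ℂ)) K := by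
    refine hh.continuousOn.mul (Complex.continuous_ofReal.comp_continuousOn ?_)
    unfold kernel
    refine ContinuousOn.div (by fun_prop) (by fun_prop) fun y hy => ?_
    exact mul_ne_zero (by positivity) (hne y hy)
  exact (hcont.integrableOn_compact hKc).mono_set hsub

theorem IsRegularization.add {lam : ℝ} {h₁ k₁ h₂ k₂ : C.carrier → ℂ}
    (c₁ : Continuous h₁) (c₂ : Continuous h₂)
    (H₁ : C.IsRegularization lam h₁ k₁) (H₂ : C.IsRegularization lam h₂ k₂) :
    C.IsRegularization lam (h₁ + h₂) (k₁ + k₂) := by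
  intro x
  refine ((H₁ x).add (H₂ x)).congr' ?_
  filter_upwards [self_mem_nhdsWithin] with δ hδ
  have := integral_add (C.integrable_truncated lam c₁ x hδ) (C.integrable_truncated lam c₂ x hδ)
  simp only [truncated, Pi.add_apply, add_mul]
  rw [this]
  ring

theorem IsRegularization.smul {lam : ℝ} {h k : C.carrier → ℂ} (c : ℂ)
    (H : C.IsRegularization lam h k) : C.IsRegularization lam (c • h) (c • k) := by
  intro x
  refine ((H x).const_mul c).congr fun δ => ?_
  simp only [truncated, Pi.smul_apply, smul_eq_mul, mul_assoc]
  rw [integral_const_mul]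
  ring

/-- The graph of `B_λ`: all pairs in `L²(Σ) × L²(Σ)` represented by `(h, B_λ h)` with
`h ∈ C^{0,1}(Σ)`. -/
def graphB (lam : ℝ) : Submodule ℂ (C.L2 × C.L2) where
  carrier := {p | ∃ h k : C.carrier → ℂ, C.IsLip h ∧ C.IsRegularization lam h k ∧
    p.1 =ᵐ[C.arcLength] h ∧ p.2 =ᵐ[C.arcLength] k}
  add_mem' := by
    rintro p q ⟨h₁, k₁, ⟨K₁, l₁⟩, r₁, a₁, b₁⟩ ⟨h₂, k₂, ⟨K₂, l₂⟩, r₂, a₂, b₂⟩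
    exact ⟨h₁ + h₂, k₁ + k₂, ⟨_, l₁.add l₂⟩,
      IsRegularization.add C l₁.continuous l₂.continuous r₁ r₂,
      (Lp.coeFn_add _ _).trans (a₁.add a₂), (Lp.coeFn_add _ _).trans (b₁.add b₂)⟩
  zero_mem' := by
    refine ⟨0, 0, ⟨0, LipschitzWith.const 0⟩, fun x => ?_, Lp.coeFn_zero _ _ _,
      Lp.coeFn_zero _ _ _⟩
    have h0 : C.truncated lam 0 x = fun _ => 0 := by
      ext δ
      simp [truncated]
    rw [h0]
    exact tendsto_const_nhds
  smul_mem' := by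
    rintro c p ⟨h, k, ⟨K, l⟩, r, a, b⟩
    exact ⟨c • h, c • k, ⟨_, (lipschitzWith_smul c).comp l⟩, IsRegularization.smul C c r,
      (Lp.coeFn_smul _ _).trans (a.const_smul c), (Lp.coeFn_smul _ _).trans (b.const_smul c)⟩

/-- The operator `B_λ` in `L²(Σ)` with domain `C^{0,1}(Σ)`. -/
def B (lam : ℝ) : C.L2 →ₗ.[ℂ] C.L2 := (C.graphB lam).toLinearPMap

end ClosedCurve

section Operators

variable {H : Type*} [NormedAddCommGroup H] [InnerProductSpace ℂ H] [CompleteSpace H]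

/-- A densely defined symmetric operator whose closure is selfadjoint. -/
def IsEssentiallySelfAdjoint (T : H →ₗ.[ℂ] H) : Prop :=
  Dense (T.domain : Set H) ∧ T.IsFormalAdjoint T ∧ T.IsClosable ∧ IsSelfAdjoint T.closure

/-- `⟨T f, f⟩ ≤ c ‖f‖²` on the domain, for some real `c`. -/
def IsBoundedAbove (T : H →ₗ.[ℂ] H) : Prop :=
  ∃ c : ℝ, ∀ f : T.domain, (⟪(f : H), T f⟫_ℂ).re ≤ c * ‖(f : H)‖ ^ 2

/-- `z` is in the resolvent set of `T` and `R = (T - z)⁻¹`. -/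
def IsResolventAt (T : H →ₗ.[ℂ] H) (z : ℂ) (R : H →L[ℂ] H) : Prop :=
  (∀ g : H, ∃ f : T.domain, (f : H) = R g ∧ T f - z • (f : H) = g) ∧
    ∀ f : T.domain, R (T f - z • (f : H)) = f

/-- The resolvent set of `T` is nonempty and all resolvents are compact. -/
def HasCompactResolvent (T : H →ₗ.[ℂ] H) : Prop :=
  (∃ z R, IsResolventAt T z R) ∧ ∀ z R, IsResolventAt T z R → IsCompactOperator R

/-- The space `ker (T - z)`. -/
def eigenspaceAt (T : H →ₗ.[ℂ] H) (z : ℂ) : Submodule ℂ T.domain :=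
  LinearMap.ker (T.toFun - z • T.domain.subtype)

/-- `ν 0 ≥ ν 1 ≥ ν 2 ≥ …` are all the eigenvalues of `T`, counted with multiplicities: each
complex number `z` occurs in the sequence exactly `dim ker (T - z)` times. -/
def IsEigenvalueSequence (T : H →ₗ.[ℂ] H) (ν : ℕ → ℝ) : Prop :=
  Antitone ν ∧ ∀ z : ℂ,
    {k : ℕ | (ν k : ℂ) = z}.encard = Cardinal.toENat (Module.rank ℂ (eigenspaceAt T z))

end Operators

end

noncomputable section

/-! ### Bounded perturbations of diagonal operators -/

section Abstract

variable {ι H : Type*} [NormedAddCommGroup H] [InnerProductSpace ℂ H]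

/-! Write `r` for the chord `|x - y|`, `d` for the shorter arc between `x` and `y`, and `κ = √(-λ)`.
The kernel is split as `exp(-κ r) / (4π r) = 1 / (4π d) + m_λ(x, y)`. A `C²` curve satisfies `1/r -
1/d ≤ M` (`exists_chord_arc`), and `(1 - exp(-κ r)) / r ≤ κ`, so `m_λ` is bounded and defines a
bounded symmetric operator `S_λ` (`smoothOp`).

The singular part does not depend on `λ` and is invariant under rotations of the circle `ℝ / L ℤ`.
Outside the arc of radius `δ` it integrates to `(log (L/2) - log δ) / (2π)`, so the counterterm
`h(x) log δ / (2π)` cancels exactly. What remains is `∫ (h y - h x) / (4π d) + h x log (L/2) / (2π)`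
(`IsLip.isRegularization`). Fourier modes diagonalize it, with multiplier `-log (1 + |n|) / (2π) +
O(1)` (`exists_abs_multiplier_add_log_le`). Since the modes are Lipschitz, they form a core, and the
closure of `B_λ` is `diag(multiplier) + S_λ` on the maximal domain of the diagonal part
(`graph_closure_B`).

Selfadjointness, independence of the domain from `λ`, semiboundedness and compactness of the
resolvent are then facts about bounded symmetric perturbations of a real diagonal tending to `-∞`.
Applying the spectral theorem to one resolvent produces an eigenbasis (`exists_eigenbasis`). Min-max
against the Fourier basis gives the asymptotics, because a factor of two in counting modes and the
bound `‖S_λ‖` each cost only `O(1)`.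

Continuity in `λ` follows from min-max and `‖S_λ - S_μ‖ = O(|√(-λ) - √(-μ)|)`. Strict monotonicity
holds because the difference of two Yukawa kernels is a superposition of Gaussians with positive
weight, and a Gaussian form is an integral of `|Fourier transform|²` against a positive density
(`re_inner_smoothOp_sub_pos`). For the limit `-∞`, positivity of the kernel bounds the form of `B_λ`
by that of multiplication by `V_λ = B_λ 1` (`IsLip.re_inner_le`), and `V_λ → -∞` uniformly on the
curve (`eventually_potential_le`). -/

theorem HilbertBasis.ext_inner (b : HilbertBasis ι ℂ H) {x y : H}
    (h : ∀ i, ⟪b i, x⟫_ℂ = ⟪b i, y⟫_ℂ) : x = y := by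
  apply b.repr.injective
  ext i
  simpa only [b.repr_apply_apply] using h i

theorem HilbertBasis.inner_self_eq (b : HilbertBasis ι ℂ H) (i : ι) : ⟪b i, b i⟫_ℂ = 1 := by
  have := b.orthonormal.1 i
  rw [inner_self_eq_norm_sq_to_K, this]; simp

theorem HilbertBasis.inner_ne (b : HilbertBasis ι ℂ H) {i j : ι} (h : i ≠ j) :
    ⟪b i, b j⟫_ℂ = 0 := b.orthonormal.2 h

theorem HilbertBasis.hasSum_norm_sq (b : HilbertBasis ι ℂ H) (x : H) :
    HasSum (fun i => ‖⟪b i, x⟫_ℂ‖ ^ 2) (‖x‖ ^ 2) := by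
  have h := (b.hasSum_inner_mul_inner x x).mapL Complex.reCLM
  convert h using 1
  · ext i
    rw [← inner_conj_symm x (b i), Complex.conj_mul']
    simp only [Complex.reCLM_apply]
    norm_cast
  · rw [inner_self_eq_norm_sq_to_K]
    simp only [Complex.reCLM_apply]
    norm_cast

/-- A weakly diagonal pair has quadratic form at most the largest occurring diagonal entry. -/
theorem HilbertBasis.re_inner_le (b : HilbertBasis ι ℂ H) {a : ι → ℝ} {f g : H}
    (h : ∀ i, ⟪b i, g⟫_ℂ = a i * ⟪b i, f⟫_ℂ) {β : ℝ}
    (hβ : ∀ i, ⟪b i, f⟫_ℂ ≠ 0 → a i ≤ β) : (⟪f, g⟫_ℂ).re ≤ β * ‖f‖ ^ 2 := by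
  have h1 := (b.hasSum_inner_mul_inner f g).mapL Complex.reCLM
  refine hasSum_le (fun i => ?_) h1 ((b.hasSum_norm_sq f).mul_left β)
  rw [h i, ← inner_conj_symm f (b i), mul_left_comm, Complex.conj_mul']
  simp only [Complex.reCLM_apply]
  norm_cast
  by_cases h0 : ⟪b i, f⟫_ℂ = 0
  · simp [h0]
  · exact mul_le_mul_of_nonneg_right (hβ i h0) (by positivity)

theorem HilbertBasis.le_re_inner (b : HilbertBasis ι ℂ H) {a : ι → ℝ} {f g : H}
    (h : ∀ i, ⟪b i, g⟫_ℂ = a i * ⟪b i, f⟫_ℂ) {α : ℝ}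
    (hα : ∀ i, ⟪b i, f⟫_ℂ ≠ 0 → α ≤ a i) : α * ‖f‖ ^ 2 ≤ (⟪f, g⟫_ℂ).re := by
  have := b.re_inner_le (a := fun i => -a i) (f := f) (g := -g) (β := -α)
    (fun i => by simp [h i]) (fun i hi => neg_le_neg (hα i hi))
  simp only [inner_neg_right, Complex.neg_re] at this
  linarith

/-- The graph of the operator `diag(a) + S` on its maximal domain, in the Hilbert basis `b`. -/
def HilbertBasis.diagGraph (b : HilbertBasis ι ℂ H) (a : ι → ℝ) (S : H →L[ℂ] H) :
    Submodule ℂ (H × H) where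
  carrier := {p | ∀ i, ⟪b i, p.2⟫_ℂ = a i * ⟪b i, p.1⟫_ℂ + ⟪b i, S p.1⟫_ℂ}
  add_mem' := by
    intro p q hp hq i
    simp only [Prod.fst_add, Prod.snd_add, map_add, inner_add_right, hp i, hq i]
    ring
  zero_mem' := by intro i; simp
  smul_mem' := by
    intro c p hp i
    simp only [Prod.smul_fst, Prod.smul_snd, map_smul, inner_smul_right, hp i]
    ring

variable {b : HilbertBasis ι ℂ H} {a : ι → ℝ} {S : H →L[ℂ] H}

theorem HilbertBasis.mem_diagGraph {f g : H} : (f, g) ∈ b.diagGraph a S ↔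
    ∀ i, ⟪b i, g⟫_ℂ = a i * ⟪b i, f⟫_ℂ + ⟪b i, S f⟫_ℂ := Iff.rfl

/-- Subtracting the bounded part leaves a weakly diagonal pair, to which Parseval arguments with
real entries apply. -/
theorem HilbertBasis.mem_diagGraph_iff_sub {f g : H} : (f, g) ∈ b.diagGraph a S ↔
    ∀ i, ⟪b i, g - S f⟫_ℂ = a i * ⟪b i, f⟫_ℂ := by
  simp only [mem_diagGraph, inner_sub_right, sub_eq_iff_eq_add]

/-- As `S` and `S'` are defined everywhere, the domain does not see them. This is behind both the
equality of domains and the comparison of eigenvalues. -/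
theorem HilbertBasis.mem_diagGraph_change {S' : H →L[ℂ] H} {f g : H}
    (h : (f, g) ∈ b.diagGraph a S) : (f, g + (S' - S) f) ∈ b.diagGraph a S' := by
  intro i
  have := h i
  simp only [sub_apply, inner_add_right, inner_sub_right] at this ⊢
  rw [this]; ring

/-- However unbounded `a` is, each coordinate condition is continuous in the pair, so no separate
closedness argument for the diagonal part is needed. -/
theorem HilbertBasis.isClosed_diagGraph : IsClosed (b.diagGraph a S : Set (H × H)) := by
  have : (b.diagGraph a S : Set (H × H)) =
      ⋂ i, {p | ⟪b i, p.2⟫_ℂ = a i * ⟪b i, p.1⟫_ℂ + ⟪b i, S p.1⟫_ℂ} := by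
    ext p; simp [HilbertBasis.diagGraph]
  rw [this]
  exact isClosed_iInter fun i => isClosed_eq (by fun_prop) (by fun_prop)

theorem HilbertBasis.basis_mem_diagGraph (i : ι) :
    (b i, (a i : ℂ) • b i + S (b i)) ∈ b.diagGraph a S := by
  classical
  intro j
  simp only [inner_add_right, inner_smul_right]
  by_cases h : j = i
  · subst h; rfl
  · simp [b.inner_ne h]

theorem HilbertBasis.diagGraph_snd_eq {f g g' : H} (h : (f, g) ∈ b.diagGraph a S)
    (h' : (f, g') ∈ b.diagGraph a S) : g = g' :=
  b.ext_inner fun i => (h i).trans (h' i).symm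

/-- By Parseval the diagonal parts of both sides are the same series, because the entries `a i` are
real. -/
theorem HilbertBasis.diagGraph_symm (hS : (S : H →ₗ[ℂ] H).IsSymmetric) {f g f' g' : H}
    (h : (f, g) ∈ b.diagGraph a S) (h' : (f', g') ∈ b.diagGraph a S) :
    ⟪g, f'⟫_ℂ = ⟪f, g'⟫_ℂ := by
  rw [mem_diagGraph_iff_sub] at h h'
  have h1 : ⟪g - S f, f'⟫_ℂ = ⟪f, g' - S f'⟫_ℂ := by
    rw [← (b.hasSum_inner_mul_inner (g - S f) f').tsum_eq,
      ← (b.hasSum_inner_mul_inner f (g' - S f')).tsum_eq]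
    congr 1; ext i
    rw [h' i, ← inner_conj_symm _ (b i), h i, ← inner_conj_symm f (b i)]
    simp only [map_mul, Complex.conj_ofReal]; ring
  have h2 : ⟪S f, f'⟫_ℂ = ⟪f, S f'⟫_ℂ := hS f f'
  simp only [inner_sub_left, inner_sub_right] at h1
  rw [h2] at h1
  exact sub_left_injective h1

/-- An operator contained in `diag(a) + S` whose domain contains the basis has closure
`diag(a) + S`. -/
theorem HilbertBasis.topologicalClosure_eq_diagGraph {G : Submodule ℂ (H × H)}
    (hG : G ≤ b.diagGraph a S) (hb : ∀ i, ∃ g, (b i, g) ∈ G) :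
    G.topologicalClosure = b.diagGraph a S := by
  apply le_antisymm (G.topologicalClosure_minimal hG isClosed_diagGraph)
  rintro ⟨f, g⟩ hfg
  have hbG : ∀ i, (b i, (a i : ℂ) • b i + S (b i)) ∈ G := fun i => by
    obtain ⟨g, hg⟩ := hb i
    rwa [diagGraph_snd_eq (basis_mem_diagGraph i) (hG hg)]
  have h1 := b.hasSum_repr f
  have h2 := (b.hasSum_repr (g - S f)).add (h1.mapL S)
  rw [sub_add_cancel] at h2
  -- The coefficients of `g - S f` are `a i` times those of `f`, so the expansions of `f` and `g`
  -- are the two components of a single series with terms in `G`.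
  have h3 : HasSum (fun i => ⟪b i, f⟫_ℂ • (b i, (a i : ℂ) • b i + S (b i))) (f, g) := by
    have := HasSum.prodMk h1 h2
    convert this using 2 with i
    simp only [b.repr_apply_apply, mem_diagGraph_iff_sub.1 hfg i, map_smul, Prod.smul_mk, smul_add,
      smul_smul]
    rw [mul_comm]
  exact mem_closure_of_tendsto h3 (Eventually.of_forall fun s =>
    sum_mem fun i _ => G.smul_mem _ (hbG i))

/-! ### Closure and selfadjointness of operators contained in a perturbed diagonal -/

section Op

variable {B : H →ₗ.[ℂ] H}

theorem HilbertBasis.isClosable_of_le (hG : B.graph ≤ b.diagGraph a S) : B.IsClosable := by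
  refine ⟨B.graph.topologicalClosure.toLinearPMap, ?_⟩
  rw [Submodule.toLinearPMap_graph_eq]
  rintro ⟨x, y⟩ hxy (rfl : x = 0)
  have h := B.graph.topologicalClosure_minimal hG isClosed_diagGraph hxy
  exact diagGraph_snd_eq h (Submodule.zero_mem _)

theorem HilbertBasis.graph_closure_eq (hG : B.graph ≤ b.diagGraph a S)
    (hb : ∀ i, b i ∈ B.domain) : B.closure.graph = b.diagGraph a S := by
  rw [← (isClosable_of_le hG).graph_closure_eq_closure_graph]
  refine topologicalClosure_eq_diagGraph hG fun i => ?_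
  exact ⟨B ⟨b i, hb i⟩, B.mem_graph ⟨b i, hb i⟩⟩

theorem HilbertBasis.dense_domain (hb : ∀ i, b i ∈ B.domain) : Dense (B.domain : Set H) := by
  have : (Submodule.span ℂ (range b)) ≤ B.domain := Submodule.span_le.2 (by
    rintro _ ⟨i, rfl⟩; exact hb i)
  exact (Submodule.dense_iff_topologicalClosure_eq_top.2 b.dense_span).mono this

/-- Testing the adjoint relation on basis vectors alone already yields the coordinate conditions
defining the graph; the converse inclusion is symmetry. -/
theorem HilbertBasis.isSelfAdjoint_of_graph [CompleteSpace H] (hS : (S : H →ₗ[ℂ] H).IsSymmetric)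
    {T : H →ₗ.[ℂ] H} (hT : T.graph = b.diagGraph a S) : IsSelfAdjoint T := by
  have hb : ∀ i, b i ∈ T.domain := fun i =>
    LinearPMap.mem_domain_of_mem_graph (hT ▸ basis_mem_diagGraph i)
  rw [LinearPMap.isSelfAdjoint_def]
  apply LinearPMap.eq_of_eq_graph
  rw [LinearPMap.adjoint_graph_eq_graph_adjoint (dense_domain hb), hT]
  ext ⟨y, w⟩
  rw [Submodule.mem_adjoint_iff]
  constructor
  · intro h i
    have := h _ _ (basis_mem_diagGraph i)
    simp only [inner_add_left, inner_smul_left, Complex.conj_ofReal] at this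
    have h2 : ⟪S (b i), y⟫_ℂ = ⟪b i, S y⟫_ℂ := hS _ _
    rw [h2] at this
    exact (sub_eq_zero.1 this).symm
  · intro h f g hfg
    exact sub_eq_zero.2 (diagGraph_symm hS hfg h)

theorem HilbertBasis.isEssentiallySelfAdjoint [CompleteSpace H] (hS : (S : H →ₗ[ℂ] H).IsSymmetric)
    (hG : B.graph ≤ b.diagGraph a S) (hb : ∀ i, b i ∈ B.domain) :
    IsEssentiallySelfAdjoint B :=
  ⟨dense_domain hb, fun x y => diagGraph_symm hS (hG (B.mem_graph x)) (hG (B.mem_graph y)),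
    isClosable_of_le hG, isSelfAdjoint_of_graph hS (graph_closure_eq hG hb)⟩

theorem re_inner_apply_le (S : H →L[ℂ] H) (f : H) : (⟪f, S f⟫_ℂ).re ≤ ‖S‖ * ‖f‖ ^ 2 := by
  calc (⟪f, S f⟫_ℂ).re ≤ ‖⟪f, S f⟫_ℂ‖ := Complex.re_le_norm _
    _ ≤ ‖f‖ * ‖S f‖ := norm_inner_le_norm _ _
    _ ≤ ‖f‖ * (‖S‖ * ‖f‖) := by gcongr; exact S.le_opNorm f
    _ = _ := by ring

theorem neg_le_re_inner_apply (S : H →L[ℂ] H) (f : H) :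
    -(‖S‖ * ‖f‖ ^ 2) ≤ (⟪f, S f⟫_ℂ).re := by
  have := re_inner_apply_le (-S) f
  simp only [neg_apply, inner_neg_right, Complex.neg_re, norm_neg] at this
  linarith

theorem HilbertBasis.diagGraph_re_le {f g : H} (h : (f, g) ∈ b.diagGraph a S) {β : ℝ}
    (hβ : ∀ i, ⟪b i, f⟫_ℂ ≠ 0 → a i ≤ β) : (⟪f, g⟫_ℂ).re ≤ (β + ‖S‖) * ‖f‖ ^ 2 := by
  have h1 := b.re_inner_le (mem_diagGraph_iff_sub.1 h) hβ
  have h2 := re_inner_apply_le S f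
  simp only [inner_sub_right, Complex.sub_re] at h1
  linarith

theorem HilbertBasis.le_diagGraph_re {f g : H} (h : (f, g) ∈ b.diagGraph a S) {α : ℝ}
    (hα : ∀ i, ⟪b i, f⟫_ℂ ≠ 0 → α ≤ a i) : (α - ‖S‖) * ‖f‖ ^ 2 ≤ (⟪f, g⟫_ℂ).re := by
  have h1 := b.le_re_inner (mem_diagGraph_iff_sub.1 h) hα
  have h2 := neg_le_re_inner_apply S f
  simp only [inner_sub_right, Complex.sub_re] at h1
  linarith

end Op

end Abstract

/-! ### Compact diagonal operators and resolvents -/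

section Abstract

variable {ι H : Type*} [NormedAddCommGroup H] [InnerProductSpace ℂ H]

theorem HilbertBasis.norm_le_of_inner_le (b : HilbertBasis ι ℂ H) {x y : H} {M : ℝ} (hM : 0 ≤ M)
    (h : ∀ i, ‖⟪b i, y⟫_ℂ‖ ≤ M * ‖⟪b i, x⟫_ℂ‖) : ‖y‖ ≤ M * ‖x‖ := by
  have h1 : ‖y‖ ^ 2 ≤ M ^ 2 * ‖x‖ ^ 2 := by
    refine hasSum_le (fun i => ?_) (b.hasSum_norm_sq y) ((b.hasSum_norm_sq x).mul_left (M ^ 2))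
    rw [← mul_pow]
    exact pow_le_pow_left₀ (norm_nonneg _) (h i) 2
  rw [← mul_pow] at h1
  exact le_of_sq_le_sq h1 (by positivity)

theorem isCompactOperator_rankOne (u v : H) :
    IsCompactOperator ((innerSL ℂ u).smulRight v : H →L[ℂ] H) := by
  have h : IsCompactOperator (ContinuousLinearMap.toSpanSingleton ℂ v) :=
    isCompactOperator_of_locallyCompactSpace_rng (ContinuousLinearMap.toSpanSingleton ℂ v)
  exact h.comp_clm (innerSL ℂ u)

theorem isCompactOperator_sum {κ : Type*} (s : Finset κ) {F : κ → H →L[ℂ] H}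
    (hF : ∀ i ∈ s, IsCompactOperator (F i)) :
    IsCompactOperator ((∑ i ∈ s, F i : H →L[ℂ] H)) := by
  classical
  induction s using Finset.induction_on with
  | empty => exact isCompactOperator_zero
  | insert i s hi ih =>
    rw [Finset.sum_insert hi]
    exact (hF i (by simp)).add (ih fun j hj => hF j (by simp [hj]))

/-- The rank-one pieces are summable in operator norm: they are mutually orthogonal, so the norm of
a finite sum is governed by the largest `|d i|` in it, which is small off a finite set. -/
theorem HilbertBasis.exists_compact_diag [CompleteSpace H] (b : HilbertBasis ι ℂ H) {d : ι → ℝ}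
    (hd : Tendsto d cofinite (𝓝 0)) :
    ∃ R : H →L[ℂ] H, IsCompactOperator R ∧ ∀ i x, ⟪b i, R x⟫_ℂ = d i * ⟪b i, x⟫_ℂ := by
  classical
  set F : ι → H →L[ℂ] H := fun i => (innerSL ℂ (b i)).smulRight ((d i : ℂ) • b i) with hF
  have hFx : ∀ (t : Finset ι) (x : H) (j : ι),
      ⟪b j, (∑ i ∈ t, F i) x⟫_ℂ = if j ∈ t then d j * ⟪b j, x⟫_ℂ else 0 := by
    intro t x j
    rw [sum_apply, inner_sum]
    have : ∀ i ∈ t, ⟪b j, F i x⟫_ℂ = if j = i then d j * ⟪b j, x⟫_ℂ else 0 := by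
      intro i _
      simp only [hF, ContinuousLinearMap.smulRight_apply, innerSL_apply_apply, inner_smul_right]
      split_ifs with h
      · subst h; rw [b.inner_self_eq]; ring
      · rw [b.inner_ne h]; ring
    rw [Finset.sum_congr rfl this, Finset.sum_ite_eq]
  have hsum : Summable F := by
    rw [summable_iff_vanishing_norm]
    intro ε hε
    have hfin : {i | ¬ (|d i| < ε / 2)}.Finite := by
      have := (Metric.tendsto_nhds.1 hd (ε / 2) (by positivity))
      simpa [Filter.eventually_cofinite, Real.dist_eq] using this
    refine ⟨hfin.toFinset, fun t ht => ?_⟩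
    refine lt_of_le_of_lt (ContinuousLinearMap.opNorm_le_bound _ (by positivity : 0 ≤ ε / 2)
      fun x => b.norm_le_of_inner_le (by positivity) fun j => ?_) (by linarith)
    rw [hFx]
    split_ifs with hj
    · have : |d j| < ε / 2 := by
        by_contra hc
        exact Finset.disjoint_left.1 ht hj (by simpa using hc)
      rw [norm_mul, Complex.norm_real, Real.norm_eq_abs]
      gcongr
    · rw [norm_zero]; positivity
  refine ⟨∑' i, F i, ?_, fun j x => ?_⟩
  · exact isCompactOperator_of_tendsto hsum.hasSum (Eventually.of_forall fun t =>
      isCompactOperator_sum t fun i _ => isCompactOperator_rankOne _ _)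
  · have h1 : Tendsto (fun t : Finset ι => ⟪b j, (∑ i ∈ t, F i) x⟫_ℂ) atTop
        (𝓝 ⟪b j, (∑' i, F i) x⟫_ℂ) := by
      have hc : Continuous fun A : H →L[ℂ] H => ⟪b j, A x⟫_ℂ := by fun_prop
      exact (hc.tendsto _).comp hsum.hasSum
    refine tendsto_nhds_unique h1 (tendsto_const_nhds.congr' ?_)
    filter_upwards [eventually_ge_atTop {j}] with t ht
    rw [hFx, if_pos (by simpa using ht)]

theorem bddAbove_of_tendsto_cofinite_atBot {a : ι → ℝ} (ha : Tendsto a cofinite atBot) :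
    ∃ M, ∀ i, a i ≤ M := by
  have hfin : {i | ¬ (a i ≤ 0)}.Finite := by
    simpa [Filter.eventually_cofinite] using ha.eventually (eventually_le_atBot 0)
  obtain ⟨M, hM⟩ := (hfin.image a).bddAbove
  refine ⟨max M 0, fun i => ?_⟩
  by_cases h : a i ≤ 0
  · exact h.trans (le_max_right _ _)
  · exact (hM ⟨i, h, rfl⟩).trans (le_max_left _ _)

variable {b : HilbertBasis ι ℂ H} {a : ι → ℝ} {S : H →L[ℂ] H}

/-- The resolvent of `diag(a) + S` at a large real point. -/
theorem HilbertBasis.exists_resolvent [CompleteSpace H] (ha : Tendsto a cofinite atBot)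
    (hS : (S : H →ₗ[ℂ] H).IsSymmetric) :
    ∃ (c : ℝ) (R : H →L[ℂ] H), IsCompactOperator R ∧
      (∀ f g, (f, g) ∈ b.diagGraph a S → f = R ((c : ℂ) • f - g)) ∧
      (∀ w, (R w, (c : ℂ) • R w - w) ∈ b.diagGraph a S) ∧
      (R : H →ₗ[ℂ] H).IsSymmetric ∧ (∀ w, 0 ≤ (⟪R w, w⟫_ℂ).re) ∧ Function.Injective R := by
  obtain ⟨M, hM⟩ := bddAbove_of_tendsto_cofinite_atBot ha
  -- The extra `1` makes `D = (c - diag a)⁻¹` have norm at most `1 / (‖S‖ + 1)`, hence `‖S D‖ < 1`,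
  -- and `1 - S D` is invertible by a Neumann series.
  set c : ℝ := M + ‖S‖ + 1 with hc
  have hca : ∀ i, ‖S‖ + 1 ≤ c - a i := fun i => by have := hM i; linarith
  have hcp : ∀ i, 0 < c - a i := fun i => by have := hca i; have := norm_nonneg S; linarith
  obtain ⟨D, hDc, hD⟩ := b.exists_compact_diag (d := fun i => (c - a i)⁻¹)
    ((tendsto_atTop_add_const_left _ c (tendsto_neg_atBot_atTop.comp ha)).inv_tendsto_atTop)
  have hDn : ‖D‖ ≤ (‖S‖ + 1)⁻¹ := by
    refine D.opNorm_le_bound (by positivity) fun x => b.norm_le_of_inner_le (by positivity)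
      fun i => ?_
    rw [hD, norm_mul, Complex.norm_real, Real.norm_eq_abs, abs_of_pos (inv_pos.2 (hcp i))]
    gcongr
    exact hca i
  have hSD : ‖S * D‖ < 1 := by
    calc ‖S * D‖ ≤ ‖S‖ * ‖D‖ := norm_mul_le _ _
      _ ≤ ‖S‖ * (‖S‖ + 1)⁻¹ := by gcongr
      _ < 1 := by
        rw [← div_eq_mul_inv, div_lt_one (by positivity)]
        linarith
  obtain ⟨V, hV⟩ := isUnit_one_sub_of_norm_lt_one hSD
  obtain ⟨W, hW1, hW2⟩ : ∃ W : H →L[ℂ] H, (∀ x, W x - S (D (W x)) = x) ∧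
      ∀ x, W (x - S (D x)) = x := by
    refine ⟨↑V⁻¹, fun x => ?_, fun x => ?_⟩
    · have := congrArg (fun A : H →L[ℂ] H => A x) V.mul_inv
      simpa [hV] using this
    · have := congrArg (fun A : H →L[ℂ] H => A x) V.inv_mul
      simpa [hV] using this
  -- `c - diag a - S = (1 - S D)(c - diag a)`, so the inverse is `D (1 - S D)⁻¹`; compactness is
  -- inherited from `D`.
  set R : H →L[ℂ] H := D * W with hR
  have hRG : ∀ w, (R w, (c : ℂ) • R w - w) ∈ b.diagGraph a S := by
    intro w i
    have h1 := hD i (W w)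
    have h2 : W w = w + S (R w) := by
      rw [← sub_eq_iff_eq_add]; exact hW1 w
    have h3 : (((c - a i : ℝ)) : ℂ) * ⟪b i, R w⟫_ℂ = ⟪b i, w⟫_ℂ + ⟪b i, S (R w)⟫_ℂ := by
      rw [← inner_add_right, ← h2]
      change _ * ⟪b i, D (W w)⟫_ℂ = _
      rw [h1, ← mul_assoc, ← Complex.ofReal_mul, mul_inv_cancel₀ (hcp i).ne']
      simp
    simp only [inner_sub_right, inner_smul_right]
    push_cast at h3
    linear_combination h3
  have hRI : ∀ f g, (f, g) ∈ b.diagGraph a S → f = R ((c : ℂ) • f - g) := by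
    intro f g h
    have h1 : D ((c : ℂ) • f - g + S f) = f := by
      refine b.ext_inner fun i => ?_
      have h2 := h i
      simp only at h2
      rw [hD]
      simp only [inner_add_right, inner_sub_right, inner_smul_right, h2]
      have : (((c - a i)⁻¹ : ℝ) : ℂ) * ((c - a i : ℝ) : ℂ) = 1 := by
        rw [← Complex.ofReal_mul, inv_mul_cancel₀ (hcp i).ne']; simp
      push_cast at this ⊢
      linear_combination ⟪b i, f⟫_ℂ * this
    have h2 := hW2 ((c : ℂ) • f - g + S f)
    rw [h1, add_sub_cancel_right] at h2
    change f = D (W _)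
    rw [h2, h1]
  refine ⟨c, R, hDc.comp_clm _, hRI, hRG, fun x y => ?_, fun w => ?_, fun x y hxy => ?_⟩
  · have := diagGraph_symm hS (hRG x) (hRG y)
    simp only [inner_sub_left, inner_sub_right, inner_smul_left, inner_smul_right,
      Complex.conj_ofReal] at this
    have h2 := sub_right_injective this
    exact h2.symm
  -- The form is at most `(c - 1) ‖R w‖²`, which leaves `re ⟪R w, w⟫ ≥ ‖R w‖²`.
  · have h := diagGraph_re_le (hRG w) (β := M) fun i _ => hM i
    simp only [inner_sub_right, inner_smul_right, Complex.sub_re, inner_self_eq_norm_sq_to_K] at h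
    have h1 : ((c : ℂ) * ((‖R w‖ : ℂ)) ^ 2).re = c * ‖R w‖ ^ 2 := by norm_cast
    have h2 : ((c : ℂ) * (((RCLike.ofReal ‖R w‖ : ℂ))) ^ 2).re = c * ‖R w‖ ^ 2 := h1
    rw [h2] at h
    have : 0 ≤ ‖R w‖ ^ 2 := by positivity
    nlinarith
  · have h1 := hRG (x - y)
    rw [map_sub, hxy, sub_self, smul_zero, zero_sub] at h1
    have h2 := diagGraph_snd_eq h1 (Submodule.zero_mem _)
    exact sub_eq_zero.1 (neg_eq_zero.1 h2)

/-! ### The spectral theorem for compact positive operators -/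

/-- For a positive operator `‖R‖` is the supremum of the Rayleigh quotients. Were `‖R‖` in the
resolvent set, these would stay a fixed distance below it; so it lies in the spectrum, and by
compactness it is an eigenvalue. -/
theorem exists_eigenvector_norm [CompleteSpace H] {R : H →L[ℂ] H} (hc : IsCompactOperator R)
    (hs : (R : H →ₗ[ℂ] H).IsSymmetric) (hp : ∀ x, 0 ≤ (⟪R x, x⟫_ℂ).re) (h0 : R ≠ 0) :
    ∃ u, ‖u‖ = 1 ∧ R u = (‖R‖ : ℂ) • u := by
  have hn : (‖R‖ : ℂ) ≠ 0 := by simpa using h0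
  have hnt : Nontrivial H := by
    by_contra hcon
    rw [not_nontrivial_iff_subsingleton] at hcon
    exact h0 (ContinuousLinearMap.ext fun x => Subsingleton.elim _ _)
  have hspec : (‖R‖ : ℂ) ∈ spectrum ℂ R := by
    by_contra hcon
    have hres : algebraMap ℝ ℂ ‖R‖ ∈ resolventSet ℂ R := by
      rw [spectrum, Set.mem_compl_iff, not_not] at hcon; exact hcon
    obtain ⟨ε, hε, h⟩ := R.rayleighQuotient_le_of_norm_mem_resolventSet hres
    have h1 : ‖R‖ ≤ ‖R‖ - ε := by
      conv_lhs => rw [R.norm_eq_iSup_rayleighQuotient hs]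
      refine ciSup_le fun x => ?_
      rw [abs_of_nonneg]
      · exact h x
      · rw [ContinuousLinearMap.rayleighQuotient, ContinuousLinearMap.reApplyInnerSelf_apply]
        exact div_nonneg (hp x) (by positivity)
    linarith
  obtain ⟨v, hv⟩ := ((hc.hasEigenvalue_iff_mem_spectrum hn).2 hspec).exists_hasEigenvector
  have hv1 : R v = (‖R‖ : ℂ) • v := hv.apply_eq_smul
  have hv0 : ‖v‖ ≠ 0 := by simpa using hv.2
  refine ⟨((‖v‖⁻¹ : ℝ) : ℂ) • v, ?_, ?_⟩
  · rw [norm_smul, Complex.norm_real, norm_inv, norm_norm, inv_mul_cancel₀ hv0]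
  · rw [map_smul, hv1, smul_comm]

/-- A compact positive injective operator on an infinite-dimensional Hilbert space has an
orthonormal basis of eigenvectors, with eigenvalues decreasing to zero. -/
theorem exists_hilbertBasis_eigenvectors [CompleteSpace H] {R : H →L[ℂ] H}
    (hc : IsCompactOperator R)
    (hs : (R : H →ₗ[ℂ] H).IsSymmetric) (hp : ∀ x, 0 ≤ (⟪R x, x⟫_ℂ).re)
    (hi : Function.Injective R) (hinf : ¬ FiniteDimensional ℂ H) :
    ∃ (u : HilbertBasis ℕ ℂ H) (ρ : ℕ → ℝ), Antitone ρ ∧ (∀ n, 0 < ρ n) ∧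
      Tendsto ρ atTop (𝓝 0) ∧ ∀ n, R (u n) = (ρ n : ℂ) • u n := by
  classical
  let P : Type _ := {A : H →L[ℂ] H // IsCompactOperator A ∧ (A : H →ₗ[ℂ] H).IsSymmetric ∧
    ∀ x, 0 ≤ (⟪A x, x⟫_ℂ).re}
  have hU : ∀ A : P, ∃ u : H, A.1 u = (‖A.1‖ : ℂ) • u ∧ (A.1 ≠ 0 → ‖u‖ = 1) := by
    rintro ⟨A, hA⟩
    by_cases h0 : A = 0
    · exact ⟨0, by simp, fun h => absurd h0 h⟩
    · obtain ⟨u, hu, hu'⟩ := exists_eigenvector_norm hA.1 hA.2.1 hA.2.2 h0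
      exact ⟨u, hu', fun _ => hu⟩
  choose U hUe hUn using hU
  let D : P → H →L[ℂ] H := fun A =>
    A.1 - (innerSL ℂ (U A)).smulRight ((‖A.1‖ : ℂ) • U A)
  have hD : ∀ A x, D A x = A.1 x - ((‖A.1‖ : ℂ) * ⟪U A, x⟫_ℂ) • U A := by
    intro A x
    simp only [D, sub_apply, ContinuousLinearMap.smulRight_apply, innerSL_apply_apply, smul_smul]
    rw [mul_comm]
  have hDu : ∀ A x, ⟪D A x, U A⟫_ℂ = 0 := by
    intro A x
    rw [hD, inner_sub_left, inner_smul_left]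
    have h1 : ⟪A.1 x, U A⟫_ℂ = ⟪x, A.1 (U A)⟫_ℂ := A.2.2.1 _ _
    rw [h1, hUe, inner_smul_right, map_mul, inner_conj_symm, Complex.conj_ofReal]
    by_cases h0 : A.1 = 0
    · simp [h0]
    · rw [inner_self_eq_norm_sq_to_K, hUn A h0]; simp
  have hDP : ∀ A, IsCompactOperator (D A) ∧ (D A : H →ₗ[ℂ] H).IsSymmetric ∧
      ∀ x, 0 ≤ (⟪D A x, x⟫_ℂ).re := by
    intro A
    refine ⟨A.2.1.sub (isCompactOperator_rankOne _ _), fun x y => ?_, fun x => ?_⟩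
    · change ⟪D A x, y⟫_ℂ = ⟪x, D A y⟫_ℂ
      have h1 : ⟪A.1 x, y⟫_ℂ = ⟪x, A.1 y⟫_ℂ := A.2.2.1 _ _
      rw [hD, hD, inner_sub_left, inner_sub_right, h1, inner_smul_left, inner_smul_right, map_mul,
        inner_conj_symm, Complex.conj_ofReal]
      ring
    · have h1 : D A x = A.1 (x - ⟪U A, x⟫_ℂ • U A) := by
        rw [hD, map_sub, map_smul, hUe, smul_smul, mul_comm]
      have h2 : ⟪D A x, x⟫_ℂ = ⟪D A x, x - ⟪U A, x⟫_ℂ • U A⟫_ℂ := by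
        rw [inner_sub_right, inner_smul_right, hDu]; ring
      rw [h2, h1]
      exact A.2.2.2 _
  let Q : ℕ → P := fun n => Nat.rec ⟨R, hc, hs, hp⟩ (fun _ A => ⟨D A, hDP A⟩) n
  have hQ0 : (Q 0).1 = R := rfl
  have hQs : ∀ n, (Q (n + 1)).1 = D (Q n) := fun n => rfl
  clear_value Q
  obtain ⟨u, hu⟩ : ∃ u : ℕ → H, ∀ n, u n = U (Q n) := ⟨_, fun n => rfl⟩
  obtain ⟨ρ, hρ⟩ : ∃ ρ : ℕ → ℝ, ∀ n, ρ n = ‖(Q n).1‖ := ⟨_, fun n => rfl⟩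
  have hQx : ∀ n x, (Q (n + 1)).1 x = (Q n).1 x - ((ρ n : ℂ) * ⟪u n, x⟫_ℂ) • u n :=
    fun n x => by rw [hQs, hD, hu, hρ]
  have hQsum : ∀ n x, (Q n).1 x =
      R x - ∑ j ∈ Finset.range n, ((ρ j : ℂ) * ⟪u j, x⟫_ℂ) • u j := by
    intro n x
    induction n with
    | zero => simp [hQ0]
    | succ n ih => rw [hQx, ih, Finset.sum_range_succ]; abel
  -- If the process stopped, `R` would have finite-dimensional range, which injectivity forbids in
  -- infinite dimension.
  have hQne : ∀ n, (Q n).1 ≠ 0 := by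
    intro n h0
    apply hinf
    set W : Submodule ℂ H := Submodule.span ℂ (u '' (Finset.range n : Set ℕ)) with hW
    have hfd : FiniteDimensional ℂ W :=
      FiniteDimensional.span_of_finite ℂ ((Finset.finite_toSet _).image _)
    have hmem : ∀ x, R x ∈ W := by
      intro x
      have h1 := hQsum n x
      rw [h0, zero_apply, eq_comm, sub_eq_zero] at h1
      rw [h1]
      exact sum_mem fun j hj => W.smul_mem _ (Submodule.subset_span ⟨j, hj, rfl⟩)
    exact FiniteDimensional.of_injective ((R : H →ₗ[ℂ] H).codRestrict W hmem)
      (fun x y hxy => hi (congrArg Subtype.val hxy))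
  have hρpos : ∀ n, 0 < ρ n := fun n => (hρ n).symm ▸ norm_pos_iff.2 (hQne n)
  have hρne : ∀ n, (ρ n : ℂ) ≠ 0 := fun n => by exact_mod_cast (hρpos n).ne'
  have hun : ∀ n, ‖u n‖ = 1 := fun n => (hu n).symm ▸ hUn _ (hQne n)
  have hue : ∀ n, (Q n).1 (u n) = (ρ n : ℂ) • u n := fun n => by
    rw [hu, hρ]; exact hUe _
  have huu : ∀ n, ⟪u n, u n⟫_ℂ = 1 := fun n => by
    rw [inner_self_eq_norm_sq_to_K, hun]; simp
  have horth_of : ∀ n y, (Q n).1 y = 0 → ⟪u n, y⟫_ℂ = 0 := by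
    intro n y hy
    have h1 : ⟪(Q n).1 (u n), y⟫_ℂ = ⟪u n, (Q n).1 y⟫_ℂ := (Q n).2.2.1 _ _
    rw [hy, hue, inner_zero_right, inner_smul_left, Complex.conj_ofReal] at h1
    exact (mul_eq_zero.1 h1).resolve_left (hρne n)
  -- Later operators annihilate earlier eigenvectors; by symmetry this makes the `u n` orthogonal.
  have hkill : ∀ n j, j < n → (Q n).1 (u j) = 0 := by
    intro n
    induction n with
    | zero => intro j hj; omega
    | succ n ih =>
      intro j hj
      rw [hQx]
      rcases Nat.lt_succ_iff_lt_or_eq.1 hj with h | rfl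
      · rw [ih j h, horth_of n _ (ih j h)]; simp
      · rw [hue, huu]; simp
  have hlt : ∀ n j, j < n → ⟪u n, u j⟫_ℂ = 0 := fun n j h => horth_of n _ (hkill n j h)
  have hon : Orthonormal ℂ u := by
    refine ⟨hun, fun i j hij => ?_⟩
    rcases lt_or_gt_of_ne hij with h | h
    · rw [← inner_conj_symm, hlt j i h, map_zero]
    · exact hlt i j h
  have hRu : ∀ n, R (u n) = (ρ n : ℂ) • u n := by
    intro n
    have h1 := hQsum n (u n)
    rw [hue, Finset.sum_eq_zero, sub_zero] at h1
    · exact h1.symm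
    · intro j hj
      rw [hon.2 (Finset.mem_range.1 hj).ne]; simp
  have hanti : Antitone ρ := by
    refine antitone_nat_of_succ_le fun n => ?_
    have h1 : (⟪(Q (n + 1)).1 (u (n + 1)), u (n + 1)⟫_ℂ).re = ρ (n + 1) := by
      rw [hue, inner_smul_left, huu, Complex.conj_ofReal]; simp
    have h2 : (⟪(Q (n + 1)).1 (u (n + 1)), u (n + 1)⟫_ℂ).re =
        (⟪(Q n).1 (u (n + 1)), u (n + 1)⟫_ℂ).re := by
      rw [hQx, hon.2 (Nat.succ_ne_self n).symm]; simp
    rw [← h1, h2]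
    calc _ ≤ ‖⟪(Q n).1 (u (n + 1)), u (n + 1)⟫_ℂ‖ := Complex.re_le_norm _
      _ ≤ ‖(Q n).1 (u (n + 1))‖ * ‖u (n + 1)‖ := norm_inner_le_norm _ _
      _ ≤ ρ n * ‖u (n + 1)‖ * ‖u (n + 1)‖ := by
        gcongr; rw [hρ]; exact (Q n).1.le_opNorm _
      _ = ρ n := by rw [hun]; ring
  -- If all `ρ n ≥ ε`, the vectors `R (u n)` would be `ε`-separated in a compact set.
  have hlim : Tendsto ρ atTop (𝓝 0) := by
    have hbd : ∀ ε > 0, ∃ n, ρ n < ε := by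
      by_contra! hcon
      obtain ⟨ε, hε, hge⟩ := hcon
      obtain ⟨K, hK, hsub⟩ := hc.image_closedBall_subset_compact (f := (R : H →ₗ[ℂ] H)) 1
      have hmem : ∀ n, R (u n) ∈ K := fun n =>
        hsub ⟨u n, by simp [hun], rfl⟩
      obtain ⟨y, -, φ, hφ, hy⟩ := hK.tendsto_subseq hmem
      obtain ⟨N, hN⟩ := Metric.cauchySeq_iff'.1 hy.cauchySeq ε hε
      have h1 := hN (N + 1) (by omega)
      have hne : φ (N + 1) ≠ φ N := (hφ (Nat.lt_succ_self N)).ne'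
      have h2 : ‖⟪u (φ (N + 1)), R (u (φ (N + 1))) - R (u (φ N))⟫_ℂ‖ = ρ (φ (N + 1)) := by
        rw [inner_sub_right, hRu, hRu, inner_smul_right, inner_smul_right, huu, hon.2 hne]
        simp [abs_of_pos (hρpos _)]
      have h3 := norm_inner_le_norm (𝕜 := ℂ) (u (φ (N + 1)))
        (R (u (φ (N + 1))) - R (u (φ N)))
      rw [h2, hun, one_mul, ← dist_eq_norm] at h3
      exact absurd (lt_of_le_of_lt h3 h1) (not_lt.2 (hge _))
    rw [Metric.tendsto_atTop]
    intro ε hε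
    obtain ⟨N, hN⟩ := hbd ε hε
    refine ⟨N, fun n hn => ?_⟩
    rw [Real.dist_eq, sub_zero, abs_of_pos (hρpos n)]
    exact (hanti hn).trans_lt hN
  -- On a vector orthogonal to all `u j` every deflated operator still agrees with `R`, so `‖R x‖ ≤
  -- ρ n ‖x‖ → 0` and injectivity applies.
  have hcompl : (Submodule.span ℂ (range u))ᗮ = ⊥ := by
    rw [Submodule.eq_bot_iff]
    intro x hx
    have hx' : ∀ j, ⟪u j, x⟫_ℂ = 0 := fun j =>
      (Submodule.mem_orthogonal _ _).1 hx _ (Submodule.subset_span ⟨j, rfl⟩)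
    have h1 : ∀ n, ‖R x‖ ≤ ρ n * ‖x‖ := by
      intro n
      have h2 := hQsum n x
      rw [Finset.sum_eq_zero (fun j _ => by rw [hx' j]; simp), sub_zero] at h2
      rw [← h2, hρ]
      exact (Q n).1.le_opNorm x
    have h2 : ‖R x‖ ≤ 0 * ‖x‖ := ge_of_tendsto' (hlim.mul_const _) h1
    rw [zero_mul, norm_le_zero_iff] at h2
    exact hi (h2.trans (map_zero R).symm)
  refine ⟨HilbertBasis.mkOfOrthogonalEqBot hon hcompl, ρ, hanti, hρpos, hlim, fun n => ?_⟩
  rw [HilbertBasis.coe_mkOfOrthogonalEqBot]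
  exact hRu n

end Abstract

/-! ### Eigenvalues of perturbed diagonal operators -/

section Abstract

variable {ι H : Type*} [NormedAddCommGroup H] [InnerProductSpace ℂ H]
variable {b : HilbertBasis ι ℂ H} {a : ι → ℝ} {S : H →L[ℂ] H}

/-- The eigenvalues `ρ n` of the resolvent `(c - T)⁻¹` turn into `c - 1 / ρ n`. Because the whole
graph is recovered from the resolvent, the two diagonal forms agree as operators, domain included.
-/
theorem HilbertBasis.exists_eigenbasis [CompleteSpace H] (ha : Tendsto a cofinite atBot)
    (hS : (S : H →ₗ[ℂ] H).IsSymmetric) (hinf : ¬ FiniteDimensional ℂ H) :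
    ∃ (u : HilbertBasis ℕ ℂ H) (ν : ℕ → ℝ), Antitone ν ∧ Tendsto ν atTop atBot ∧
      b.diagGraph a S = u.diagGraph ν 0 := by
  obtain ⟨c, R, hRc, hRI, hRG, hRs, hRp, hRi⟩ := b.exists_resolvent ha hS
  obtain ⟨u, ρ, hρa, hρp, hρt, hu⟩ := exists_hilbertBasis_eigenvectors hRc hRs hRp hRi hinf
  refine ⟨u, fun n => c - (ρ n)⁻¹, fun m n hmn => ?_, ?_, ?_⟩
  · have := inv_anti₀ (hρp n) (hρa hmn)
    simp only
    linarith
  · have h1 : Tendsto (fun n => (ρ n)⁻¹) atTop atTop :=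
      Tendsto.inv_tendsto_nhdsGT_zero
        (tendsto_nhdsWithin_of_tendsto_nhds_of_eventually_within _ hρt
          (Eventually.of_forall hρp))
    exact tendsto_atBot_add_const_left _ c (tendsto_neg_atTop_atBot.comp h1)
  · have hcoef : ∀ n x, ⟪u n, R x⟫_ℂ = ρ n * ⟪u n, x⟫_ℂ := fun n x => by
      have h1 : ⟪R (u n), x⟫_ℂ = ⟪u n, R x⟫_ℂ := hRs _ _
      rw [← h1, hu, inner_smul_left, Complex.conj_ofReal]
    have hρ0 : ∀ n, ((ρ n : ℂ)⁻¹) * ρ n = 1 := fun n => by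
      rw [inv_mul_cancel₀]; exact_mod_cast (hρp n).ne'
    ext ⟨f, g⟩
    constructor
    · intro h i
      have h1 := congrArg (fun x => ⟪u i, x⟫_ℂ) (hRI f g h)
      simp only [hcoef, inner_sub_right, inner_smul_right] at h1
      simp only [zero_apply, inner_zero_right, add_zero]
      push_cast
      linear_combination ((ρ i : ℂ)⁻¹) * h1 + (c * ⟪u i, f⟫_ℂ - ⟪u i, g⟫_ℂ) * hρ0 i
    · intro h
      have h1 : f = R ((c : ℂ) • f - g) := by
        refine u.ext_inner fun i => ?_
        have h2 := h i
        simp only [zero_apply, inner_zero_right, add_zero] at h2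
        push_cast at h2
        simp only [hcoef, inner_sub_right, inner_smul_right]
        linear_combination ρ i * h2 - ⟪u i, f⟫_ℂ * hρ0 i
      have h2 := hRG ((c : ℂ) • f - g)
      rwa [← h1, sub_sub_cancel] at h2

theorem HilbertBasis.isBoundedAbove_of_graph (ha : Tendsto a cofinite atBot) {T : H →ₗ.[ℂ] H}
    (hT : T.graph = b.diagGraph a S) : IsBoundedAbove T := by
  obtain ⟨M, hM⟩ := bddAbove_of_tendsto_cofinite_atBot ha
  exact ⟨M + ‖S‖, fun f => diagGraph_re_le (hT ▸ T.mem_graph f) fun i _ => hM i⟩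

theorem HilbertBasis.hasCompactResolvent_of_graph [CompleteSpace H]
    (ha : Tendsto a cofinite atBot) (hS : (S : H →ₗ[ℂ] H).IsSymmetric) {T : H →ₗ.[ℂ] H}
    (hT : T.graph = b.diagGraph a S) : HasCompactResolvent T := by
  obtain ⟨c, R, hRc, hRI, hRG, hRs, hRp, hRi⟩ := b.exists_resolvent ha hS
  have hRI' : ∀ f : T.domain, (f : H) = R ((c : ℂ) • (f : H) - T f) := fun f =>
    hRI _ _ (hT ▸ T.mem_graph f)
  constructor
  -- `R` inverts `c - T`, whereas a resolvent inverts `T - z`; hence the sign.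
  · refine ⟨c, -R, fun g => ?_, fun f => ?_⟩
    · have h := hRG (-g)
      rw [← hT, LinearPMap.mem_graph_iff] at h
      obtain ⟨f, hf1, hf2⟩ := h
      refine ⟨f, by simp [hf1], ?_⟩
      simp only at hf1 hf2
      rw [hf2, hf1]; abel
    · conv_rhs => rw [hRI' f]
      rw [neg_apply, ← map_neg, neg_sub]
  · intro z Q hQ
    -- This resolvent identity factors an arbitrary resolvent through the compact `R`.
    have h : Q = R.comp (((c : ℂ) - z) • Q - ContinuousLinearMap.id ℂ H) := by
      ext g
      obtain ⟨f, hf1, hf2⟩ := hQ.1 g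
      simp only [ContinuousLinearMap.comp_apply, sub_apply, smul_apply,
        ContinuousLinearMap.id_apply]
      rw [← hf1]
      conv_lhs => rw [hRI' f]
      congr 1
      rw [← hf2, sub_smul]; abel
    rw [h]
    exact hRc.comp_clm _

/-- In coordinates `T f = z f` forces the coefficients of `f` to vanish off `{k | ν k = z}`. That
set is finite as `ν → -∞`, so its basis vectors form an algebraic basis of the eigenspace. -/
theorem HilbertBasis.isEigenvalueSequence_of_graph {u : HilbertBasis ℕ ℂ H} {ν : ℕ → ℝ}
    (hν : Antitone ν) (hν' : Tendsto ν atTop atBot) {T : H →ₗ.[ℂ] H}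
    (hT : T.graph = u.diagGraph ν 0) : IsEigenvalueSequence T ν := by
  classical
  refine ⟨hν, fun z => ?_⟩
  set s : Set ℕ := {k | (ν k : ℂ) = z} with hs
  have hfin : s.Finite := by
    obtain ⟨N, hN⟩ := (hν'.eventually (eventually_lt_atBot z.re)).exists_forall_of_atTop
    refine (Set.finite_Iio N).subset fun k hk => ?_
    by_contra hcon
    have h1 := hN k (not_lt.1 hcon)
    rw [← (hk : (ν k : ℂ) = z)] at h1
    simp at h1
  have hTu : ∀ f : T.domain, ∀ k, ⟪u k, T f⟫_ℂ = ν k * ⟪u k, (f : H)⟫_ℂ := fun f k => by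
    have h : ((f : H), T f) ∈ u.diagGraph ν 0 := hT ▸ T.mem_graph f
    simpa using h k
  have hmem : ∀ f : T.domain, f ∈ eigenspaceAt T z ↔ T f = z • (f : H) := fun f => by
    simp [eigenspaceAt, LinearMap.mem_ker, sub_eq_zero]
  have hdom : ∀ k, u k ∈ T.domain := fun k =>
    LinearPMap.mem_domain_of_mem_graph (hT ▸ basis_mem_diagGraph k)
  have hTk : ∀ k, T ⟨u k, hdom k⟩ = (ν k : ℂ) • u k := fun k => by
    refine u.ext_inner fun j => ?_
    rw [hTu, inner_smul_right]
    by_cases h : j = k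
    · rw [h]
    · simp [u.inner_ne h]
  let v : s → eigenspaceAt T z := fun k => ⟨⟨u k, hdom k⟩, by
    rw [hmem, hTk]; simp only; rw [k.2]⟩
  have hli : LinearIndependent ℂ v := by
    have h1 : LinearIndependent ℂ fun k : s => u k :=
      u.orthonormal.linearIndependent.comp _ Subtype.val_injective
    exact LinearIndependent.of_comp (T.domain.subtype.comp (eigenspaceAt T z).subtype) h1
  have hsp : ⊤ ≤ Submodule.span ℂ (range v) := by
    rintro f -
    have hz : ∀ k, k ∉ s → ⟪u k, (f : T.domain).1⟫_ℂ = 0 := fun k hk => by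
      have h1 := hTu f k
      rw [(hmem f).1 f.2, inner_smul_right] at h1
      have h2 : ((ν k : ℂ) - z) * ⟪u k, (f : T.domain).1⟫_ℂ = 0 := by rw [sub_mul, h1, sub_self]
      exact (mul_eq_zero.1 h2).resolve_left fun h => hk (sub_eq_zero.1 h)
    have hsum : (f : T.domain).1 = ∑ k ∈ hfin.toFinset, ⟪u k, (f : T.domain).1⟫_ℂ • u k := by
      refine (u.hasSum_repr (f : T.domain).1).unique ?_
      simp only [u.repr_apply_apply]
      refine hasSum_sum_of_ne_finset_zero fun k hk => ?_
      rw [hz k (by simpa using hk), zero_smul]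
    have hfv : f = ∑ k ∈ hfin.toFinset.attach,
        ⟪u k, (f : T.domain).1⟫_ℂ • v ⟨k.1, hfin.mem_toFinset.1 k.2⟩ := by
      apply Subtype.ext
      apply Subtype.ext
      rw [AddSubmonoidClass.coe_finsetSum, AddSubmonoidClass.coe_finsetSum]
      refine hsum.trans ?_
      rw [← Finset.sum_attach]
      rfl
    rw [hfv]
    exact sum_mem fun k _ => Submodule.smul_mem _ _ (Submodule.subset_span ⟨_, rfl⟩)
  have h := congrArg Cardinal.toENat (Module.Basis.mk hli hsp).mk_eq_rank
  rw [Cardinal.toENat_lift, Cardinal.toENat_lift] at h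
  exact h

/-! ### The min-max principle -/

/-- The span of the basis vectors with index in a finite set. -/
def HilbertBasis.spanFinset (b : HilbertBasis ι ℂ H) (s : Finset ι) : Submodule ℂ H :=
  Submodule.span ℂ (range fun i : s => b i)

instance (b : HilbertBasis ι ℂ H) (s : Finset ι) : FiniteDimensional ℂ (b.spanFinset s) :=
  FiniteDimensional.span_of_finite ℂ (Set.finite_range _)

theorem HilbertBasis.finrank_spanFinset (b : HilbertBasis ι ℂ H) (s : Finset ι) :
    Module.finrank ℂ (b.spanFinset s) = s.card := by
  have h1 : LinearIndependent ℂ fun k : s => b k :=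
    b.orthonormal.linearIndependent.comp _ Subtype.val_injective
  rw [HilbertBasis.spanFinset, finrank_span_eq_card h1, Fintype.card_coe]

theorem HilbertBasis.inner_eq_zero_of_mem_spanFinset {s : Finset ι} {f : H}
    (hf : f ∈ b.spanFinset s) {i : ι} (hi : i ∉ s) : ⟪b i, f⟫_ℂ = 0 := by
  induction hf using Submodule.span_induction with
  | mem x hx =>
    obtain ⟨j, rfl⟩ := hx
    exact b.inner_ne fun h => hi (h ▸ j.2)
  | zero => simp
  | add x y _ _ hx hy => rw [inner_add_right, hx, hy, add_zero]
  | smul c x _ hx => rw [inner_smul_right, hx, mul_zero]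

theorem HilbertBasis.exists_mem_diagGraph_of_mem_spanFinset (a : ι → ℝ) (S : H →L[ℂ] H)
    {s : Finset ι} {f : H} (hf : f ∈ b.spanFinset s) : ∃ g, (f, g) ∈ b.diagGraph a S := by
  induction hf using Submodule.span_induction with
  | mem x hx =>
    obtain ⟨j, rfl⟩ := hx
    exact ⟨_, basis_mem_diagGraph j.1⟩
  | zero => exact ⟨0, Submodule.zero_mem _⟩
  | add x y _ _ hx hy =>
    obtain ⟨g, hg⟩ := hx
    obtain ⟨g', hg'⟩ := hy
    exact ⟨g + g', Submodule.add_mem _ hg hg'⟩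
  | smul c x _ hx =>
    obtain ⟨g, hg⟩ := hx
    exact ⟨c • g, Submodule.smul_mem _ c hg⟩

theorem exists_ne_zero_inner_eq_zero {k : ℕ} (w : Fin k → H) (V : Submodule ℂ H)
    [FiniteDimensional ℂ V] (hV : k < Module.finrank ℂ V) :
    ∃ f ∈ V, f ≠ 0 ∧ ∀ j, ⟪w j, f⟫_ℂ = 0 := by
  let Φ : V →ₗ[ℂ] (Fin k → ℂ) :=
    LinearMap.pi fun j => (innerSL ℂ (w j) : H →ₗ[ℂ] ℂ).comp V.subtype
  have h : LinearMap.ker Φ ≠ ⊥ := LinearMap.ker_ne_bot_of_finrank_lt (by simpa using hV)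
  obtain ⟨f, hf, hf0⟩ := (Submodule.ne_bot_iff _).1 h
  refine ⟨f, f.2, by simpa using hf0, fun j => ?_⟩
  have := congrFun (LinearMap.mem_ker.1 hf) j
  simpa [Φ] using this

section MinMax

variable {u : HilbertBasis ℕ ℂ H} {ν : ℕ → ℝ}

/-- Indices start at `0`, so a space of dimension above `k` contains a nonzero vector orthogonal to
`u 0, …, u (k - 1)`, where the form is at most `ν k ‖f‖²`. -/
theorem HilbertBasis.le_eigenvalue (hν : Antitone ν) {k : ℕ} (V : Submodule ℂ H)
    [FiniteDimensional ℂ V] (hV : k < Module.finrank ℂ V) {α : ℝ}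
    (h : ∀ f ∈ V, ∃ g, (f, g) ∈ u.diagGraph ν 0 ∧ α * ‖f‖ ^ 2 ≤ (⟪f, g⟫_ℂ).re) : α ≤ ν k := by
  obtain ⟨f, hfV, hf0, hf⟩ := exists_ne_zero_inner_eq_zero (fun j : Fin k => u j) V hV
  obtain ⟨g, hg, hfg⟩ := h f hfV
  have h1 := u.re_inner_le (a := ν) (β := ν k) (fun i => by simpa using hg i) (fun i hi => hν (by
    by_contra hcon
    exact hi (hf ⟨i, not_le.1 hcon⟩)))
  have h2 : 0 < ‖f‖ ^ 2 := by positivity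
  exact le_of_mul_le_mul_right (hfg.trans h1) h2

theorem HilbertBasis.eigenvalue_mul_le (hν : Antitone ν) {k : ℕ} {f g : H}
    (hf : f ∈ u.spanFinset (Finset.range (k + 1))) (hg : (f, g) ∈ u.diagGraph ν 0) :
    ν k * ‖f‖ ^ 2 ≤ (⟪f, g⟫_ℂ).re := by
  refine u.le_re_inner (a := ν) (fun i => by simpa using hg i) (fun i hi => hν ?_)
  by_contra hcon
  exact hi (inner_eq_zero_of_mem_spanFinset hf (by simp; omega))

/-- The dual half of min-max: `k` linear constraints cannot exclude every nonzero vector of the `(k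
+ 1)`-dimensional span of `u 0, …, u k`. -/
theorem HilbertBasis.eigenvalue_le (hν : Antitone ν) {k : ℕ} (w : Fin k → H) {β : ℝ}
    (h : ∀ f g, (f, g) ∈ u.diagGraph ν 0 → (∀ j, ⟪w j, f⟫_ℂ = 0) →
      (⟪f, g⟫_ℂ).re ≤ β * ‖f‖ ^ 2) : ν k ≤ β := by
  obtain ⟨f, hfV, hf0, hf⟩ := exists_ne_zero_inner_eq_zero w
    (u.spanFinset (Finset.range (k + 1))) (by rw [finrank_spanFinset]; simp)
  obtain ⟨g, hg⟩ := exists_mem_diagGraph_of_mem_spanFinset ν 0 hfV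
  have h2 : 0 < ‖f‖ ^ 2 := by positivity
  exact le_of_mul_le_mul_right ((eigenvalue_mul_le hν hfV hg).trans (h f g hg hf)) h2

variable {S' : H →L[ℂ] H} {u' : HilbertBasis ℕ ℂ H} {ν' : ℕ → ℝ}

/-- The leading `k + 1` eigenvectors of the first operator serve as trial space for the second; a
lower bound on the perturbation is needed only there. -/
theorem HilbertBasis.eigenvalue_add_le (hν : Antitone ν) (hν' : Antitone ν')
    (hG : b.diagGraph a S = u.diagGraph ν 0) (hG' : b.diagGraph a S' = u'.diagGraph ν' 0)
    {k : ℕ} {ε : ℝ} (h : ∀ f ∈ u.spanFinset (Finset.range (k + 1)),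
      ε * ‖f‖ ^ 2 ≤ (⟪f, (S' - S) f⟫_ℂ).re) : ν k + ε ≤ ν' k := by
  refine le_eigenvalue (u := u') hν' (u.spanFinset (Finset.range (k + 1)))
    (by rw [finrank_spanFinset]; simp) fun f hf => ?_
  obtain ⟨g, hg⟩ := exists_mem_diagGraph_of_mem_spanFinset ν 0 hf
  refine ⟨g + (S' - S) f, ?_, ?_⟩
  · rw [← hG']
    exact mem_diagGraph_change (hG ▸ hg)
  · rw [inner_add_right, Complex.add_re, add_mul]
    exact add_le_add (eigenvalue_mul_le hν hf hg) (h f hf)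

theorem HilbertBasis.abs_eigenvalue_sub_le (hν : Antitone ν) (hν' : Antitone ν')
    (hG : b.diagGraph a S = u.diagGraph ν 0) (hG' : b.diagGraph a S' = u'.diagGraph ν' 0)
    (k : ℕ) : |ν' k - ν k| ≤ ‖S' - S‖ := by
  rw [abs_le]
  constructor
  · have := eigenvalue_add_le (k := k) (ε := -‖S' - S‖) hν hν' hG hG' fun f _ => by
      rw [neg_mul]; exact neg_le_re_inner_apply _ _
    linarith
  · have := eigenvalue_add_le (k := k) (ε := -‖S - S'‖) hν' hν hG' hG fun f _ => by
      rw [neg_mul]; exact neg_le_re_inner_apply _ _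
    rw [norm_sub_rev] at this
    linarith

/-- Pointwise positivity gives no uniform gap on `H`, but the trial space is finite-dimensional, so
the form of `S' - S` attains a positive minimum on its unit sphere. -/
theorem HilbertBasis.eigenvalue_lt (hν : Antitone ν) (hν' : Antitone ν')
    (hG : b.diagGraph a S = u.diagGraph ν 0) (hG' : b.diagGraph a S' = u'.diagGraph ν' 0)
    (h : ∀ f ≠ 0, 0 < (⟪f, (S' - S) f⟫_ℂ).re) (k : ℕ) : ν k < ν' k := by
  set V := u.spanFinset (Finset.range (k + 1)) with hV
  have : ProperSpace V := FiniteDimensional.proper ℂ V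
  have hne : (Metric.sphere (0 : V) 1).Nonempty := by
    have : Nontrivial V := Module.nontrivial_of_finrank_pos (R := ℂ)
      (by rw [hV, finrank_spanFinset]; simp)
    exact (NormedSpace.sphere_nonempty (x := (0 : V)) (r := 1)).2 (by norm_num)
  obtain ⟨f₀, hf₀, hmin⟩ := (isCompact_sphere (0 : V) 1).exists_isMinOn hne
    (f := fun f : V => (⟪(f : H), (S' - S) f⟫_ℂ).re) (by fun_prop)
  have hf₀n : f₀ ≠ 0 := by
    rintro rfl
    simp at hf₀
  have hpos := h f₀ (by simpa using hf₀n)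
  have := eigenvalue_add_le (k := k) hν hν' hG hG'
    (ε := (⟪(f₀ : H), (S' - S) f₀⟫_ℂ).re) fun f hf => ?_
  · linarith
  · by_cases hf0 : f = 0
    · simp [hf0]
    have hn : ‖f‖ ≠ 0 := by simpa using hf0
    have h1 := hmin (a := (((‖f‖⁻¹ : ℝ) : ℂ) • ⟨f, hf⟩ : V)) (by
      rw [mem_sphere_zero_iff_norm, norm_smul, Complex.norm_real, norm_inv, norm_norm]
      exact inv_mul_cancel₀ hn)
    simp only [Set.mem_ofPred_eq, Submodule.coe_smul, map_smul, inner_smul_left, inner_smul_right,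
      Complex.conj_ofReal, Complex.re_ofReal_mul] at h1
    have h2 := mul_le_mul_of_nonneg_right h1 (sq_nonneg ‖f‖)
    refine h2.trans (le_of_eq ?_)
    field_simp

end MinMax

end Abstract

/-! ### Geometry of the curve -/

namespace ClosedCurve

variable (C : ClosedCurve)

instance : Fact (0 < C.len) := ⟨C.len_pos⟩

theorem point_periodic : Function.Periodic C.point C.len := fun s =>
  Subtype.ext (C.periodic s)

theorem continuous_lift_point : Continuous (C.point_periodic.lift : AddCircle C.len → C.carrier) :=
  continuous_quot_lift _ C.continuous_point

theorem bijective_lift_point :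
    Function.Bijective (C.point_periodic.lift : AddCircle C.len → C.carrier) := by
  constructor
  · intro p q h
    obtain ⟨s, rfl⟩ := QuotientAddGroup.mk_surjective p
    obtain ⟨t, rfl⟩ := QuotientAddGroup.mk_surjective q
    have he : C.param s = C.param t := congrArg Subtype.val h
    have hper : ∀ s, C.param (toIcoMod C.len_pos 0 s) = C.param s := fun s => by
      rw [toIcoMod, C.periodic.sub_zsmul_eq]
    have hmem : ∀ s, toIcoMod C.len_pos 0 s ∈ Set.Ico 0 C.len := fun s => by
      simpa using toIcoMod_mem_Ico C.len_pos 0 s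
    have hm := C.injOn (hmem s) (hmem t) (by rw [hper, hper, he])
    have h2 : ∀ s, ((toIcoMod C.len_pos 0 s : ℝ) : AddCircle C.len) = s := fun s => by
      rw [toIcoMod, AddCircle.coe_sub, sub_eq_self]
      exact (QuotientAddGroup.eq_zero_iff _).2 ⟨_, rfl⟩
    have h3 := congrArg (fun r : ℝ => (r : AddCircle C.len)) hm
    simp only [h2] at h3
    exact h3
  · rintro ⟨_, s, rfl⟩
    exact ⟨(s : AddCircle C.len), rfl⟩

/-- The arc length parametrization as a homeomorphism from the circle `ℝ / len ℤ`. -/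
def homeo : AddCircle C.len ≃ₜ C.carrier :=
  Continuous.homeoOfEquivCompactToT2 (f := Equiv.ofBijective _ C.bijective_lift_point)
    C.continuous_lift_point

theorem homeo_coe (s : ℝ) : C.homeo (s : AddCircle C.len) = C.point s := rfl

theorem homeo_symm_point (s : ℝ) : C.homeo.symm (C.point s) = (s : AddCircle C.len) := by
  rw [← homeo_coe, Homeomorph.symm_apply_apply]

instance : CompactSpace C.carrier := C.homeo.compactSpace

theorem arcLength_eq_map : C.arcLength = (volume : Measure (AddCircle C.len)).map C.homeo := by
  have h := (AddCircle.measurePreserving_mk C.len 0).map_eq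
  rw [← h, Measure.map_map C.homeo.continuous.measurable AddCircle.measurable_mk',
    zero_add, ← Measure.restrict_congr_set (μ := (volume : Measure ℝ)) Ico_ae_eq_Ioc]
  rfl

theorem measurePreserving_homeo : MeasurePreserving C.homeo volume C.arcLength :=
  ⟨C.homeo.continuous.measurable, C.arcLength_eq_map.symm⟩

theorem integral_arcLength {E : Type*} [NormedAddCommGroup E] [NormedSpace ℝ E]
    (f : C.carrier → E) : ∫ x, f x ∂C.arcLength = ∫ p, f (C.homeo p) :=
  (C.measurePreserving_homeo.integral_comp C.homeo.measurableEmbedding f).symm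

instance : C.arcLength.IsOpenPosMeasure := by
  rw [arcLength_eq_map]
  exact C.homeo.continuous.isOpenPosMeasure_map C.homeo.surjective

theorem arcLength_real_univ : C.arcLength.real univ = C.len := by
  rw [measureReal_def, arcLength_eq_map, Measure.map_apply C.homeo.continuous.measurable
    MeasurableSet.univ, preimage_univ, AddCircle.measure_univ,
    ENNReal.toReal_ofReal C.len_pos.le]

/-- The length of the shorter arc between two points. -/
def arcDist (x y : C.carrier) : ℝ := ‖C.homeo.symm y - C.homeo.symm x‖

theorem arcDist_comm (x y : C.carrier) : C.arcDist x y = C.arcDist y x := norm_sub_rev _ _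

theorem arcDist_nonneg (x y : C.carrier) : 0 ≤ C.arcDist x y := norm_nonneg _

theorem arcDist_pos {x y : C.carrier} (h : x ≠ y) : 0 < C.arcDist x y := by
  rw [arcDist, norm_pos_iff, sub_ne_zero]
  exact fun h' => h (C.homeo.symm.injective h').symm

theorem continuous_arcDist : Continuous fun p : C.carrier × C.carrier => C.arcDist p.1 p.2 := by
  unfold arcDist
  have := C.homeo.symm.continuous
  fun_prop

theorem arcDist_homeo (p q : AddCircle C.len) :
    C.arcDist (C.homeo p) (C.homeo q) = ‖q - p‖ := by simp [arcDist]

theorem arcDist_point_le (s t : ℝ) : C.arcDist (C.point s) (C.point t) ≤ |t - s| := by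
  rw [arcDist, homeo_symm_point, homeo_symm_point, ← AddCircle.coe_sub]
  exact QuotientAddGroup.norm_mk_le_norm

/-- Rounding picks the signed displacement of least modulus, so estimates for pairs of points become
estimates in one real variable. -/
theorem exists_point_point (x y : C.carrier) :
    ∃ s u : ℝ, x = C.point s ∧ y = C.point (s + u) ∧ |u| = C.arcDist x y := by
  obtain ⟨_, s, rfl⟩ := x
  obtain ⟨_, t, rfl⟩ := y
  refine ⟨s, (t - s) - round (C.len⁻¹ * (t - s)) * C.len, rfl, Subtype.ext ?_, ?_⟩
  · change C.param t = C.param _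
    rw [← add_sub_assoc, add_sub_cancel, ← zsmul_eq_mul, C.periodic.sub_zsmul_eq]
  · change _ = C.arcDist (C.point s) (C.point t)
    rw [arcDist, homeo_symm_point, homeo_symm_point, ← AddCircle.coe_sub, AddCircle.norm_eq]

theorem arcDist_le (x y : C.carrier) : C.arcDist x y ≤ C.len / 2 := by
  have := AddCircle.norm_le_half_period C.len C.len_pos.ne' (x := C.homeo.symm y - C.homeo.symm x)
  rwa [abs_of_pos C.len_pos] at this

/-- Truncation by parameter intervals is truncation by balls of the arc metric, hence invariant
under rotations. -/
theorem interval_eq (δ : ℝ) (x : C.carrier) : C.interval δ x = {y | C.arcDist x y < δ} := by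
  ext y
  constructor
  · rintro ⟨s₀, s, rfl, rfl, hs⟩
    refine lt_of_le_of_lt (C.arcDist_point_le _ _) ?_
    rw [abs_lt]
    exact ⟨by linarith [hs.1], by linarith [hs.2]⟩
  · intro hy
    obtain ⟨s, u, rfl, rfl, hu⟩ := C.exists_point_point x y
    rw [Set.mem_ofPred_eq, ← hu, abs_lt] at hy
    exact ⟨s, s + u, rfl, rfl, by linarith [hy.1], by linarith [hy.2]⟩

/-! ### Comparison of chord and arc -/

theorem differentiable_param : Differentiable ℝ C.param := C.contDiff.differentiable (by norm_num)

theorem norm_param_sub_le (s t : ℝ) : ‖C.param t - C.param s‖ ≤ |t - s| := by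
  have := Convex.norm_image_sub_le_of_norm_deriv_le (𝕜 := ℝ) (f := C.param) (s := univ) (C := 1)
    (fun x _ => C.differentiable_param x) (fun x _ => (C.unit_speed x).le) convex_univ
    (mem_univ s) (mem_univ t)
  simpa using this

theorem dist_le_arcDist (x y : C.carrier) : dist x y ≤ C.arcDist x y := by
  obtain ⟨s, u, rfl, rfl, hu⟩ := C.exists_point_point x y
  rw [← hu, dist_comm]
  have := C.norm_param_sub_le s (s + u)
  rw [add_sub_cancel_left] at this
  rw [Subtype.dist_eq, dist_eq_norm]
  exact this

/-- Periodicity reduces the bound on the continuous second derivative to one compact period. -/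
theorem exists_deriv_lipschitz : ∃ Q > 0, ∀ s t, ‖deriv C.param t - deriv C.param s‖ ≤
    Q * |t - s| := by
  have hd : ContDiff ℝ 1 (deriv C.param) := by
    have h : ContDiff ℝ (1 + 1) C.param := by
      have := C.contDiff
      norm_num at this ⊢
      exact this
    exact (contDiff_succ_iff_deriv.1 h).2.2
  have hper : Function.Periodic (deriv (deriv C.param)) C.len := by
    have h1 : Function.Periodic (deriv C.param) C.len := fun s => by
      rw [← deriv_comp_add_const]
      congr 1
      ext1 t
      exact C.periodic t
    intro s
    rw [← deriv_comp_add_const]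
    congr 1
    ext1 t
    exact h1 t
  have hcont : Continuous (deriv (deriv C.param)) := hd.continuous_deriv (by norm_num)
  obtain ⟨Q, hQ⟩ := (isCompact_Icc (a := 0) (b := C.len)).exists_bound_of_continuousOn
    hcont.continuousOn
  refine ⟨max Q 1, by positivity, fun s t => ?_⟩
  have := Convex.norm_image_sub_le_of_norm_deriv_le (𝕜 := ℝ) (f := deriv C.param) (s := univ)
    (C := max Q 1) (fun x _ => hd.differentiable (by norm_num) x) (fun x _ => ?_) convex_univ
    (mem_univ s) (mem_univ t)
  · simpa using this
  · obtain ⟨y, hy, hxy⟩ := hper.exists_mem_Ico₀ C.len_pos x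
    rw [hxy]
    exact (hQ y (Ico_subset_Icc_self hy)).trans (le_max_left _ _)

/-- The chord differs from `u` times the unit tangent by at most `Q u²`, by the mean value
inequality for the remainder. -/
theorem exists_sub_sq_le_norm_param_sub :
    ∃ Q > 0, ∀ s u, |u| - Q * u ^ 2 ≤ ‖C.param (s + u) - C.param s‖ := by
  obtain ⟨Q, hQ, h⟩ := C.exists_deriv_lipschitz
  refine ⟨Q, hQ, fun s u => ?_⟩
  have hder : ∀ t, HasDerivAt (fun t => C.param (s + t) - t • deriv C.param s)
      (deriv C.param (s + t) - deriv C.param s) t := fun t => by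
    have h1 := ((C.differentiable_param (s + t)).hasDerivAt).scomp t
      ((hasDerivAt_id t).const_add s)
    have h2 := (hasDerivAt_id t).smul_const (deriv C.param s)
    have h3 := h1.sub h2
    simp only [one_smul] at h3
    exact h3
  have h3 := Convex.norm_image_sub_le_of_norm_hasDerivWithin_le (s := uIcc 0 u) (C := Q * |u|)
    (fun t _ => (hder t).hasDerivWithinAt) (fun t ht => ?_) (convex_uIcc 0 u)
    left_mem_uIcc right_mem_uIcc
  · simp only [add_zero, zero_smul, sub_zero, Real.norm_eq_abs] at h3
    have h4 : ‖u • deriv C.param s‖ = |u| := by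
      rw [norm_smul, C.unit_speed, mul_one, Real.norm_eq_abs]
    have h5 : ‖u • deriv C.param s‖ ≤ ‖C.param (s + u) - C.param s‖ +
        ‖C.param (s + u) - u • deriv C.param s - C.param s‖ := by
      have := norm_sub_le (C.param (s + u) - C.param s)
        (C.param (s + u) - u • deriv C.param s - C.param s)
      refine le_trans (le_of_eq ?_) this
      congr 1
      abel
    have h6 : Q * |u| * |u| = Q * u ^ 2 := by rw [mul_assoc, abs_mul_abs_self]; ring
    linarith
  · refine (h s (s + t)).trans ?_
    rw [add_sub_cancel_left]
    have := abs_sub_left_of_mem_uIcc ht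
    simp only [sub_zero] at this
    exact mul_le_mul_of_nonneg_left this hQ.le

/-- Chord-arc comparison. -/
theorem exists_chord_arc : ∃ c > 0, ∃ M > 0, ∀ x y : C.carrier,
    c * C.arcDist x y ≤ dist x y ∧ (dist x y)⁻¹ - (C.arcDist x y)⁻¹ ≤ M := by
  obtain ⟨Q, hQ, h⟩ := C.exists_sub_sq_le_norm_param_sub
  have hloc : ∀ x y, C.arcDist x y - Q * C.arcDist x y ^ 2 ≤ dist x y := fun x y => by
    obtain ⟨s, u, rfl, rfl, hu⟩ := C.exists_point_point x y
    rw [← hu, dist_comm, sq_abs, Subtype.dist_eq, dist_eq_norm]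
    exact h s u
  -- Pairs are separated at arc distance `1 / (2Q)`. Below it the quadratic error is at most half
  -- the arc; above it, compactness and injectivity bound the chord from below.
  set K : Set (C.carrier × C.carrier) := {p | (2 * Q)⁻¹ ≤ C.arcDist p.1 p.2} with hK
  have hKc : IsCompact K := (isClosed_le continuous_const C.continuous_arcDist).isCompact
  obtain ⟨r, hr, hrK⟩ : ∃ r > 0, ∀ p ∈ K, r ≤ dist p.1 p.2 := by
    rcases K.eq_empty_or_nonempty with hE | hne
    · exact ⟨1, one_pos, fun p hp => by simp [hE] at hp⟩
    · obtain ⟨p₀, hp₀, hmin⟩ := hKc.exists_isMinOn hne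
        (f := fun p : C.carrier × C.carrier => dist p.1 p.2) (by fun_prop)
      refine ⟨_, dist_pos.2 fun heq => ?_, fun p hp => hmin hp⟩
      have h1 : (2 * Q)⁻¹ ≤ C.arcDist p₀.1 p₀.2 := hp₀
      rw [heq, arcDist, sub_self, norm_zero] at h1
      have : 0 < (2 * Q)⁻¹ := by positivity
      linarith
  have hL := C.len_pos
  refine ⟨min (1 / 2) (r / C.len), by positivity, max (2 * Q) r⁻¹, by positivity, fun x y => ?_⟩
  have hd0 := C.arcDist_nonneg x y
  by_cases hxy : x = y
  · subst hxy
    have h0 : C.arcDist x x = 0 := by simp [arcDist]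
    simp only [h0, dist_self, mul_zero, le_refl, inv_zero, sub_zero, true_and]
    positivity
  have hdpos := C.arcDist_pos hxy
  by_cases hp : (2 * Q)⁻¹ ≤ C.arcDist x y
  · have h1 : r ≤ dist x y := hrK (x, y) hp
    constructor
    · calc min (1 / 2) (r / C.len) * C.arcDist x y ≤ (r / C.len) * C.len := by
            gcongr
            · exact min_le_right _ _
            · have := C.arcDist_le x y; linarith
        _ = r := by field_simp
        _ ≤ _ := h1
    · have h2 : (dist x y)⁻¹ ≤ r⁻¹ := inv_anti₀ hr h1
      have h3 : 0 < (C.arcDist x y)⁻¹ := by positivity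
      have := le_max_right (2 * Q) r⁻¹
      linarith
  · have h1 := hloc x y
    have h2 : Q * C.arcDist x y ≤ 1 / 2 := by
      have h3 := (not_le.1 hp).le
      calc Q * C.arcDist x y ≤ Q * (2 * Q)⁻¹ := by gcongr
        _ = 1 / 2 := by field_simp
    have h4 : C.arcDist x y / 2 ≤ dist x y := by nlinarith
    constructor
    · calc min (1 / 2) (r / C.len) * C.arcDist x y ≤ (1 / 2) * C.arcDist x y := by
            gcongr
            exact min_le_left _ _
        _ ≤ _ := by linarith
    · refine le_trans ?_ (le_max_left _ _)
      have h5 : 0 < dist x y := by linarith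
      -- `1/r - 1/d = (d - r) / (r d)`, with `d - r ≤ Q d²` and `r ≥ d / 2`, which gives `2Q`.
      rw [inv_sub_inv h5.ne' hdpos.ne', div_le_iff₀ (by positivity)]
      nlinarith [mul_le_mul_of_nonneg_left h4 (by positivity : 0 ≤ 2 * Q * C.arcDist x y)]

end ClosedCurve

/-! ### Radial integrals on the circle -/

/-- On the fundamental domain centred at `0` the quotient norm is the absolute value. -/
theorem AddCircle.integral_comp_norm {L : ℝ} [hL : Fact (0 < L)] (G : ℝ → ℝ) :
    ∫ p : AddCircle L, G ‖p‖ = 2 * ∫ u in (0 : ℝ)..(L / 2), G u := by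
  have hL0 := hL.out
  rw [← AddCircle.integral_preimage L (-(L / 2))]
  have h1 : ∫ a in Ioc (-(L / 2)) (-(L / 2) + L), G ‖(a : AddCircle L)‖ =
      ∫ a in Icc (-(L / 2)) (L / 2), G |a| := by
    rw [show -(L / 2) + L = L / 2 by ring, ← integral_Icc_eq_integral_Ioc]
    refine setIntegral_congr_fun measurableSet_Icc fun a ha => ?_
    rw [(AddCircle.norm_coe_eq_abs_iff L hL0.ne').2]
    rw [abs_of_pos hL0]
    exact abs_le.2 ha
  rw [h1, ← integral_indicator measurableSet_Icc]
  have h2 : (Icc (-(L / 2)) (L / 2)).indicator (fun a => G |a|) =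
      fun a => (Iic (L / 2)).indicator G |a| := by
    ext a
    simp only [indicator, mem_Icc, mem_Iic, ← abs_le]
  rw [h2, integral_comp_abs, setIntegral_indicator measurableSet_Iic,
    intervalIntegral.integral_of_le (by positivity), Ioi_inter_Iic]

theorem AddCircle.integral_inv_norm {L : ℝ} [hL : Fact (0 < L)] {δ : ℝ} (hδ : 0 < δ)
    (hδL : δ ≤ L / 2) :
    ∫ p in {p : AddCircle L | δ ≤ ‖p‖}, ‖p‖⁻¹ = 2 * (Real.log (L / 2) - Real.log δ) := by
  have hL0 := hL.out
  rw [← integral_indicator (measurableSet_le measurable_const measurable_norm)]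
  have h2 : {p : AddCircle L | δ ≤ ‖p‖}.indicator (fun p => ‖p‖⁻¹) =
      fun p => (Ici δ).indicator (fun u => u⁻¹) ‖p‖ := by
    ext a
    simp only [indicator, mem_Ici, Set.mem_ofPred_eq]
  rw [h2, AddCircle.integral_comp_norm, intervalIntegral.integral_of_le (by positivity),
    setIntegral_indicator measurableSet_Ici]
  have h3 : Ioc 0 (L / 2) ∩ Ici δ = Icc δ (L / 2) := by
    ext u
    simp only [mem_inter_iff, mem_Ioc, mem_Ici, mem_Icc]
    exact ⟨fun h => ⟨h.2, h.1.2⟩, fun h => ⟨⟨hδ.trans_le h.1, h.2⟩, h.1⟩⟩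
  rw [h3, integral_Icc_eq_integral_Ioc, ← intervalIntegral.integral_of_le hδL,
    integral_inv_of_pos hδ (by positivity), Real.log_div (by positivity) hδ.ne']

/-! ### The truncated cosine integral -/

theorem abs_cos_sub_one_div_le (v : ℝ) : |(Real.cos v - 1) / v| ≤ |v| := by
  by_cases hv : v = 0
  · simp [hv]
  rw [abs_div, div_le_iff₀ (abs_pos.2 hv), abs_mul_abs_self, abs_le]
  have h1 := Real.one_sub_sq_div_two_le_cos (x := v)
  have h2 := Real.cos_le_one v
  constructor <;> nlinarith [sq_nonneg v]

theorem intervalIntegrable_cos_sub_one_div (a b : ℝ) :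
    IntervalIntegrable (fun v : ℝ => (Real.cos v - 1) / v) volume a b := by
  rw [intervalIntegrable_iff]
  refine Integrable.mono' (g := fun v => |v|)
    ((continuous_abs.intervalIntegrable a b).def') ?_ ?_
  · exact (by fun_prop : Measurable fun v : ℝ => (Real.cos v - 1) / v).aestronglyMeasurable
  · exact Eventually.of_forall fun v => abs_cos_sub_one_div_le v

/-- Integration by parts against `sin v / v`: the two boundary terms and `∫ 1 / v²` contribute at
most `1` each. -/
theorem abs_integral_cos_div_le {N : ℝ} (hN : 1 ≤ N) :
    |∫ v in (1 : ℝ)..N, Real.cos v / v| ≤ 3 := by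
  have hpos : ∀ v ∈ uIcc 1 N, (v : ℝ) ≠ 0 := fun v hv => by
    rw [uIcc_of_le hN] at hv; linarith [hv.1]
  have hc1 : ContinuousOn (fun v : ℝ => Real.cos v / v) (uIcc 1 N) :=
    Real.continuous_cos.continuousOn.div continuousOn_id hpos
  have hc2 : ContinuousOn (fun v : ℝ => Real.sin v / v ^ 2) (uIcc 1 N) :=
    Real.continuous_sin.continuousOn.div (by fun_prop) fun v hv => pow_ne_zero 2 (hpos v hv)
  have hc3 : ContinuousOn (fun v : ℝ => 1 / v ^ 2) (uIcc 1 N) :=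
    continuousOn_const.div (by fun_prop) fun v hv => pow_ne_zero 2 (hpos v hv)
  have h1 : ∫ v in (1 : ℝ)..N, (Real.cos v / v - Real.sin v / v ^ 2) =
      Real.sin N / N - Real.sin 1 / 1 := by
    refine intervalIntegral.integral_eq_sub_of_hasDerivAt (f := fun v => Real.sin v / v)
      (fun v hv => ?_) (hc1.sub hc2).intervalIntegrable
    have h := (Real.hasDerivAt_sin v).div (hasDerivAt_id v) (hpos v hv)
    refine h.congr_deriv ?_
    have := hpos v hv
    simp only [id]
    field_simp
  have h2 : ∫ v in (1 : ℝ)..N, 1 / v ^ 2 = -(1 / N) - -(1 / 1) := by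
    refine intervalIntegral.integral_eq_sub_of_hasDerivAt (f := fun v => -(1 / v))
      (fun v hv => ?_) hc3.intervalIntegrable
    have h := (hasDerivAt_inv (hpos v hv)).neg
    simp only [one_div]
    refine h.congr_deriv ?_
    simp
  rw [intervalIntegral.integral_sub hc1.intervalIntegrable hc2.intervalIntegrable] at h1
  have hi3 : IntervalIntegrable (fun v : ℝ => 1 / v ^ 2) volume 1 N := hc3.intervalIntegrable
  have h3 : |∫ v in (1 : ℝ)..N, Real.sin v / v ^ 2| ≤ ∫ v in (1 : ℝ)..N, 1 / v ^ 2 := by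
    rw [← Real.norm_eq_abs]
    refine intervalIntegral.norm_integral_le_of_norm_le hN (Eventually.of_forall fun v _ => ?_)
      hi3
    rw [Real.norm_eq_abs, abs_div, abs_of_nonneg (sq_nonneg v)]
    gcongr
    exact Real.abs_sin_le_one v
  have h4 : |Real.sin N / N| ≤ 1 := by
    rw [abs_div, abs_of_pos (by linarith : 0 < N), div_le_one (by linarith)]
    exact (Real.abs_sin_le_one N).trans hN
  have h5 := Real.abs_sin_le_one 1
  have h6 : 0 < 1 / N := by positivity
  rw [abs_le] at *
  constructor <;> linarith [h1, h2, h3.1, h3.2, h4.1, h4.2, h5.1, h5.2]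

/-- Beyond `v = 1` the term `-1 / v` integrates to `-log N`, and the oscillating remainder is
bounded. -/
theorem exists_abs_integral_cos_sub_one_div_add_log_le :
    ∃ K, ∀ N : ℝ, 1 ≤ N → |(∫ v in (0 : ℝ)..N, (Real.cos v - 1) / v) + Real.log N| ≤ K := by
  refine ⟨|∫ v in (0 : ℝ)..1, (Real.cos v - 1) / v| + 3, fun N hN => ?_⟩
  have hpos : ∀ v ∈ uIcc 1 N, (v : ℝ) ≠ 0 := fun v hv => by
    rw [uIcc_of_le hN] at hv; linarith [hv.1]
  have hc1 : ContinuousOn (fun v : ℝ => Real.cos v / v) (uIcc 1 N) :=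
    Real.continuous_cos.continuousOn.div continuousOn_id hpos
  have hc2 : ContinuousOn (fun v : ℝ => v⁻¹) (uIcc 1 N) := continuousOn_inv₀.mono hpos
  rw [← intervalIntegral.integral_add_adjacent_intervals
    (intervalIntegrable_cos_sub_one_div 0 1) (intervalIntegrable_cos_sub_one_div 1 N)]
  have h1 : ∫ v in (1 : ℝ)..N, (Real.cos v - 1) / v =
      (∫ v in (1 : ℝ)..N, Real.cos v / v) - Real.log N := by
    have h2 : Real.log N = ∫ v in (1 : ℝ)..N, v⁻¹ := by
      rw [integral_inv_of_pos one_pos (by linarith), div_one]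
    rw [h2, ← intervalIntegral.integral_sub hc1.intervalIntegrable hc2.intervalIntegrable]
    congr 1
    ext v
    rw [sub_div, one_div]
  rw [h1]
  have h3 := abs_integral_cos_div_le hN
  calc _ = |(∫ v in (0 : ℝ)..1, (Real.cos v - 1) / v) + ∫ v in (1 : ℝ)..N, Real.cos v / v| := by
        congr 1; ring
    _ ≤ _ := (abs_add_le _ _).trans (by gcongr)

/-! ### Logarithmic behaviour of the Fourier multiplier -/

namespace ClosedCurve

variable (C : ClosedCurve)

/-- The Fourier multiplier of the regularized arc length kernel. -/
def multiplier (n : ℤ) : ℝ :=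
  Real.log (C.len / 2) / (2 * Real.pi) +
    ∫ p : AddCircle C.len, (Real.cos (2 * Real.pi * n * ‖p‖ / C.len) - 1) / (4 * Real.pi * ‖p‖)

/-- After rescaling by `2π |n| / L`, the frequency enters only through the upper limit; its sign is
lost because cosine is even. -/
theorem multiplier_eq (n : ℤ) : C.multiplier n = Real.log (C.len / 2) / (2 * Real.pi) +
    (2 * Real.pi)⁻¹ * ∫ v in (0 : ℝ)..(Real.pi * |(n : ℝ)|), (Real.cos v - 1) / v := by
  have hL := C.len_pos
  rw [multiplier, AddCircle.integral_comp_norm (L := C.len)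
    (fun u => (Real.cos (2 * Real.pi * n * u / C.len) - 1) / (4 * Real.pi * u))]
  congr 1
  by_cases hn : n = 0
  · simp [hn]
  have hn' : (0 : ℝ) < |(n : ℝ)| := abs_pos.2 (by exact_mod_cast hn)
  set c : ℝ := 2 * Real.pi * |(n : ℝ)| / C.len with hc
  have hcpos : 0 < c := by have := Real.pi_pos; positivity
  have h1 := intervalIntegral.mul_integral_comp_mul_left (a := 0) (b := C.len / 2)
    (f := fun v => (Real.cos v - 1) / v) (c := c)
  rw [mul_zero, show c * (C.len / 2) = Real.pi * |(n : ℝ)| by rw [hc]; field_simp] at h1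
  rw [← h1, ← intervalIntegral.integral_const_mul, ← intervalIntegral.integral_const_mul,
    ← intervalIntegral.integral_const_mul]
  congr 1
  ext u
  have h2 : Real.cos (2 * Real.pi * n * u / C.len) = Real.cos (c * u) := by
    rcases abs_choice (n : ℝ) with h | h
    · rw [hc, h]; congr 1; ring
    · rw [hc, h, ← Real.cos_neg]; congr 1; ring
  rw [h2]
  have := Real.pi_pos
  by_cases hu : u = 0
  · simp [hu]
  field_simp
  ring

theorem exists_abs_multiplier_add_log_le :
    ∃ K, ∀ n : ℤ, |C.multiplier n + Real.log (1 + |(n : ℝ)|) / (2 * Real.pi)| ≤ K := by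
  obtain ⟨K, hK⟩ := exists_abs_integral_cos_sub_one_div_add_log_le
  have hpi := Real.pi_pos
  -- The frequency `0` is treated apart, since the cosine estimate needs an upper limit at least
  -- `1`; `log 2` pays for replacing `|n|` by `1 + |n|`.
  refine ⟨max |C.multiplier 0| (|Real.log (C.len / 2) / (2 * Real.pi)| +
    (2 * Real.pi)⁻¹ * (K + Real.log Real.pi + Real.log 2)), fun n => ?_⟩
  by_cases hn : n = 0
  · subst hn
    refine le_trans (le_of_eq ?_) (le_max_left _ _)
    simp
  refine le_trans ?_ (le_max_right _ _)
  have hn1 : (1 : ℝ) ≤ |(n : ℝ)| := by exact_mod_cast Int.one_le_abs hn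
  have h1 := hK (Real.pi * |(n : ℝ)|) (by nlinarith [Real.pi_gt_three])
  rw [Real.log_mul hpi.ne' (by positivity)] at h1
  have h2 : Real.log |(n : ℝ)| ≤ Real.log (1 + |(n : ℝ)|) :=
    Real.log_le_log (by positivity) (by linarith)
  have h3 : Real.log (1 + |(n : ℝ)|) ≤ Real.log 2 + Real.log |(n : ℝ)| := by
    rw [← Real.log_mul (by norm_num) (by positivity)]
    exact Real.log_le_log (by positivity) (by linarith)
  have h4 : 0 ≤ Real.log Real.pi := Real.log_nonneg (by linarith [Real.pi_gt_three])
  rw [multiplier_eq]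
  set I := ∫ v in (0 : ℝ)..(Real.pi * |(n : ℝ)|), (Real.cos v - 1) / v
  calc _ = |Real.log (C.len / 2) / (2 * Real.pi) +
        (2 * Real.pi)⁻¹ * (I + Real.log (1 + |(n : ℝ)|))| := by congr 1; ring
    _ ≤ |Real.log (C.len / 2) / (2 * Real.pi)| +
        |(2 * Real.pi)⁻¹ * (I + Real.log (1 + |(n : ℝ)|))| := abs_add_le _ _
    _ ≤ _ := by
      rw [abs_mul, abs_of_pos (by positivity : 0 < (2 * Real.pi)⁻¹)]
      gcongr
      rw [abs_le] at h1 ⊢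
      constructor <;> linarith [h1.1, h1.2]

theorem tendsto_multiplier : Tendsto C.multiplier cofinite atBot := by
  obtain ⟨K, hK⟩ := C.exists_abs_multiplier_add_log_le
  have hpi := Real.pi_pos
  have h1 : Tendsto (fun n : ℤ => |(n : ℝ)|) cofinite atTop := by
    have := tendsto_norm_cocompact_atTop.comp Int.tendsto_coe_cofinite
    exact this
  have h2 : Tendsto (fun n : ℤ => K - Real.log (1 + |(n : ℝ)|) / (2 * Real.pi)) cofinite atBot := by
    have h3 := (Real.tendsto_log_atTop.comp (tendsto_atTop_add_const_left _ 1 h1)).atTop_div_const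
      (by positivity : 0 < 2 * Real.pi)
    exact tendsto_atBot_add_const_left _ K (tendsto_neg_atTop_atBot.comp h3)
  refine tendsto_atBot_mono (fun n => ?_) h2
  have := (abs_le.1 (hK n)).2
  linarith

end ClosedCurve

/-! ### Integral operators with bounded kernels -/

section KernelOperator

variable {X : Type*} [MeasurableSpace X] {μ : Measure X}

/-- The integral operator with kernel `m`, as a map on functions. -/
def kernelFun (μ : Measure X) (m : X → X → ℝ) (f : X → ℂ) (x : X) : ℂ :=
  ∫ y, (m x y : ℂ) * f y ∂μ

theorem integrable_kernel_mul {m : X → X → ℝ} (hm : Measurable (Function.uncurry m)) {M : ℝ}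
    (hM : ∀ x y, |m x y| ≤ M) {f : X → ℂ} (hf : Integrable f μ) (x : X) :
    Integrable (fun y => (m x y : ℂ) * f y) μ := by
  refine hf.bdd_mul (c := M) ?_ (Eventually.of_forall fun y => ?_)
  · exact (Complex.measurable_ofReal.comp (hm.comp measurable_prodMk_left)).aestronglyMeasurable
  · rw [Complex.norm_real]; exact hM x y

theorem kernelFun_congr {m : X → X → ℝ} {f g : X → ℂ} (h : f =ᵐ[μ] g) :
    kernelFun μ m f = kernelFun μ m g := by
  ext x
  refine integral_congr_ae ?_
  filter_upwards [h] with y hy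
  rw [hy]

theorem norm_kernelFun_le {m : X → X → ℝ} {M : ℝ} (hM : ∀ x y, |m x y| ≤ M) {f : X → ℂ}
    (hf : Integrable f μ) (x : X) : ‖kernelFun μ m f x‖ ≤ M * ∫ y, ‖f y‖ ∂μ := by
  rw [← integral_const_mul]
  refine norm_integral_le_of_norm_le (hf.norm.const_mul M) (Eventually.of_forall fun y => ?_)
  rw [norm_mul, Complex.norm_real]
  exact mul_le_mul_of_nonneg_right (hM x y) (norm_nonneg _)

variable [IsFiniteMeasure μ]

theorem Lp.integrable_two (f : Lp ℂ 2 μ) : Integrable f μ :=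
  (Lp.memLp f).integrable (by norm_num)

theorem stronglyMeasurable_kernelFun {m : X → X → ℝ} (hm : Measurable (Function.uncurry m))
    {f : X → ℂ} (hf : Measurable f) : StronglyMeasurable (kernelFun μ m f) := by
  have : StronglyMeasurable (fun p : X × X => (m p.1 p.2 : ℂ) * f p.2) :=
    ((Complex.measurable_ofReal.comp hm).mul (hf.comp measurable_snd)).stronglyMeasurable
  exact this.integral_prod_right

theorem Lp.integral_norm_le (f : Lp ℂ 2 μ) :
    ∫ x, ‖f x‖ ∂μ ≤ μ.real univ ^ (2 : ℝ)⁻¹ * ‖f‖ := by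
  have h := eLpNorm_le_eLpNorm_mul_rpow_measure_univ (p := 1) (q := 2) (μ := μ)
    (by norm_num) (Lp.memLp f).1
  have h1 : ∫ x, ‖f x‖ ∂μ = (eLpNorm f 1 μ).toReal := by
    rw [eLpNorm_one_eq_lintegral_enorm, integral_norm_eq_lintegral_enorm (Lp.memLp f).1]
  rw [h1, Lp.norm_def, mul_comm]
  refine (ENNReal.toReal_mono (ENNReal.mul_ne_top (Lp.memLp f).eLpNorm_ne_top
    (ENNReal.rpow_ne_top_of_nonneg (by norm_num) (measure_ne_top _ _))) h).trans
    (le_of_eq ?_)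
  rw [ENNReal.toReal_mul, ← ENNReal.toReal_rpow, measureReal_def]
  norm_num

theorem memLp_kernelFun {m : X → X → ℝ} (hm : Measurable (Function.uncurry m)) {M : ℝ}
    (hM : ∀ x y, |m x y| ≤ M) (f : Lp ℂ 2 μ) : MemLp (kernelFun μ m f) 2 μ :=
  MemLp.of_bound
    (stronglyMeasurable_kernelFun hm (Lp.stronglyMeasurable f).measurable).aestronglyMeasurable
    _ (Eventually.of_forall (norm_kernelFun_le hM (Lp.integrable_two f)))

/-- The integral operator with bounded measurable kernel `m` on `L²(μ)`. -/
def kernelOp (m : X → X → ℝ) (hm : Measurable (Function.uncurry m)) {M : ℝ}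
    (hM : ∀ x y, |m x y| ≤ M) : Lp ℂ 2 μ →L[ℂ] Lp ℂ 2 μ :=
  LinearMap.mkContinuous
    { toFun := fun f => (memLp_kernelFun hm hM f).toLp _
      map_add' := fun f g => by
        rw [← MemLp.toLp_add]
        congr 1
        rw [kernelFun_congr (Lp.coeFn_add f g)]
        ext x
        simp only [kernelFun, Pi.add_apply, mul_add]
        exact integral_add (integrable_kernel_mul hm hM (Lp.integrable_two f) x)
          (integrable_kernel_mul hm hM (Lp.integrable_two g) x)
      map_smul' := fun c f => by
        rw [RingHom.id_apply, ← MemLp.toLp_const_smul]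
        congr 1
        rw [kernelFun_congr (Lp.coeFn_smul c f)]
        ext x
        simp only [kernelFun, Pi.smul_apply, smul_eq_mul, mul_left_comm _ c]
        exact integral_const_mul _ _ }
    -- Passing from `L²` to `L¹` and from a uniform bound back to `L²` each cost `μ(X)^(1/2)`.
    (max M 0 * μ.real univ) fun f => by
      have hM' : ∀ x y, |m x y| ≤ max M 0 := fun x y => (hM x y).trans (le_max_left _ _)
      have h1 := Lp.norm_le_of_ae_bound (p := 2) (μ := μ)
        (f := (memLp_kernelFun hm hM f).toLp (kernelFun μ m f))
        (C := max M 0 * (μ.real univ ^ (2 : ℝ)⁻¹ * ‖f‖)) (by positivity) (by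
          filter_upwards [MemLp.coeFn_toLp (memLp_kernelFun hm hM f)] with x hx
          rw [hx]
          refine (norm_kernelFun_le hM' (Lp.integrable_two f) x).trans ?_
          gcongr
          exact Lp.integral_norm_le f)
      refine h1.trans (le_of_eq ?_)
      have h2 : μ.real univ ^ (2 : ℝ)⁻¹ * μ.real univ ^ (2 : ℝ)⁻¹ = μ.real univ := by
        rw [← Real.rpow_add_of_nonneg (by positivity) (by norm_num) (by norm_num)]
        norm_num
      have h3 : ((2 : ℝ≥0∞).toReal)⁻¹ = (2 : ℝ)⁻¹ := by norm_num
      rw [measureReal_def] at h2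
      have h4 : (measureUnivNNReal μ : ℝ) = (μ univ).toReal := rfl
      simp only [measureReal_def, h3, h4]
      linear_combination max M 0 * ‖f‖ * h2

variable {m m' : X → X → ℝ} {hm : Measurable (Function.uncurry m)}
  {hm' : Measurable (Function.uncurry m')} {M M' : ℝ} {hM : ∀ x y, |m x y| ≤ M}
  {hM' : ∀ x y, |m' x y| ≤ M'}

theorem coeFn_kernelOp (f : Lp ℂ 2 μ) : kernelOp m hm hM f =ᵐ[μ] kernelFun μ m f :=
  MemLp.coeFn_toLp (memLp_kernelFun hm hM f)

theorem norm_kernelOp_le (h0 : 0 ≤ M) : ‖(kernelOp m hm hM : Lp ℂ 2 μ →L[ℂ] Lp ℂ 2 μ)‖ ≤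
    M * μ.real univ := by
  unfold kernelOp
  exact (LinearMap.mkContinuous_norm_le _ (by positivity) _).trans (by rw [max_eq_left h0])

theorem inner_kernelOp (f g : Lp ℂ 2 μ) : ⟪f, kernelOp m hm hM g⟫_ℂ =
    ∫ x, ∫ y, (starRingEnd ℂ (f x)) * ((m x y : ℂ) * g y) ∂μ ∂μ := by
  rw [L2.inner_def]
  refine integral_congr_ae ?_
  filter_upwards [coeFn_kernelOp (hm := hm) (hM := hM) g] with x hx
  rw [hx, RCLike.inner_apply', kernelFun, ← integral_const_mul]

theorem integrable_prod_kernel (hm : Measurable (Function.uncurry m))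
    (hM : ∀ x y, |m x y| ≤ M) (f g : Lp ℂ 2 μ) :
    Integrable (fun p : X × X => (starRingEnd ℂ (f p.1)) * ((m p.1 p.2 : ℂ) * g p.2))
      (μ.prod μ) := by
  have h1 : Integrable (fun p : X × X => (starRingEnd ℂ (f p.1)) * g p.2) (μ.prod μ) :=
    Integrable.mul_prod (f := fun x => starRingEnd ℂ (f x))
      ((Lp.integrable_two f).congr' (by
        exact (Complex.continuous_conj.comp_aestronglyMeasurable (Lp.memLp f).1)) (by simp))
      (Lp.integrable_two g)
  have h2 := h1.bdd_mul (f := fun p : X × X => (m p.1 p.2 : ℂ)) (c := M)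
    (Complex.measurable_ofReal.comp hm).aestronglyMeasurable
    (Eventually.of_forall fun p => by rw [Complex.norm_real]; exact hM _ _)
  refine h2.congr (Eventually.of_forall fun p => ?_)
  simp only
  ring

theorem kernelOp_isSymmetric (hsymm : ∀ x y, m x y = m y x) :
    ((kernelOp m hm hM : Lp ℂ 2 μ →L[ℂ] Lp ℂ 2 μ) : Lp ℂ 2 μ →ₗ[ℂ] Lp ℂ 2 μ).IsSymmetric := by
  intro f g
  change ⟪kernelOp m hm hM f, g⟫_ℂ = ⟪f, kernelOp m hm hM g⟫_ℂ
  rw [← inner_conj_symm, inner_kernelOp, inner_kernelOp, ← integral_conj]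
  simp_rw [← integral_conj]
  rw [integral_integral_swap]
  · refine integral_congr_ae (Eventually.of_forall fun x => ?_)
    refine integral_congr_ae (Eventually.of_forall fun y => ?_)
    simp only [map_mul, Complex.conj_conj, Complex.conj_ofReal, hsymm y x]
    ring
  · have := (integrable_prod_kernel hm hM g f)
    exact this.congr' (Complex.continuous_conj.comp_aestronglyMeasurable this.1)
      (Eventually.of_forall fun p => by simp [Function.uncurry])

theorem kernelOp_sub {M'' : ℝ} {hm'' : Measurable (Function.uncurry fun x y => m x y - m' x y)}
    {hM'' : ∀ x y, |m x y - m' x y| ≤ M''} :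
    (kernelOp m hm hM - kernelOp m' hm' hM' : Lp ℂ 2 μ →L[ℂ] Lp ℂ 2 μ) =
      kernelOp (fun x y => m x y - m' x y) hm'' hM'' := by
  ext1 f
  apply Lp.ext
  rw [sub_apply]
  filter_upwards [Lp.coeFn_sub (kernelOp m hm hM f) (kernelOp m' hm' hM' f),
    coeFn_kernelOp (hm := hm) (hM := hM) f, coeFn_kernelOp (hm := hm') (hM := hM') f,
    coeFn_kernelOp (hm := hm'') (hM := hM'') f] with x h1 h2 h3 h4
  rw [h1, Pi.sub_apply, h2, h3, h4]
  simp only [kernelFun]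
  rw [← integral_sub (integrable_kernel_mul hm hM (Lp.integrable_two f) x)
    (integrable_kernel_mul hm' hM' (Lp.integrable_two f) x)]
  congr 1
  ext y
  push_cast
  ring

end KernelOperator

/-! ### The regularized operator -/

theorem abs_exp_neg_mul_sub_le {a b r : ℝ} (ha : 0 ≤ a) (hb : 0 ≤ b) (hr : 0 ≤ r) :
    |Real.exp (-a * r) - Real.exp (-b * r)| ≤ |a - b| * r := by
  wlog hab : a ≤ b generalizing a b
  · rw [abs_sub_comm, abs_sub_comm a]
    exact this hb ha (not_le.1 hab).le
  have h1 : Real.exp (-b * r) ≤ Real.exp (-a * r) :=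
    Real.exp_le_exp.2 (by nlinarith)
  rw [abs_of_nonneg (by linarith), abs_sub_comm, abs_of_nonneg (by linarith)]
  have h2 : Real.exp (-b * r) = Real.exp (-a * r) * Real.exp (-((b - a) * r)) := by
    rw [← Real.exp_add]; congr 1; ring
  have h3 := Real.add_one_le_exp (-((b - a) * r))
  have h4 : Real.exp (-a * r) ≤ 1 := Real.exp_le_one_iff.2 (by nlinarith)
  have h5 := Real.exp_pos (-a * r)
  have h6 : 0 ≤ (b - a) * r := mul_nonneg (by linarith) hr
  rw [h2]
  nlinarith

namespace ClosedCurve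

variable (C : ClosedCurve)

/-- The difference between the kernel and the kernel of the regularized arc length operator. -/
def smoothKernel (lam : ℝ) (x y : C.carrier) : ℝ :=
  C.kernel lam x y - (4 * Real.pi * C.arcDist x y)⁻¹

theorem kernel_comm (lam : ℝ) (x y : C.carrier) : C.kernel lam x y = C.kernel lam y x := by
  simp only [kernel, dist_comm]

theorem kernel_nonneg (lam : ℝ) (x y : C.carrier) : 0 ≤ C.kernel lam x y := by
  unfold kernel
  have := Real.pi_pos
  positivity

theorem smoothKernel_comm (lam : ℝ) (x y : C.carrier) :
    C.smoothKernel lam x y = C.smoothKernel lam y x := by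
  simp only [smoothKernel, C.kernel_comm lam x y, C.arcDist_comm x y]

theorem measurable_arcDist : Measurable fun p : C.carrier × C.carrier => C.arcDist p.1 p.2 :=
  C.continuous_arcDist.measurable

theorem continuous_arcDist_right (x : C.carrier) : Continuous fun y => C.arcDist x y := by
  unfold arcDist
  have := C.homeo.symm.continuous
  fun_prop

theorem measurable_kernel (lam : ℝ) : Measurable (Function.uncurry (C.kernel lam)) := by
  unfold Function.uncurry kernel
  fun_prop

theorem measurable_smoothKernel (lam : ℝ) :
    Measurable (Function.uncurry (C.smoothKernel lam)) :=
  (C.measurable_kernel lam).sub (C.measurable_arcDist.const_mul _).inv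

/-- Division by zero gives both singular terms the value `0` on the diagonal, so later bounds hold
at every pair. -/
theorem smoothKernel_self (lam : ℝ) (x : C.carrier) : C.smoothKernel lam x x = 0 := by
  simp [smoothKernel, kernel, arcDist]

/-- The deviation from `1 / d` has two sources: the curvature, at most `M` by chord-arc comparison,
and the exponential, at most `κ`. -/
theorem exists_abs_smoothKernel_le (lam : ℝ) : ∃ M, ∀ x y, |C.smoothKernel lam x y| ≤ M := by
  obtain ⟨c, hc, M, hM, h⟩ := C.exists_chord_arc
  set κ := Real.sqrt (-lam) with hκ
  have hκ0 : 0 ≤ κ := Real.sqrt_nonneg _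
  have hpi := Real.pi_pos
  refine ⟨(4 * Real.pi)⁻¹ * (M + κ), fun x y => ?_⟩
  by_cases hxy : x = y
  · rw [hxy, smoothKernel_self, abs_zero]; positivity
  have hr : 0 < dist x y := dist_pos.2 hxy
  have hd : 0 < C.arcDist x y := C.arcDist_pos hxy
  have h1 : C.smoothKernel lam x y =
      (4 * Real.pi)⁻¹ * (Real.exp (-κ * dist x y) * (dist x y)⁻¹ - (C.arcDist x y)⁻¹) := by
    rw [smoothKernel, kernel, ← hκ]
    field_simp
  rw [h1, abs_mul, abs_of_pos (by positivity : 0 < (4 * Real.pi)⁻¹)]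
  gcongr
  have h2 := (h x y).2
  have h3 : (C.arcDist x y)⁻¹ ≤ (dist x y)⁻¹ := inv_anti₀ hr (C.dist_le_arcDist x y)
  have h4 : Real.exp (-κ * dist x y) ≤ 1 := Real.exp_le_one_iff.2 (by nlinarith)
  have h5 : 1 - κ * dist x y ≤ Real.exp (-κ * dist x y) := by
    have := Real.add_one_le_exp (-κ * dist x y); linarith
  have h6 : 0 < (dist x y)⁻¹ := inv_pos.2 hr
  have h7 : Real.exp (-κ * dist x y) * (dist x y)⁻¹ ≤ (dist x y)⁻¹ := by nlinarith
  have h8 : (dist x y)⁻¹ - κ ≤ Real.exp (-κ * dist x y) * (dist x y)⁻¹ := by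
    have := mul_le_mul_of_nonneg_right h5 h6.le
    rw [sub_mul, one_mul, mul_assoc, mul_inv_cancel₀ hr.ne', mul_one] at this
    exact this
  rw [abs_le]
  constructor <;> linarith

/-- The bounded operator with the smooth kernel. -/
def smoothOp (lam : ℝ) : C.L2 →L[ℂ] C.L2 :=
  kernelOp (C.smoothKernel lam) (C.measurable_smoothKernel lam)
    (C.exists_abs_smoothKernel_le lam).choose_spec

theorem smoothOp_isSymmetric (lam : ℝ) : (C.smoothOp lam : C.L2 →ₗ[ℂ] C.L2).IsSymmetric :=
  kernelOp_isSymmetric (C.smoothKernel_comm lam)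

theorem coeFn_smoothOp (lam : ℝ) (f : C.L2) :
    C.smoothOp lam f =ᵐ[C.arcLength] kernelFun C.arcLength (C.smoothKernel lam) f :=
  coeFn_kernelOp f

/-- The arc terms cancel, and the difference of exponentials supplies a factor `r` that removes the
denominator. -/
theorem abs_smoothKernel_sub_le (lam mu : ℝ) (x y : C.carrier) :
    |C.smoothKernel lam x y - C.smoothKernel mu x y| ≤
      (4 * Real.pi)⁻¹ * |Real.sqrt (-lam) - Real.sqrt (-mu)| := by
  have hpi := Real.pi_pos
  by_cases hxy : x = y
  · rw [hxy, smoothKernel_self, smoothKernel_self, sub_zero, abs_zero]; positivity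
  have hr : 0 < dist x y := dist_pos.2 hxy
  have h1 : C.smoothKernel lam x y - C.smoothKernel mu x y = (4 * Real.pi)⁻¹ *
      ((Real.exp (-Real.sqrt (-lam) * dist x y) - Real.exp (-Real.sqrt (-mu) * dist x y)) /
        dist x y) := by
    rw [smoothKernel, smoothKernel, kernel, kernel]
    field_simp
    ring
  rw [h1, abs_mul, abs_of_pos (by positivity : 0 < (4 * Real.pi)⁻¹), abs_div, abs_of_pos hr]
  gcongr
  rw [div_le_iff₀ hr]
  exact abs_exp_neg_mul_sub_le (Real.sqrt_nonneg _) (Real.sqrt_nonneg _) hr.le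

theorem smoothOp_sub (lam mu : ℝ) : C.smoothOp lam - C.smoothOp mu =
    kernelOp (fun x y => C.smoothKernel lam x y - C.smoothKernel mu x y)
      ((C.measurable_smoothKernel lam).sub (C.measurable_smoothKernel mu))
      (C.abs_smoothKernel_sub_le lam mu) :=
  kernelOp_sub

theorem norm_smoothOp_sub_le (lam mu : ℝ) : ‖C.smoothOp lam - C.smoothOp mu‖ ≤
    (4 * Real.pi)⁻¹ * |Real.sqrt (-lam) - Real.sqrt (-mu)| * C.len := by
  rw [smoothOp_sub, ← C.arcLength_real_univ]
  have hpi := Real.pi_pos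
  exact norm_kernelOp_le (by positivity)

/-- The integrand of the regularized arc length operator. -/
def arcIntegrand (h : C.carrier → ℂ) (x y : C.carrier) : ℂ :=
  (h y - h x) * (((4 * Real.pi * C.arcDist x y)⁻¹ : ℝ) : ℂ)

/-- The regularized arc length operator. -/
def arcFun (h : C.carrier → ℂ) (x : C.carrier) : ℂ :=
  (∫ y, C.arcIntegrand h x y ∂C.arcLength) +
    h x * ((Real.log (C.len / 2) / (2 * Real.pi) : ℝ) : ℂ)

variable {C}

/-- The Lipschitz increment `h y - h x` compensates the singularity `1 / d`, since chords are no
longer than arcs. -/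
theorem IsLip.exists_norm_arcIntegrand_le {h : C.carrier → ℂ} (hh : C.IsLip h) :
    ∃ K, ∀ x y, ‖C.arcIntegrand h x y‖ ≤ K := by
  obtain ⟨K, hK⟩ := hh
  have hpi := Real.pi_pos
  refine ⟨K * (4 * Real.pi)⁻¹, fun x y => ?_⟩
  by_cases hxy : x = y
  · simp only [arcIntegrand, hxy, sub_self, zero_mul, norm_zero]; positivity
  have hd := C.arcDist_pos hxy
  have h1 : ‖h y - h x‖ ≤ K * C.arcDist x y := by
    rw [← dist_eq_norm, dist_comm]
    exact (hK.dist_le_mul x y).trans (by gcongr; exact C.dist_le_arcDist x y)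
  rw [arcIntegrand, norm_mul, Complex.norm_real, Real.norm_eq_abs, abs_of_pos (by positivity)]
  calc ‖h y - h x‖ * (4 * Real.pi * C.arcDist x y)⁻¹
      ≤ K * C.arcDist x y * (4 * Real.pi * C.arcDist x y)⁻¹ := by gcongr
    _ = _ := by field_simp

theorem IsLip.continuous {h : C.carrier → ℂ} (hh : C.IsLip h) : Continuous h := by
  obtain ⟨K, hK⟩ := hh
  exact hK.continuous

theorem IsLip.exists_norm_le {h : C.carrier → ℂ} (hh : C.IsLip h) : ∃ K, ∀ x, ‖h x‖ ≤ K := by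
  obtain ⟨K, hK⟩ := isCompact_univ.exists_bound_of_continuousOn hh.continuous.continuousOn
  exact ⟨K, fun x => hK x (mem_univ x)⟩

theorem IsLip.memLp {h : C.carrier → ℂ} (hh : C.IsLip h) {p : ℝ≥0∞} : MemLp h p C.arcLength := by
  obtain ⟨K, hK⟩ := hh.exists_norm_le
  exact MemLp.of_bound hh.continuous.aestronglyMeasurable K (Eventually.of_forall hK)

theorem IsLip.measurable_arcIntegrand {h : C.carrier → ℂ} (hh : C.IsLip h) :
    Measurable (Function.uncurry (C.arcIntegrand h)) := by
  have := hh.continuous.measurable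
  exact ((this.comp measurable_snd).sub (this.comp measurable_fst)).mul
    (Complex.measurable_ofReal.comp (C.measurable_arcDist.const_mul _).inv)

theorem IsLip.integrable_arcIntegrand {h : C.carrier → ℂ} (hh : C.IsLip h) (x : C.carrier) :
    Integrable (C.arcIntegrand h x) C.arcLength := by
  obtain ⟨K, hK⟩ := hh.exists_norm_arcIntegrand_le
  exact Integrable.of_bound
    (hh.measurable_arcIntegrand.comp measurable_prodMk_left).aestronglyMeasurable K
    (Eventually.of_forall (hK x))

theorem IsLip.integrable_smoothKernel_mul {h : C.carrier → ℂ} (hh : C.IsLip h) (lam : ℝ)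
    (x : C.carrier) : Integrable (fun y => (C.smoothKernel lam x y : ℂ) * h y) C.arcLength := by
  obtain ⟨M, hM⟩ := C.exists_abs_smoothKernel_le lam
  exact integrable_kernel_mul (C.measurable_smoothKernel lam) hM
    (memLp_one_iff_integrable.1 hh.memLp) x

theorem integral_compl_interval_inv_arcDist (x : C.carrier) {δ : ℝ} (hδ : 0 < δ)
    (hδL : δ ≤ C.len / 2) :
    ∫ y in (C.interval δ x)ᶜ, (4 * Real.pi * C.arcDist x y)⁻¹ ∂C.arcLength =
      (Real.log (C.len / 2) - Real.log δ) / (2 * Real.pi) := by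
  have hpi := Real.pi_pos
  have hset : (C.interval δ x)ᶜ = {y | δ ≤ C.arcDist x y} := by
    ext y; simp [interval_eq]
  have hmeas : MeasurableSet {y | δ ≤ C.arcDist x y} :=
    (isClosed_le continuous_const (C.continuous_arcDist_right x)).measurableSet
  rw [hset, ← integral_indicator hmeas, integral_arcLength]
  set q := C.homeo.symm x with hq
  have hx : x = C.homeo q := by simp [hq]
  -- Rotating `x` to the origin makes the integral independent of `x`.
  have h1 : ∀ p, {y | δ ≤ C.arcDist x y}.indicator
      (fun y => (4 * Real.pi * C.arcDist x y)⁻¹) (C.homeo p) =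
      (4 * Real.pi)⁻¹ * {p : AddCircle C.len | δ ≤ ‖p‖}.indicator (fun p => ‖p‖⁻¹) (p - q) := by
    intro p
    simp only [indicator, Set.mem_ofPred_eq, hx, arcDist_homeo, mul_inv]
    split_ifs
    · rfl
    · simp
  simp_rw [h1]
  rw [integral_const_mul, integral_sub_right_eq_self (μ := (volume : Measure (AddCircle C.len)))
    (fun p => {p : AddCircle C.len | δ ≤ ‖p‖}.indicator (fun p => ‖p‖⁻¹) p) q,
    integral_indicator (measurableSet_le measurable_const measurable_norm),
    AddCircle.integral_inv_norm hδ hδL]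
  field_simp
  ring

theorem integrableOn_compl_interval_inv_arcDist (x : C.carrier) {δ : ℝ} (hδ : 0 < δ) :
    IntegrableOn (fun y => (4 * Real.pi * C.arcDist x y)⁻¹) (C.interval δ x)ᶜ C.arcLength := by
  have hpi := Real.pi_pos
  have hset : (C.interval δ x)ᶜ = {y | δ ≤ C.arcDist x y} := by
    ext y; simp [interval_eq]
  have hmeas : MeasurableSet {y | δ ≤ C.arcDist x y} :=
    (isClosed_le continuous_const (C.continuous_arcDist_right x)).measurableSet
  rw [hset]
  refine Measure.integrableOn_of_bounded (M := (4 * Real.pi * δ)⁻¹) (measure_ne_top _ _)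
    ((C.continuous_arcDist_right x).measurable.const_mul _).inv.aestronglyMeasurable ?_
  filter_upwards [ae_restrict_mem hmeas] with y hy
  have hy' : δ ≤ C.arcDist x y := hy
  rw [Real.norm_eq_abs, abs_of_nonneg (inv_nonneg.2 (mul_nonneg (by positivity)
    (C.arcDist_nonneg x y)))]
  gcongr

theorem measurableSet_interval (δ : ℝ) (x : C.carrier) : MeasurableSet (C.interval δ x) := by
  rw [interval_eq]
  exact (isOpen_lt (C.continuous_arcDist_right x) continuous_const).measurableSet

/-- Dominated convergence. The centre is removed for every `δ > 0`, which `G x = 0` makes harmless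
without any appeal to null points. -/
theorem tendsto_setIntegral_compl_interval {G : C.carrier → ℂ} (hG : Integrable G C.arcLength)
    {x : C.carrier} (hx : G x = 0) :
    Tendsto (fun δ => ∫ y in (C.interval δ x)ᶜ, G y ∂C.arcLength) (𝓝[>] 0)
      (𝓝 (∫ y, G y ∂C.arcLength)) := by
  simp_rw [← integral_indicator (measurableSet_interval _ x).compl]
  refine tendsto_integral_filter_of_dominated_convergence (fun y => ‖G y‖)
    (Eventually.of_forall fun δ =>
      hG.aestronglyMeasurable.indicator (measurableSet_interval δ x).compl)
    (Eventually.of_forall fun δ => Eventually.of_forall fun y => norm_indicator_le_norm_self _ _)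
    hG.norm (Eventually.of_forall fun y => ?_)
  by_cases hxy : x = y
  · subst hxy
    refine tendsto_const_nhds.congr fun δ => ?_
    simp [indicator, hx]
  · refine tendsto_const_nhds.congr' ?_
    filter_upwards [Ioo_mem_nhdsGT (C.arcDist_pos hxy)] with δ hδ
    rw [indicator_of_mem]
    rw [interval_eq]
    exact not_lt.2 hδ.2.le

/-- On the truncated domain `h y k(x, y)` splits into two integrable terms plus `h x / (4π d)`,
whose integral cancels the counterterm up to `h x log (L/2) / (2π)`. -/
theorem IsLip.isRegularization {h : C.carrier → ℂ} (hh : C.IsLip h) (lam : ℝ) :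
    C.IsRegularization lam h
      (C.arcFun h + kernelFun C.arcLength (C.smoothKernel lam) h) := by
  intro x
  have hpi := Real.pi_pos
  have hL := C.len_pos
  have h1 := tendsto_setIntegral_compl_interval (hh.integrable_arcIntegrand x) (x := x)
    (by simp [arcIntegrand])
  have h2 := tendsto_setIntegral_compl_interval (hh.integrable_smoothKernel_mul lam x) (x := x)
    (by simp [smoothKernel_self])
  have h3 := (h1.add (tendsto_const_nhds
    (x := h x * ((Real.log (C.len / 2) / (2 * Real.pi) : ℝ) : ℂ)))).add h2
  refine h3.congr' ?_
  filter_upwards [Ioo_mem_nhdsGT (by positivity : 0 < C.len / 2)] with δ hδ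
  have h4 := integral_compl_interval_inv_arcDist x hδ.1 hδ.2.le
  have h5 : Integrable (fun y => (((4 * Real.pi * C.arcDist x y)⁻¹ : ℝ) : ℂ))
      (C.arcLength.restrict (C.interval δ x)ᶜ) :=
    (integrableOn_compl_interval_inv_arcDist x hδ.1).ofReal
  have h6 : ∫ y in (C.interval δ x)ᶜ, h y * (C.kernel lam x y : ℂ) ∂C.arcLength =
      ∫ y in (C.interval δ x)ᶜ, (C.arcIntegrand h x y + (C.smoothKernel lam x y : ℂ) * h y +
        h x * (((4 * Real.pi * C.arcDist x y)⁻¹ : ℝ) : ℂ)) ∂C.arcLength := by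
    congr 1
    ext y
    simp only [arcIntegrand, smoothKernel]
    push_cast
    ring
  have h7 := (hh.integrable_arcIntegrand x).integrableOn (s := (C.interval δ x)ᶜ)
  have h8 := (hh.integrable_smoothKernel_mul lam x).integrableOn (s := (C.interval δ x)ᶜ)
  have h78 : IntegrableOn (fun y => C.arcIntegrand h x y + (C.smoothKernel lam x y : ℂ) * h y)
      (C.interval δ x)ᶜ C.arcLength := h7.add h8
  rw [truncated, h6, integral_add h78 (h5.const_mul _), integral_add h7 h8,
    integral_const_mul]
  have h9 : ∫ y in (C.interval δ x)ᶜ, (((4 * Real.pi * C.arcDist x y)⁻¹ : ℝ) : ℂ) ∂C.arcLength =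
      (((Real.log (C.len / 2) - Real.log δ) / (2 * Real.pi) : ℝ) : ℂ) := by
    rw [← h4]; exact integral_ofReal
  rw [h9]
  push_cast
  ring

theorem IsRegularization.unique {lam : ℝ} {h k k' : C.carrier → ℂ}
    (hk : C.IsRegularization lam h k) (hk' : C.IsRegularization lam h k') : k = k' :=
  funext fun x => tendsto_nhds_unique (hk x) (hk' x)

theorem IsLip.memLp_arcFun {h : C.carrier → ℂ} (hh : C.IsLip h) :
    MemLp (C.arcFun h) 2 C.arcLength := by
  obtain ⟨K, hK⟩ := hh.exists_norm_arcIntegrand_le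
  refine MemLp.add ?_ (hh.memLp.mul_const _)
  refine MemLp.of_bound
    hh.measurable_arcIntegrand.stronglyMeasurable.integral_prod_right.aestronglyMeasurable
    (K * C.arcLength.real univ) (Eventually.of_forall fun x => ?_)
  exact norm_integral_le_of_norm_le_const (Eventually.of_forall (hK x))

theorem IsLip.memLp_kernelFun {h : C.carrier → ℂ} (hh : C.IsLip h) (lam : ℝ) :
    MemLp (kernelFun C.arcLength (C.smoothKernel lam) h) 2 C.arcLength := by
  rw [← kernelFun_congr hh.memLp.coeFn_toLp]
  exact _root_.memLp_kernelFun (C.measurable_smoothKernel lam)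
    (C.exists_abs_smoothKernel_le lam).choose_spec _

/-- Open subsets of the curve have positive length, so a class in `L²` has at most one continuous
representative and the relation is single-valued. -/
theorem graph_B (lam : ℝ) : (C.B lam).graph = C.graphB lam := by
  refine Submodule.toLinearPMap_graph_eq _ ?_
  rintro ⟨f, g⟩ ⟨h, k, hh, hk, hf, hg⟩ (rfl : f = 0)
  have h0 : h = 0 := by
    refine (Continuous.ae_eq_iff_eq C.arcLength hh.continuous continuous_const).1 ?_
    filter_upwards [hf, Lp.coeFn_zero ℂ 2 C.arcLength] with x h1 h2
    rw [← h1, h2]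
    rfl
  subst h0
  have hk0 : k = 0 := by
    refine hk.unique fun x => ?_
    have h0 : C.truncated lam 0 x = fun _ => 0 := by
      ext δ
      simp [truncated]
    rw [h0]
    exact tendsto_const_nhds
  subst hk0
  exact Lp.ext (hg.trans (Lp.coeFn_zero ℂ 2 C.arcLength).symm)

theorem mem_graph_B_iff {lam : ℝ} {f g : C.L2} : (f, g) ∈ (C.B lam).graph ↔
    ∃ h, C.IsLip h ∧ f =ᵐ[C.arcLength] h ∧
      g =ᵐ[C.arcLength] C.arcFun h + kernelFun C.arcLength (C.smoothKernel lam) h := by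
  rw [graph_B]
  constructor
  · rintro ⟨h, k, hh, hk, hf, hg⟩
    rw [hk.unique (hh.isRegularization lam)] at hg
    exact ⟨h, hh, hf, hg⟩
  · rintro ⟨h, hh, hf, hg⟩
    exact ⟨h, _, hh, hh.isRegularization lam, hf, hg⟩

theorem IsLip.toLp_mem_graph_B {h : C.carrier → ℂ} (hh : C.IsLip h) (lam : ℝ) :
    (hh.memLp.toLp h, (hh.memLp_arcFun.add (hh.memLp_kernelFun lam)).toLp _) ∈
      (C.B lam).graph :=
  mem_graph_B_iff.2 ⟨h, hh, MemLp.coeFn_toLp _, MemLp.coeFn_toLp _⟩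

end ClosedCurve

/-! ### The Fourier basis of the curve -/

namespace ClosedCurve

variable (C : ClosedCurve)

/-- The normalized Fourier mode on the curve. -/
def mode (n : ℤ) (x : C.carrier) : ℂ :=
  (((Real.sqrt C.len)⁻¹ : ℝ) : ℂ) * fourier n (C.homeo.symm x)

theorem norm_fourier_coe_sub_one_le (n : ℤ) (u : ℝ) :
    ‖fourier n (u : AddCircle C.len) - 1‖ ≤ 2 * Real.pi * |(n : ℝ)| / C.len * |u| := by
  have hL := C.len_pos
  have hpi := Real.pi_pos
  have h1 : fourier n (u : AddCircle C.len) =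
      Complex.exp (Complex.I * ((2 * Real.pi * n * u / C.len : ℝ) : ℂ)) := by
    rw [fourier_coe_apply]
    congr 1
    push_cast
    ring
  rw [h1]
  refine (Real.norm_exp_I_mul_ofReal_sub_one_le).trans (le_of_eq ?_)
  rw [Real.norm_eq_abs, abs_div, abs_mul, abs_mul, abs_mul, abs_of_pos hL, abs_of_pos hpi]
  norm_num
  ring

theorem exists_coe_eq_abs_eq_norm (p : AddCircle C.len) :
    ∃ u : ℝ, p = (u : AddCircle C.len) ∧ |u| = ‖p‖ := by
  obtain ⟨t, rfl⟩ := QuotientAddGroup.mk_surjective p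
  refine ⟨t - round (C.len⁻¹ * t) * C.len, ?_, ?_⟩
  · change ((t : ℝ) : AddCircle C.len) = _
    rw [AddCircle.coe_sub, eq_comm, sub_eq_self]
    exact (QuotientAddGroup.eq_zero_iff _).2 ⟨_, zsmul_eq_mul _ _⟩
  · exact (AddCircle.norm_eq C.len).symm

theorem norm_fourier_sub_one_le (n : ℤ) (p : AddCircle C.len) :
    ‖fourier n p - 1‖ ≤ 2 * Real.pi * |(n : ℝ)| / C.len * ‖p‖ := by
  obtain ⟨u, rfl, hu⟩ := C.exists_coe_eq_abs_eq_norm p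
  rw [← hu]
  exact C.norm_fourier_coe_sub_one_le n u

theorem re_fourier (n : ℤ) (p : AddCircle C.len) :
    (fourier n p).re = Real.cos (2 * Real.pi * n * ‖p‖ / C.len) := by
  obtain ⟨u, rfl, hu⟩ := C.exists_coe_eq_abs_eq_norm p
  have h1 : fourier n (u : AddCircle C.len) =
      Complex.exp (((2 * Real.pi * n * u / C.len : ℝ) : ℂ) * Complex.I) := by
    rw [fourier_coe_apply]
    congr 1
    push_cast
    ring
  rw [h1, Complex.exp_ofReal_mul_I_re, ← hu]
  rcases abs_choice u with h | h
  · rw [h]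
  · rw [h, ← Real.cos_neg]; congr 1; ring

theorem fourier_add_right (n : ℤ) (p q : AddCircle C.len) :
    fourier n (p + q) = fourier n p * fourier n q := by
  simp only [fourier_apply, smul_add, AddCircle.toCircle_add, Circle.coe_mul]

theorem norm_fourier_apply (n : ℤ) (p : AddCircle C.len) : ‖fourier n p‖ = 1 := by
  rw [fourier_apply, Circle.norm_coe]

/-- Characters are Lipschitz in arc distance, and the chord-arc bound transfers this to Euclidean
distance. This places the Fourier basis in the domain of `B_λ`. -/
theorem isLip_mode (n : ℤ) : C.IsLip (C.mode n) := by
  obtain ⟨c, hc, M, hM, h⟩ := C.exists_chord_arc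
  have hL := C.len_pos
  have hpi := Real.pi_pos
  set K : ℝ := (Real.sqrt C.len)⁻¹ * (2 * Real.pi * |(n : ℝ)| / C.len * c⁻¹) with hK
  have hK0 : 0 ≤ K := by positivity
  refine ⟨⟨K, hK0⟩, LipschitzWith.of_dist_le_mul fun y x => ?_⟩
  rw [dist_eq_norm, mode, mode, ← mul_sub, norm_mul, Complex.norm_real, Real.norm_eq_abs,
    abs_of_pos (by positivity)]
  set p := C.homeo.symm x with hp
  set q := C.homeo.symm y with hq
  have h1 : fourier n q - fourier n p = fourier n p * (fourier n (q - p) - 1) := by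
    rw [mul_sub, ← fourier_add_right, mul_one, add_sub_cancel]
  have h2 : C.arcDist x y ≤ c⁻¹ * dist y x := by
    rw [inv_mul_eq_div, le_div_iff₀ hc, mul_comm, dist_comm]
    exact (h x y).1
  rw [h1, norm_mul, norm_fourier_apply, one_mul]
  change _ ≤ K * dist y x
  rw [hK, mul_assoc, mul_assoc]
  gcongr
  refine (C.norm_fourier_sub_one_le n (q - p)).trans ?_
  gcongr
  exact h2

/-- The Fourier mode as an element of `L²`. -/
def modeL2 (n : ℤ) : C.L2 := (C.isLip_mode n).memLp.toLp (C.mode n)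

theorem coeFn_modeL2 (n : ℤ) : C.modeL2 n =ᵐ[C.arcLength] C.mode n := MemLp.coeFn_toLp _

theorem inner_modeL2 (n : ℤ) {f : C.L2} {h : C.carrier → ℂ} (hf : f =ᵐ[C.arcLength] h) :
    ⟪C.modeL2 n, f⟫_ℂ = (((Real.sqrt C.len)⁻¹ : ℝ) : ℂ) *
      ∫ p : AddCircle C.len, fourier (-n) p * h (C.homeo p) := by
  rw [L2.inner_def, ← integral_const_mul]
  have h1 : ∫ x, ⟪C.modeL2 n x, f x⟫_ℂ ∂C.arcLength =
      ∫ x, starRingEnd ℂ (C.mode n x) * h x ∂C.arcLength := by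
    refine integral_congr_ae ?_
    filter_upwards [hf, C.coeFn_modeL2 n] with x h1 h2
    rw [h1, h2, RCLike.inner_apply']
  rw [h1, integral_arcLength]
  congr 1
  ext p
  simp only [mode, map_mul, Complex.conj_ofReal, Homeomorph.symm_apply_apply, fourier_neg]
  ring

theorem orthonormal_modeL2 : Orthonormal ℂ C.modeL2 := by
  have hL := C.len_pos
  rw [orthonormal_iff_ite]
  intro m n
  rw [C.inner_modeL2 m (C.coeFn_modeL2 n)]
  have h1 : ∫ p : AddCircle C.len, fourier (-m) p * C.mode n (C.homeo p) =
      (((Real.sqrt C.len)⁻¹ : ℝ) : ℂ) * (C.len * fourierCoeff (T := C.len) (fourier n) m) := by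
    rw [fourierCoeff, AddCircle.integral_haarAddCircle]
    simp only [mode, Homeomorph.symm_apply_apply, smul_eq_mul, mul_left_comm (fourier (-m) _)]
    rw [integral_const_mul, Complex.real_smul]
    push_cast
    have : (C.len : ℂ) ≠ 0 := by exact_mod_cast hL.ne'
    field_simp
  rw [h1, fourierCoeff_fourier, ← mul_assoc, ← mul_assoc, ← Complex.ofReal_mul,
    ← Complex.ofReal_mul, ← mul_inv, Real.mul_self_sqrt hL.le, inv_mul_cancel₀ hL.ne']
  simp [Pi.single_apply]

theorem eq_zero_of_inner_modeL2 {f : C.L2} (hf : ∀ n, ⟪C.modeL2 n, f⟫_ℂ = 0) : f = 0 := by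
  have hL := C.len_pos
  have hs : (((Real.sqrt C.len)⁻¹ : ℝ) : ℂ) ≠ 0 := by
    have : 0 < (Real.sqrt C.len)⁻¹ := by positivity
    exact_mod_cast this.ne'
  have h0 : ∀ n, ∫ p : AddCircle C.len, fourier (-n) p * f (C.homeo p) = 0 := fun n => by
    have := hf n
    rw [C.inner_modeL2 n (h := f) (ae_eq_refl _)] at this
    exact (mul_eq_zero.1 this).resolve_left hs
  have hmem : MemLp (fun p => f (C.homeo p)) 2 (volume : Measure (AddCircle C.len)) :=
    (Lp.memLp f).comp_measurePreserving C.measurePreserving_homeo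
  have hmem' := memLp_haarAddCircle_iff.2 hmem
  have h1 : hmem'.toLp _ = 0 := by
    apply fourierBasis.repr.injective
    ext n
    rw [fourierBasis_repr, fourierCoeff_congr_ae hmem'.coeFn_toLp, fourierCoeff,
      AddCircle.integral_haarAddCircle]
    simp only [smul_eq_mul, h0 n]
    simp
  have h2 : (fun p => f (C.homeo p)) =ᵐ[AddCircle.haarAddCircle] 0 := by
    have := hmem'.coeFn_toLp
    rw [h1] at this
    exact this.symm.trans (Lp.coeFn_zero _ _ _)
  have h3 : ∀ᵐ p ∂(volume : Measure (AddCircle C.len)), f (C.homeo p) = 0 := by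
    rw [AddCircle.volume_eq_smul_haarAddCircle]
    exact Measure.ae_smul_measure h2 _
  apply Lp.ext
  refine EventuallyEq.trans ?_ (Lp.coeFn_zero _ _ _).symm
  have h4 : ∀ᵐ x ∂(volume : Measure (AddCircle C.len)).map C.homeo, f x = 0 :=
    C.homeo.measurableEmbedding.ae_map_iff.2 h3
  rw [← arcLength_eq_map] at h4
  exact h4

/-- The Fourier basis of `L²(Σ)`. -/
def modeBasis : HilbertBasis ℤ ℂ C.L2 :=
  HilbertBasis.mkOfOrthogonalEqBot C.orthonormal_modeL2 (by
    rw [Submodule.eq_bot_iff]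
    intro f hf
    exact C.eq_zero_of_inner_modeL2 fun n =>
      (Submodule.mem_orthogonal _ _).1 hf _ (Submodule.subset_span ⟨n, rfl⟩))

theorem coe_modeBasis : ⇑C.modeBasis = C.modeL2 := HilbertBasis.coe_mkOfOrthogonalEqBot _ _

variable {C}

/-- The weight of the arc length operator on the circle. -/
theorem integrable_fourier_sub_one_mul (n : ℤ) : Integrable (fun u : AddCircle C.len =>
    (fourier n u - 1) * (((4 * Real.pi * ‖u‖)⁻¹ : ℝ) : ℂ)) := by
  have hL := C.len_pos
  have hpi := Real.pi_pos
  refine Integrable.of_bound ?_ (2 * Real.pi * |(n : ℝ)| / C.len * (4 * Real.pi)⁻¹)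
    (Eventually.of_forall fun u => ?_)
  · refine Measurable.aestronglyMeasurable ?_
    have := (fourier n : C(AddCircle C.len, ℂ)).continuous.measurable
    fun_prop
  · by_cases hu : u = 0
    · simp [hu]; positivity
    have hu' : 0 < ‖u‖ := norm_pos_iff.2 hu
    rw [norm_mul, Complex.norm_real, Real.norm_eq_abs, abs_of_pos (by positivity)]
    calc _ ≤ 2 * Real.pi * |(n : ℝ)| / C.len * ‖u‖ * (4 * Real.pi * ‖u‖)⁻¹ := by
          gcongr
          exact C.norm_fourier_sub_one_le n u
      _ = _ := by field_simp

/-- The reflection `u ↦ -u` conjugates the integrand, so the integral is real and equals that of the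
real part. -/
theorem integral_fourier_sub_one_mul (n : ℤ) :
    ∫ u : AddCircle C.len, (fourier n u - 1) * (((4 * Real.pi * ‖u‖)⁻¹ : ℝ) : ℂ) =
      ((∫ u : AddCircle C.len,
        (Real.cos (2 * Real.pi * n * ‖u‖ / C.len) - 1) / (4 * Real.pi * ‖u‖) : ℝ) : ℂ) := by
  set g : AddCircle C.len → ℂ := fun u => (fourier n u - 1) * (((4 * Real.pi * ‖u‖)⁻¹ : ℝ) : ℂ)
    with hg
  have hgi : Integrable g := integrable_fourier_sub_one_mul n
  have h1 : ∫ u, g u = starRingEnd ℂ (∫ u, g u) := by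
    rw [← integral_conj, ← integral_neg_eq_self g]
    congr 1
    ext u
    simp only [hg, map_mul, map_sub, Complex.conj_ofReal, map_one, norm_neg]
    rw [← fourier_neg]
    congr 2
    simp [fourier_apply]
  have h2 : ((∫ u, g u).re : ℂ) = ∫ u, g u := Complex.conj_eq_iff_re.1 h1.symm
  rw [← h2]
  congr 1
  have h3 : (∫ u, g u).re = ∫ u, (g u).re := (integral_re hgi).symm
  rw [h3]
  congr 1
  ext u
  simp only [hg, Complex.re_mul_ofReal, Complex.sub_re, Complex.one_re, C.re_fourier, div_eq_mul_inv]

theorem arcFun_homeo {h : C.carrier → ℂ} (p : AddCircle C.len) :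
    C.arcFun h (C.homeo p) = (∫ u : AddCircle C.len,
      (h (C.homeo (p + u)) - h (C.homeo p)) * (((4 * Real.pi * ‖u‖)⁻¹ : ℝ) : ℂ)) +
      h (C.homeo p) * ((Real.log (C.len / 2) / (2 * Real.pi) : ℝ) : ℂ) := by
  rw [arcFun, integral_arcLength, ← integral_add_left_eq_self _ p]
  simp only [arcIntegrand, arcDist_homeo, add_sub_cancel_left]

/-- The regularized operator averages the differences `H (p + u) - H p`; after Fubini, each
translation by `u` contributes the factor `fourier n u - 1`. -/
theorem IsLip.integral_fourier_mul_arcFun {h : C.carrier → ℂ} (hh : C.IsLip h) (n : ℤ) :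
    ∫ p : AddCircle C.len, fourier (-n) p * C.arcFun h (C.homeo p) =
      C.multiplier n * ∫ p : AddCircle C.len, fourier (-n) p * h (C.homeo p) := by
  have hpi := Real.pi_pos
  set H : AddCircle C.len → ℂ := fun p => h (C.homeo p) with hH
  have hHc : Continuous H := hh.continuous.comp C.homeo.continuous
  have hF : Continuous (fourier (-n) : AddCircle C.len → ℂ) := ContinuousMap.continuous _
  set w : AddCircle C.len → ℂ := fun u => (((4 * Real.pi * ‖u‖)⁻¹ : ℝ) : ℂ) with hw
  have hwm : Measurable w := by rw [hw]; fun_prop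
  have hcompact : ∀ {G : AddCircle C.len → ℂ}, Continuous G → Integrable G := fun hG =>
    hG.integrable_of_hasCompactSupport (HasCompactSupport.of_compactSpace _)
  set J := ∫ p, fourier (-n) p * H p with hJ
  obtain ⟨K, hK⟩ := hh.exists_norm_arcIntegrand_le
  have hbound : ∀ p u, ‖(H (p + u) - H p) * w u‖ ≤ K := fun p u => by
    have := hK (C.homeo p) (C.homeo (p + u))
    rwa [arcIntegrand, arcDist_homeo, add_sub_cancel_left] at this
  have hint : Integrable (Function.uncurry fun p u => fourier (-n) p * ((H (p + u) - H p) * w u))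
      ((volume : Measure (AddCircle C.len)).prod volume) := by
    refine Integrable.of_bound ?_ K (Eventually.of_forall fun z => ?_)
    · refine Measurable.aestronglyMeasurable ?_
      have h1 : Measurable fun z : AddCircle C.len × AddCircle C.len => H (z.1 + z.2) :=
        (hHc.comp continuous_add).measurable
      have h2 := hHc.measurable
      have h3 := hF.measurable
      exact (h3.comp measurable_fst).mul
        ((h1.sub (h2.comp measurable_fst)).mul (hwm.comp measurable_snd))
    · change ‖fourier (-n) z.1 * _‖ ≤ K
      rw [norm_mul, norm_fourier_apply, one_mul]
      exact hbound _ _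
  -- The difference is split only for fixed `u`, where `w u` is a constant; its singularity at `0`
  -- is not integrable on its own.
  have hinner : ∀ u, ∫ p, fourier (-n) p * ((H (p + u) - H p) * w u) =
      J * ((fourier n u - 1) * w u) := fun u => by
    have h1 : ∀ p, fourier (-n) p * ((H (p + u) - H p) * w u) =
        (fourier n u * (fourier (-n) (p + u) * H (p + u)) - fourier (-n) p * H p) * w u :=
      fun p => by
        have h2 : fourier n u * fourier (-n) u = 1 := by
          rw [← fourier_add]; simp
        rw [fourier_add_right]
        linear_combination (-(fourier (-n) p * H (p + u) * w u)) * h2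
    simp_rw [h1]
    rw [integral_mul_const, integral_sub, integral_const_mul,
      integral_add_right_eq_self (fun p => fourier (-n) p * H p) u]
    · ring
    · apply hcompact
      fun_prop
    · exact hcompact (hF.mul hHc)
  calc ∫ p : AddCircle C.len, fourier (-n) p * C.arcFun h (C.homeo p)
      = ∫ p, ((∫ u, fourier (-n) p * ((H (p + u) - H p) * w u)) +
          fourier (-n) p * H p * ((Real.log (C.len / 2) / (2 * Real.pi) : ℝ) : ℂ)) := by
        congr 1
        ext p
        rw [arcFun_homeo, mul_add, ← integral_const_mul, mul_assoc]
    _ = (∫ p, ∫ u, fourier (-n) p * ((H (p + u) - H p) * w u)) +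
          J * ((Real.log (C.len / 2) / (2 * Real.pi) : ℝ) : ℂ) := by
        have h1 : Integrable fun p => ∫ u, fourier (-n) p * ((H (p + u) - H p) * w u) :=
          hint.integral_prod_left
        have h2 : Integrable fun p => fourier (-n) p * H p *
            ((Real.log (C.len / 2) / (2 * Real.pi) : ℝ) : ℂ) :=
          (hcompact (hF.mul hHc)).mul_const _
        rw [integral_add h1 h2, integral_mul_const]
    _ = C.multiplier n * J := by
        rw [integral_integral_swap hint]
        simp_rw [hinner]
        rw [integral_const_mul, integral_fourier_sub_one_mul, multiplier]
        push_cast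
        ring

/-- Only an inclusion at this stage: the domain consists of Lipschitz functions, and equality
appears after taking closures. -/
theorem B_graph_le (lam : ℝ) :
    (C.B lam).graph ≤ C.modeBasis.diagGraph C.multiplier (C.smoothOp lam) := by
  rintro ⟨f, g⟩ hfg
  obtain ⟨h, hh, hf, hg⟩ := mem_graph_B_iff.1 hfg
  intro n
  simp only [coe_modeBasis]
  have h1 : C.smoothOp lam f =ᵐ[C.arcLength] kernelFun C.arcLength (C.smoothKernel lam) h := by
    rw [← kernelFun_congr hf]; exact C.coeFn_smoothOp lam f
  have h2 : (g - C.smoothOp lam f : C.L2) =ᵐ[C.arcLength] C.arcFun h := by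
    filter_upwards [hg, h1, Lp.coeFn_sub g (C.smoothOp lam f)] with x a1 a2 a3
    rw [a3, Pi.sub_apply, a1, a2, Pi.add_apply, add_sub_cancel_right]
  have h3 := C.inner_modeL2 n h2
  rw [hh.integral_fourier_mul_arcFun, mul_left_comm, ← C.inner_modeL2 n hf,
    inner_sub_right, sub_eq_iff_eq_add] at h3
  exact h3

theorem modeBasis_mem_domain (lam : ℝ) (n : ℤ) : C.modeBasis n ∈ (C.B lam).domain := by
  rw [coe_modeBasis]
  exact LinearPMap.mem_domain_of_mem_graph ((C.isLip_mode n).toLp_mem_graph_B lam)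

theorem graph_closure_B (lam : ℝ) :
    (C.B lam).closure.graph = C.modeBasis.diagGraph C.multiplier (C.smoothOp lam) :=
  HilbertBasis.graph_closure_eq (B_graph_le lam) (modeBasis_mem_domain lam)

end ClosedCurve

/-! ### Gaussian subordination of the Yukawa kernel -/

section Subordination

theorem image_sub_div_Ioi {A B : ℝ} (hA : 0 < A) (hB : 0 < B) :
    (fun u : ℝ => A * u - B / u) '' Ioi 0 = univ := by
  refine eq_univ_of_forall fun v => ?_
  have h0 : 0 ≤ v ^ 2 + 4 * A * B := by positivity
  have h1 : |v| < Real.sqrt (v ^ 2 + 4 * A * B) := by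
    rw [← Real.sqrt_sq_eq_abs]
    exact Real.sqrt_lt_sqrt (sq_nonneg v) (by nlinarith [mul_pos hA hB])
  have h2 : 0 < v + Real.sqrt (v ^ 2 + 4 * A * B) := by
    have := neg_abs_le v; linarith
  -- This is the positive root of `A u² - v u - B = 0`.
  refine ⟨(v + Real.sqrt (v ^ 2 + 4 * A * B)) / (2 * A), by
    simp only [mem_Ioi]; positivity, ?_⟩
  have h3 := Real.sq_sqrt h0
  generalize Real.sqrt (v ^ 2 + 4 * A * B) = R at h2 h3
  have h4 := h2.ne'
  simp only
  field_simp
  linear_combination h3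

theorem injOn_sub_div_Ioi {A B : ℝ} (hA : 0 < A) (hB : 0 < B) :
    InjOn (fun u : ℝ => A * u - B / u) (Ioi 0) := by
  refine StrictMonoOn.injOn fun u hu v hv huv => ?_
  have hu' : 0 < u := hu
  have h1 : A * u < A * v := by gcongr
  have h2 : B / v < B / u := by gcongr
  linarith

theorem hasDerivAt_sub_div {A B u : ℝ} (hu : u ≠ 0) :
    HasDerivAt (fun u : ℝ => A * u - B / u) (A + B / u ^ 2) u := by
  have h1 := (hasDerivAt_id u).const_mul A
  have h2 := (hasDerivAt_inv hu).const_mul B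
  have h3 := h1.sub h2
  simp only [id] at h3
  refine h3.congr_deriv ?_
  field_simp
  ring

/-- The Cauchy-Schlömilch substitution for the Gaussian. -/
theorem integral_exp_neg_sub_div_sq {A B : ℝ} (hA : 0 < A) (hB : 0 < B) :
    IntegrableOn (fun u : ℝ => Real.exp (-(A * u - B / u) ^ 2)) (Ioi 0) ∧
    ∫ u in Ioi (0 : ℝ), Real.exp (-(A * u - B / u) ^ 2) = Real.sqrt Real.pi / (2 * A) := by
  set φ : ℝ → ℝ := fun u => A * u - B / u with hφ
  set E : ℝ → ℝ := fun u => Real.exp (-(φ u) ^ 2) with hE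
  have hder : ∀ u ∈ Ioi (0 : ℝ), HasDerivWithinAt φ (A + B / u ^ 2) (Ioi 0) u := fun u hu =>
    (hasDerivAt_sub_div (ne_of_gt hu)).hasDerivWithinAt
  have hpos : ∀ u ∈ Ioi (0 : ℝ), 0 < A + B / u ^ 2 := fun u hu => by
    have : (0 : ℝ) < u := hu
    positivity
  have hgauss : Integrable fun v : ℝ => Real.exp (-v ^ 2) := by
    simpa using integrable_exp_neg_mul_sq one_pos
  have hgaussv : ∫ v : ℝ, Real.exp (-v ^ 2) = Real.sqrt Real.pi := by
    simpa using integral_gaussian 1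
  have h1 : IntegrableOn (fun u => |A + B / u ^ 2| • E u) (Ioi 0) := by
    rw [← integrableOn_image_iff_integrableOn_abs_deriv_smul measurableSet_Ioi hder
      (injOn_sub_div_Ioi hA hB) (fun v => Real.exp (-v ^ 2)), image_sub_div_Ioi hA hB,
      integrableOn_univ]
    exact hgauss
  have h2 : ∫ u in Ioi (0 : ℝ), |A + B / u ^ 2| • E u = Real.sqrt Real.pi := by
    rw [← integral_image_eq_integral_abs_deriv_smul measurableSet_Ioi hder
      (injOn_sub_div_Ioi hA hB) (fun v => Real.exp (-v ^ 2)), image_sub_div_Ioi hA hB,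
      setIntegral_univ, hgaussv]
  have hEm : Measurable E := by
    have : Measurable φ := by rw [hφ]; fun_prop
    exact ((this.pow_const 2).neg).exp
  have h3 : IntegrableOn E (Ioi 0) := by
    refine Integrable.mono' (h1.const_mul A⁻¹) hEm.aestronglyMeasurable ?_
    filter_upwards [ae_restrict_mem measurableSet_Ioi] with u hu
    have hu' : (0 : ℝ) < u := hu
    rw [abs_of_pos (hpos u hu), smul_eq_mul, Real.norm_eq_abs, abs_of_pos (Real.exp_pos _),
      ← mul_assoc]
    refine le_mul_of_one_le_left (Real.exp_pos _).le ?_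
    rw [mul_add, inv_mul_cancel₀ hA.ne']
    have : 0 < A⁻¹ * (B / u ^ 2) := by positivity
    linarith
  have hψder : ∀ u ∈ Ioi (0 : ℝ), HasDerivWithinAt (fun u => B / A / u) (-(B / A) / u ^ 2)
      (Ioi 0) u := fun u hu => by
    have := ((hasDerivAt_inv (ne_of_gt hu : u ≠ 0)).const_mul (B / A)).hasDerivWithinAt
      (s := Ioi 0)
    refine this.congr_deriv ?_
    ring
  have hψinj : InjOn (fun u => B / A / u) (Ioi (0 : ℝ)) := fun u hu v hv huv => by
    have hu' : (0 : ℝ) < u := hu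
    have hv' : (0 : ℝ) < v := hv
    simp only at huv
    field_simp at huv
    linarith
  have hψimg : (fun u => B / A / u) '' Ioi (0 : ℝ) = Ioi 0 := by
    ext v
    constructor
    · rintro ⟨u, hu, rfl⟩
      have hu' : (0 : ℝ) < u := hu
      simp only [mem_Ioi]; positivity
    · intro hv
      have hv' : (0 : ℝ) < v := hv
      refine ⟨B / A / v, by simp only [mem_Ioi]; positivity, ?_⟩
      simp only
      field_simp
  -- The inversion `u ↦ B / (A u)` flips the sign of `φ`. Hence the two terms of the Jacobian `A + B
  -- / u²` contribute equally, and the full Gaussian integral equals `2 A ∫ E`.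
  have h4 : ∫ u in Ioi (0 : ℝ), E u = ∫ u in Ioi (0 : ℝ), |-(B / A) / u ^ 2| • E u := by
    conv_lhs => rw [← hψimg]
    rw [integral_image_eq_integral_abs_deriv_smul measurableSet_Ioi hψder hψinj]
    refine setIntegral_congr_fun measurableSet_Ioi fun u hu => ?_
    have hu' : (0 : ℝ) < u := hu
    have h5 : φ (B / A / u) = -φ u := by
      simp only [hφ]
      field_simp
      ring
    simp only [hE, h5, neg_sq]
  have h6 : ∫ u in Ioi (0 : ℝ), |A + B / u ^ 2| • E u =
      A * (∫ u in Ioi (0 : ℝ), E u) + A * ∫ u in Ioi (0 : ℝ), |-(B / A) / u ^ 2| • E u := by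
    have hint : IntegrableOn (fun u => |-(B / A) / u ^ 2| • E u) (Ioi 0) := by
      rw [← hψimg] at h3
      refine ((integrableOn_image_iff_integrableOn_abs_deriv_smul measurableSet_Ioi hψder hψinj
        E).1 h3).congr_fun (fun u hu => ?_) measurableSet_Ioi
      have hu' : (0 : ℝ) < u := hu
      have h5 : φ (B / A / u) = -φ u := by
        simp only [hφ]
        field_simp
        ring
      simp only [hE, h5, neg_sq]
    rw [← integral_const_mul, ← integral_const_mul, ← integral_add (h3.const_mul A)
      (hint.const_mul A)]
    refine setIntegral_congr_fun measurableSet_Ioi fun u hu => ?_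
    have hu' : (0 : ℝ) < u := hu
    simp only [smul_eq_mul]
    rw [abs_of_pos (hpos u hu), neg_div, abs_neg, abs_of_pos (by positivity)]
    field_simp
  refine ⟨h3, ?_⟩
  rw [h6, ← h4] at h2
  rw [eq_div_iff (by positivity)]
  linarith

/-- The subordination weight. -/
def yukawaWeight (a b u : ℝ) : ℝ :=
  Real.exp (-(a / 2 / u) ^ 2) - Real.exp (-(b / 2 / u) ^ 2)

/-- Completing the square: `(a / 2u)² + u² r² = (r u - a / 2u)² + a r`. The case `a = 0` is an
ordinary Gaussian, outside the scope of the substitution. -/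
theorem integral_exp_mul_exp {a r : ℝ} (ha : 0 ≤ a) (hr : 0 < r) :
    IntegrableOn (fun u : ℝ => Real.exp (-(a / 2 / u) ^ 2) * Real.exp (-u ^ 2 * r ^ 2)) (Ioi 0) ∧
    ∫ u in Ioi (0 : ℝ), Real.exp (-(a / 2 / u) ^ 2) * Real.exp (-u ^ 2 * r ^ 2) =
      Real.sqrt Real.pi / 2 * (Real.exp (-a * r) / r) := by
  rcases ha.eq_or_lt with rfl | ha
  · have h1 : ∀ u : ℝ, Real.exp (-(0 / 2 / u) ^ 2) * Real.exp (-u ^ 2 * r ^ 2) =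
        Real.exp (-(r ^ 2) * u ^ 2) := fun u => by
      rw [← Real.exp_add]; congr 1; ring
    simp_rw [h1]
    refine ⟨(integrable_exp_neg_mul_sq (by positivity)).integrableOn, ?_⟩
    rw [integral_gaussian_Ioi, Real.sqrt_div Real.pi_pos.le, Real.sqrt_sq hr.le]
    simp
    ring
  · obtain ⟨h1, h2⟩ := integral_exp_neg_sub_div_sq hr (by positivity : 0 < a / 2)
    have h3 : ∀ u ∈ Ioi (0 : ℝ), Real.exp (-a * r) * Real.exp (-(r * u - a / 2 / u) ^ 2) =
        Real.exp (-(a / 2 / u) ^ 2) * Real.exp (-u ^ 2 * r ^ 2) := fun u hu => by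
      have hu' : (0 : ℝ) < u := hu
      rw [← Real.exp_add, ← Real.exp_add]
      congr 1
      field_simp
      ring
    have h4 : IntegrableOn (fun u => Real.exp (-a * r) * Real.exp (-(r * u - a / 2 / u) ^ 2))
        (Ioi 0) := h1.const_mul _
    refine ⟨h4.congr_fun h3 measurableSet_Ioi, ?_⟩
    rw [← setIntegral_congr_fun measurableSet_Ioi h3, integral_const_mul, h2]
    field_simp

theorem integral_yukawaWeight_mul {a b r : ℝ} (ha : 0 ≤ a) (hb : 0 ≤ b) (hr : 0 < r) :
    ∫ u in Ioi (0 : ℝ), yukawaWeight a b u * Real.exp (-u ^ 2 * r ^ 2) =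
      Real.sqrt Real.pi / 2 * ((Real.exp (-a * r) - Real.exp (-b * r)) / r) := by
  obtain ⟨h1, h2⟩ := integral_exp_mul_exp ha hr
  obtain ⟨h3, h4⟩ := integral_exp_mul_exp hb hr
  simp only [yukawaWeight, sub_mul]
  rw [integral_sub h1 h3, h2, h4]
  ring

theorem measurable_yukawaWeight (a b : ℝ) : Measurable (yukawaWeight a b) := by
  unfold yukawaWeight
  fun_prop

theorem yukawaWeight_pos {a b u : ℝ} (ha : 0 ≤ a) (hab : a < b) (hu : 0 < u) :
    0 < yukawaWeight a b u := by
  have h1 : a / 2 / u < b / 2 / u := by gcongr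
  have h2 : 0 ≤ a / 2 / u := by positivity
  exact sub_pos.2 (Real.exp_lt_exp.2 (by nlinarith))

/-- Each exponential tends to `1` at infinity, so only their difference is integrable: it is at most
`1` near zero and of order `u⁻²` at infinity. -/
theorem integrableOn_yukawaWeight {a b : ℝ} (ha : 0 ≤ a) (hab : a < b) :
    IntegrableOn (yukawaWeight a b) (Ioi 0) := by
  have hm := (measurable_yukawaWeight a b).aestronglyMeasurable (μ := volume)
  rw [← Ioc_union_Ioi_eq_Ioi (zero_le_one : (0 : ℝ) ≤ 1), integrableOn_union]
  constructor
  · refine Measure.integrableOn_of_bounded (M := 1) (by simp) hm ?_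
    filter_upwards [ae_restrict_mem measurableSet_Ioc] with u hu
    rw [Real.norm_eq_abs, abs_of_pos (yukawaWeight_pos ha hab hu.1), yukawaWeight]
    have h1 : Real.exp (-(a / 2 / u) ^ 2) ≤ 1 :=
      Real.exp_le_one_iff.2 (neg_nonpos.2 (sq_nonneg _))
    have h2 := Real.exp_pos (-(b / 2 / u) ^ 2)
    linarith
  · have h0 : IntegrableOn (fun u : ℝ => (b / 2) ^ 2 * u ^ (-2 : ℝ)) (Ioi 1) :=
      (integrableOn_Ioi_rpow_of_lt (by norm_num) one_pos).const_mul _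
    refine Integrable.mono' h0 hm.restrict ?_
    filter_upwards [ae_restrict_mem measurableSet_Ioi] with u hu
    have hu' : (0 : ℝ) < u := lt_trans one_pos hu
    rw [Real.norm_eq_abs, abs_of_pos (yukawaWeight_pos ha hab hu'), yukawaWeight]
    have h1 : Real.exp (-(a / 2 / u) ^ 2) ≤ 1 :=
      Real.exp_le_one_iff.2 (neg_nonpos.2 (sq_nonneg _))
    have h2 := Real.add_one_le_exp (-(b / 2 / u) ^ 2)
    have h3 : (b / 2 / u) ^ 2 = (b / 2) ^ 2 * u ^ (-2 : ℝ) := by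
      rw [Real.rpow_neg hu'.le, div_pow, div_eq_mul_inv]
      norm_num
    linarith

end Subordination

/-! ### Strict positivity of Gaussian kernels -/

section Gaussian

variable {X E : Type*} [MeasurableSpace X] {μ : Measure X}
  [NormedAddCommGroup E] [InnerProductSpace ℝ E] {j : X → E} {f : X → ℂ}

/-- The Fourier transform of the complex measure `f μ` pushed forward by `j`. -/
def charInt (μ : Measure X) (j : X → E) (f : X → ℂ) (v : E) : ℂ :=
  ∫ x, f x * Complex.exp (Complex.I * (⟪j x, v⟫_ℝ : ℂ)) ∂μ

theorem norm_exp_I_mul_ofReal (t : ℝ) : ‖Complex.exp (Complex.I * (t : ℂ))‖ = 1 := by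
  rw [mul_comm]; exact Complex.norm_exp_ofReal_mul_I t

theorem norm_charInt_le (v : E) : ‖charInt μ j f v‖ ≤ ∫ x, ‖f x‖ ∂μ := by
  refine (norm_integral_le_integral_norm _).trans (le_of_eq ?_)
  congr 1
  ext x
  rw [norm_mul, norm_exp_I_mul_ofReal, mul_one]

variable [MeasurableSpace E] [BorelSpace E] [FiniteDimensional ℝ E]

theorem measurable_exp_I_inner (hj : Measurable j) (v : E) :
    Measurable fun x => Complex.exp (Complex.I * (⟪j x, v⟫_ℝ : ℂ)) := by
  have : Measurable fun x => ⟪j x, v⟫_ℝ := hj.inner_const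
  fun_prop

theorem integrable_mul_exp_I (hj : Measurable j) (hf : Integrable f μ) (v : E) :
    Integrable (fun x => f x * Complex.exp (Complex.I * (⟪j x, v⟫_ℝ : ℂ))) μ :=
  hf.mul_bdd (c := 1) (measurable_exp_I_inner hj v).aestronglyMeasurable
    (Eventually.of_forall fun _ => (norm_exp_I_mul_ofReal _).le)

theorem continuous_charInt (hj : Measurable j) (hf : Integrable f μ) :
    Continuous (charInt μ j f) := by
  refine continuous_of_dominated (bound := fun x => ‖f x‖)
    (fun v => (integrable_mul_exp_I hj hf v).aestronglyMeasurable)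
    (fun v => Eventually.of_forall fun x => ?_) hf.norm (Eventually.of_forall fun x => ?_)
  · rw [norm_mul, norm_exp_I_mul_ofReal, mul_one]
  · fun_prop

theorem integrable_conj_mul_prod (hf : Integrable f μ) :
    Integrable (fun z : X × X => starRingEnd ℂ (f z.1) * f z.2) (μ.prod μ) :=
  Integrable.mul_prod (f := fun x => starRingEnd ℂ (f x))
    (hf.congr' (Complex.continuous_conj.comp_aestronglyMeasurable hf.1) (by simp)) hf

theorem integrable_exp_neg_mul_norm_sq {b : ℝ} (hb : 0 < b) :
    Integrable fun v : E => Real.exp (-b * ‖v‖ ^ 2) := by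
  have h := GaussianFourier.integrable_cexp_neg_mul_sq_norm_add (V := E) (b := (b : ℂ))
    (by simpa using hb) 0 0
  refine h.norm.congr (Eventually.of_forall fun v => ?_)
  simp only [Complex.norm_exp]
  congr 1
  simp [← Complex.ofReal_pow]

/-- A Gaussian is a superposition of the waves `exp(i ⟪w, v⟫)` with Gaussian density; for each `v`
the wave `w = j y - j x` factors, and Fubini turns the form into an integral of `|charInt|²`. -/
theorem gaussian_form_eq [IsFiniteMeasure μ] (hj : Measurable j) (hf : Integrable f μ) {b : ℝ} (hb : 0 < b) :
    (((Real.pi / b) ^ ((Module.finrank ℝ E : ℝ) / 2) : ℝ) : ℂ) *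
      ∫ z : X × X, starRingEnd ℂ (f z.1) * f z.2 *
        ((Real.exp (-‖j z.2 - j z.1‖ ^ 2 / (4 * b)) : ℝ) : ℂ) ∂(μ.prod μ) =
      ((∫ v : E, Real.exp (-b * ‖v‖ ^ 2) * ‖charInt μ j f v‖ ^ 2 : ℝ) : ℂ) := by
  have hpi := Real.pi_pos
  have hker : ∀ w : E, (((Real.pi / b) ^ ((Module.finrank ℝ E : ℝ) / 2) : ℝ) : ℂ) *
      ((Real.exp (-‖w‖ ^ 2 / (4 * b)) : ℝ) : ℂ) =
      ∫ v : E, ((Real.exp (-b * ‖v‖ ^ 2) : ℝ) : ℂ) *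
        Complex.exp (Complex.I * (⟪w, v⟫_ℝ : ℂ)) := fun w => by
    have h := GaussianFourier.integral_cexp_neg_mul_sq_norm_add (V := E) (b := (b : ℂ))
      (by simpa using hb) Complex.I w
    have h1 : ∀ v : E, ((Real.exp (-b * ‖v‖ ^ 2) : ℝ) : ℂ) *
        Complex.exp (Complex.I * (⟪w, v⟫_ℝ : ℂ)) =
        Complex.exp (-b * ‖v‖ ^ 2 + Complex.I * (⟪w, v⟫_ℝ : ℂ)) := fun v => by
      rw [Complex.exp_add]; push_cast; rfl
    simp_rw [h1]
    rw [h, Complex.ofReal_cpow (by positivity)]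
    push_cast
    congr 2
    rw [Complex.I_sq]; ring
  have hint : Integrable (Function.uncurry fun (z : X × X) (v : E) =>
      starRingEnd ℂ (f z.1) * f z.2 * (((Real.exp (-b * ‖v‖ ^ 2) : ℝ) : ℂ) *
        Complex.exp (Complex.I * (⟪j z.2 - j z.1, v⟫_ℝ : ℂ)))) ((μ.prod μ).prod volume) := by
    have h1 := (integrable_conj_mul_prod hf).mul_prod
      ((integrable_exp_neg_mul_norm_sq (E := E) hb).ofReal (𝕜 := ℂ))
    have hm : Measurable fun p : (X × X) × E =>
        Complex.exp (Complex.I * (⟪j p.1.2 - j p.1.1, p.2⟫_ℝ : ℂ)) := by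
      have : Measurable fun p : (X × X) × E => ⟪j p.1.2 - j p.1.1, p.2⟫_ℝ :=
        ((hj.comp (measurable_snd.comp measurable_fst)).sub
          (hj.comp (measurable_fst.comp measurable_fst))).inner measurable_snd
      fun_prop
    refine (h1.mul_bdd (c := 1) hm.aestronglyMeasurable
      (Eventually.of_forall fun p => (norm_exp_I_mul_ofReal _).le)).congr
      (Eventually.of_forall fun p => ?_)
    simp only [Function.uncurry, mul_assoc]
    rfl
  rw [← integral_const_mul]
  have h2 : ∀ z : X × X, (((Real.pi / b) ^ ((Module.finrank ℝ E : ℝ) / 2) : ℝ) : ℂ) *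
      (starRingEnd ℂ (f z.1) * f z.2 *
        ((Real.exp (-‖j z.2 - j z.1‖ ^ 2 / (4 * b)) : ℝ) : ℂ)) =
      ∫ v : E, starRingEnd ℂ (f z.1) * f z.2 * (((Real.exp (-b * ‖v‖ ^ 2) : ℝ) : ℂ) *
        Complex.exp (Complex.I * (⟪j z.2 - j z.1, v⟫_ℝ : ℂ))) := fun z => by
    rw [integral_const_mul, ← hker]; ring
  simp_rw [h2]
  rw [integral_integral_swap hint, ← integral_complex_ofReal]
  congr 1
  ext v
  have h3 : ∀ z : X × X, starRingEnd ℂ (f z.1) * f z.2 * (((Real.exp (-b * ‖v‖ ^ 2) : ℝ) : ℂ) *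
        Complex.exp (Complex.I * (⟪j z.2 - j z.1, v⟫_ℝ : ℂ))) =
      ((Real.exp (-b * ‖v‖ ^ 2) : ℝ) : ℂ) *
        (starRingEnd ℂ (f z.1 * Complex.exp (Complex.I * (⟪j z.1, v⟫_ℝ : ℂ))) *
        (f z.2 * Complex.exp (Complex.I * (⟪j z.2, v⟫_ℝ : ℂ)))) := fun z => by
    have h4 : Complex.exp (Complex.I * (⟪j z.2 - j z.1, v⟫_ℝ : ℂ)) =
        starRingEnd ℂ (Complex.exp (Complex.I * (⟪j z.1, v⟫_ℝ : ℂ))) *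
        Complex.exp (Complex.I * (⟪j z.2, v⟫_ℝ : ℂ)) := by
      rw [← Complex.exp_conj, ← Complex.exp_add, inner_sub_left]
      congr 1
      simp only [map_mul, Complex.conj_I, Complex.conj_ofReal, Complex.ofReal_sub]
      ring
    rw [h4, map_mul]
    ring
  simp_rw [h3]
  rw [integral_const_mul, integral_prod_mul
    (fun x => starRingEnd ℂ (f x * Complex.exp (Complex.I * (⟪j x, v⟫_ℝ : ℂ))))
    (fun x => f x * Complex.exp (Complex.I * (⟪j x, v⟫_ℝ : ℂ))), integral_conj]
  change _ * (starRingEnd ℂ (charInt μ j f v) * charInt μ j f v) = _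
  rw [Complex.conj_mul']
  push_cast
  rfl

/-- The positive and negative parts of `u` define finite measures with the same characteristic
function, so their images under `j` agree, and an embedding loses nothing. -/
theorem ae_eq_zero_of_charInt_ofReal_eq_zero (hj : MeasurableEmbedding j) {u : X → ℝ}
    (hu : Integrable u μ) (h0 : ∀ v, charInt μ j (fun x => (u x : ℂ)) v = 0) : u =ᵐ[μ] 0 := by
  have key : ∀ w : X → ℝ, Integrable w μ → (∀ x, 0 ≤ w x) → ∀ v : E,
      charFun ((μ.withDensity fun x => ENNReal.ofReal (w x)).map j) v =
        charInt μ j (fun x => (w x : ℂ)) v := by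
    intro w hw hw0 v
    rw [charFun_apply, hj.integral_map, integral_withDensity_eq_integral_toReal_smul₀
      hw.aestronglyMeasurable.aemeasurable.ennreal_ofReal (by simp), charInt]
    congr 1
    ext x
    rw [ENNReal.toReal_ofReal (hw0 x), Complex.real_smul, mul_comm Complex.I]
  have hp : Integrable (fun x => max (u x) 0) μ := hu.pos_part
  have hn : Integrable (fun x => max (-u x) 0) μ := hu.neg_part
  have hp' : Integrable (fun x => ((max (u x) 0 : ℝ) : ℂ)) μ := hp.ofReal
  have hn' : Integrable (fun x => ((max (-u x) 0 : ℝ) : ℂ)) μ := hn.ofReal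
  have hfin : ∀ w : X → ℝ, Integrable w μ →
      ∫⁻ x, ENNReal.ofReal (w x) ∂μ ≠ ∞ := fun w hw => by
    refine ne_of_lt (lt_of_le_of_lt (lintegral_mono fun x => ?_) hw.2)
    exact Real.ofReal_le_enorm _
  have hfp := isFiniteMeasure_withDensity (hfin _ hp)
  have hfn := isFiniteMeasure_withDensity (hfin _ hn)
  have heq : (μ.withDensity fun x => ENNReal.ofReal (max (u x) 0)).map j =
      (μ.withDensity fun x => ENNReal.ofReal (max (-u x) 0)).map j := by
    refine Measure.ext_of_charFun (funext fun v => ?_)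
    rw [key _ hp (fun x => le_max_right _ _), key _ hn (fun x => le_max_right _ _)]
    rw [← sub_eq_zero, ← h0 v, charInt, charInt, charInt, ← integral_sub
      (integrable_mul_exp_I hj.measurable hp' v)
      (integrable_mul_exp_I hj.measurable hn' v)]
    congr 1
    ext x
    have : max (u x) 0 - max (-u x) 0 = u x := by
      rcases le_total (u x) 0 with h | h
      · rw [max_eq_right h, max_eq_left (by linarith)]; ring
      · rw [max_eq_left h, max_eq_right (by linarith)]; ring
    rw [← sub_mul]
    conv_rhs => rw [← this]
    push_cast
    rfl
  have heq2 : (μ.withDensity fun x => ENNReal.ofReal (max (u x) 0)) =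
      (μ.withDensity fun x => ENNReal.ofReal (max (-u x) 0)) := by
    have := congrArg (Measure.comap j) heq
    rwa [hj.comap_map, hj.comap_map] at this
  have h3 := (withDensity_eq_iff hp.aestronglyMeasurable.aemeasurable.ennreal_ofReal
    hn.aestronglyMeasurable.aemeasurable.ennreal_ofReal (hfin _ hp)).1 heq2
  filter_upwards [h3] with x hx
  rw [ENNReal.ofReal_eq_ofReal_iff (le_max_right _ _) (le_max_right _ _)] at hx
  rcases le_total (u x) 0 with h | h
  · rw [max_eq_right h, max_eq_left (by linarith)] at hx
    simp only [Pi.zero_apply]; linarith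
  · rw [max_eq_left h, max_eq_right (by linarith)] at hx
    exact hx

/-- Evaluation at `-v` shows that the transform of the conjugate vanishes too, so the real and
imaginary parts can be treated separately. -/
theorem ae_eq_zero_of_charInt_eq_zero (hj : MeasurableEmbedding j) (hf : Integrable f μ)
    (h0 : ∀ v, charInt μ j f v = 0) : f =ᵐ[μ] 0 := by
  have hconj : ∀ v, charInt μ j (fun x => starRingEnd ℂ (f x)) v = 0 := fun v => by
    have h1 := congrArg (starRingEnd ℂ) (h0 (-v))
    rw [charInt, ← integral_conj, map_zero] at h1
    rw [← h1, charInt]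
    congr 1
    ext x
    rw [map_mul, ← Complex.exp_conj]
    simp
  have hfc : Integrable (fun x => starRingEnd ℂ (f x)) μ :=
    hf.congr' (Complex.continuous_conj.comp_aestronglyMeasurable hf.1) (by simp)
  have hre : (fun x => (f x).re) =ᵐ[μ] 0 := by
    refine ae_eq_zero_of_charInt_ofReal_eq_zero hj hf.re fun v => ?_
    have h1 : charInt μ j (fun x => ((f x).re : ℂ)) v =
        (1 / 2) * (charInt μ j f v + charInt μ j (fun x => starRingEnd ℂ (f x)) v) := by
      rw [charInt, charInt, charInt, ← integral_add (integrable_mul_exp_I hj.measurable hf v)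
        (integrable_mul_exp_I hj.measurable hfc v), ← integral_const_mul]
      congr 1
      ext x
      rw [← add_mul, Complex.add_conj]
      push_cast
      ring
    rw [h1, h0, hconj]; ring
  have him : (fun x => (f x).im) =ᵐ[μ] 0 := by
    refine ae_eq_zero_of_charInt_ofReal_eq_zero hj hf.im fun v => ?_
    have h1 : charInt μ j (fun x => ((f x).im : ℂ)) v = (1 / (2 * Complex.I)) *
        (charInt μ j f v - charInt μ j (fun x => starRingEnd ℂ (f x)) v) := by
      rw [charInt, charInt, charInt, ← integral_sub (integrable_mul_exp_I hj.measurable hf v)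
        (integrable_mul_exp_I hj.measurable hfc v), ← integral_const_mul]
      congr 1
      ext x
      rw [← sub_mul, Complex.sub_conj]
      have := Complex.I_ne_zero
      field_simp
      push_cast
      ring
    rw [h1, h0, hconj]; ring
  filter_upwards [hre, him] with x h1 h2
  exact Complex.ext h1 h2

/-- The quadratic form of a Gaussian kernel is strictly positive. -/
theorem gaussian_form_pos [IsFiniteMeasure μ] (hj : MeasurableEmbedding j) (hf : Integrable f μ)
    (hf0 : ¬ f =ᵐ[μ] 0) {b : ℝ} (hb : 0 < b) :
    0 < (∫ z : X × X, starRingEnd ℂ (f z.1) * f z.2 *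
        ((Real.exp (-‖j z.2 - j z.1‖ ^ 2 / (4 * b)) : ℝ) : ℂ) ∂(μ.prod μ)).re := by
  have hpi := Real.pi_pos
  have hc := continuous_charInt hj.measurable hf
  have hpos : 0 < ∫ v : E, Real.exp (-b * ‖v‖ ^ 2) * ‖charInt μ j f v‖ ^ 2 := by
    have hcont : Continuous fun v : E => Real.exp (-b * ‖v‖ ^ 2) * ‖charInt μ j f v‖ ^ 2 := by
      fun_prop
    have hint : Integrable fun v : E => Real.exp (-b * ‖v‖ ^ 2) * ‖charInt μ j f v‖ ^ 2 := by
      refine (integrable_exp_neg_mul_norm_sq hb).mul_bdd (c := (∫ x, ‖f x‖ ∂μ) ^ 2)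
        (by fun_prop) (Eventually.of_forall fun v => ?_)
      rw [norm_pow, norm_norm]
      exact pow_le_pow_left₀ (norm_nonneg _) (norm_charInt_le v) 2
    rw [integral_pos_iff_support_of_nonneg (fun v => by positivity) hint]
    -- The integrand is continuous, so the integral could vanish only if the transform were
    -- identically zero.
    refine hcont.isOpen_support.measure_pos _ ?_
    by_contra hemp
    rw [not_nonempty_iff_eq_empty, Function.support_eq_empty_iff] at hemp
    refine hf0 (ae_eq_zero_of_charInt_eq_zero hj hf fun v => ?_)
    have h1 := congrFun hemp v
    simpa [(Real.exp_pos _).ne'] using h1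
  have h := congrArg Complex.re (gaussian_form_eq (E := E) hj.measurable hf hb)
  rw [Complex.re_ofReal_mul, Complex.ofReal_re] at h
  have h2 : 0 < (Real.pi / b) ^ ((Module.finrank ℝ E : ℝ) / 2) := by positivity
  rw [← h] at hpos
  exact (mul_pos_iff_of_pos_left h2).1 hpos

end Gaussian

/-! ### Strict monotonicity in the spectral parameter -/

namespace ClosedCurve

variable (C : ClosedCurve)

instance : NullSingletonClass C.arcLength := by
  refine ⟨fun x => ?_⟩
  have h : C.homeo ⁻¹' {x} = Metric.closedBall (C.homeo.symm x) 0 := by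
    ext p
    simp [Homeomorph.eq_symm_apply]
  rw [arcLength_eq_map, Measure.map_apply C.homeo.continuous.measurable
    (measurableSet_singleton x), h, AddCircle.volume_closedBall]
  simp [C.len_pos.le]

/-- The subordination formula fails on the diagonal, where the kernels carry the value `0`; hence
the need for a null set. -/
theorem ae_prod_fst_ne_snd :
    ∀ᵐ z : C.carrier × C.carrier ∂C.arcLength.prod C.arcLength, z.1 ≠ z.2 := by
  have hs : MeasurableSet {z : C.carrier × C.carrier | z.1 = z.2} :=
    (isClosed_eq continuous_fst continuous_snd).measurableSet
  rw [ae_iff]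
  simp only [ne_eq, not_not]
  rw [Measure.measure_prod_null hs]
  refine Eventually.of_forall fun x => ?_
  have : Prod.mk x ⁻¹' {z : C.carrier × C.carrier | z.1 = z.2} = {x} := by
    ext y; simp [eq_comm]
  change C.arcLength _ = 0
  rw [this]
  exact measure_singleton x

theorem measurableEmbedding_coe :
    MeasurableEmbedding (Subtype.val : C.carrier → EuclideanSpace ℝ (Fin 3)) :=
  MeasurableEmbedding.subtype_coe
    (isCompact_iff_compactSpace.2 inferInstance : IsCompact C.carrier).isClosed.measurableSet

theorem smoothKernel_sub_eq_integral {lam mu : ℝ} {x y : C.carrier} (hxy : x ≠ y) :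
    C.smoothKernel mu x y - C.smoothKernel lam x y =
      (4 * Real.pi)⁻¹ * (2 / Real.sqrt Real.pi) *
        ∫ u in Ioi (0 : ℝ), yukawaWeight (Real.sqrt (-mu)) (Real.sqrt (-lam)) u *
          Real.exp (-u ^ 2 * dist x y ^ 2) := by
  have hpi := Real.pi_pos
  have hr : 0 < dist x y := dist_pos.2 hxy
  have hs : 0 < Real.sqrt Real.pi := Real.sqrt_pos.2 hpi
  rw [integral_yukawaWeight_mul (Real.sqrt_nonneg _) (Real.sqrt_nonneg _) hr, smoothKernel,
    smoothKernel, kernel, kernel]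
  field_simp
  ring

/-- The bounded part of the operator is strictly increasing in the spectral parameter, since the
difference of two Yukawa kernels is a superposition of Gaussians. -/
theorem re_inner_smoothOp_sub_pos {lam mu : ℝ} (hlm : lam < mu) (hmu : mu ≤ 0) {f : C.L2}
    (hf : f ≠ 0) : 0 < (⟪f, (C.smoothOp mu - C.smoothOp lam) f⟫_ℂ).re := by
  have hpi := Real.pi_pos
  set a := Real.sqrt (-mu) with ha
  set b := Real.sqrt (-lam) with hb
  have ha0 : 0 ≤ a := Real.sqrt_nonneg _
  have hab : a < b := Real.sqrt_lt_sqrt (by linarith) (by linarith)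
  set c : ℝ := (4 * Real.pi)⁻¹ * (2 / Real.sqrt Real.pi) with hc
  have hc0 : 0 < c := by positivity
  have hfi := Lp.integrable_two f
  have hf0 : ¬ f =ᵐ[C.arcLength] 0 := fun h => hf ((Lp.eq_zero_iff_ae_eq_zero).2 h)
  set ν := C.arcLength.prod C.arcLength with hν
  set F : C.carrier × C.carrier → ℝ → ℂ := fun z u =>
    starRingEnd ℂ (f z.1) * f z.2 * (yukawaWeight a b u : ℂ) *
      ((Real.exp (-u ^ 2 * dist z.1 z.2 ^ 2) : ℝ) : ℂ) with hF
  have hint : Integrable (Function.uncurry F) (ν.prod (volume.restrict (Ioi 0))) := by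
    have h1 := (integrable_conj_mul_prod hfi).mul_prod
      ((integrableOn_yukawaWeight ha0 hab).ofReal (𝕜 := ℂ))
    refine h1.mul_bdd (c := 1) ?_ (Eventually.of_forall fun p => ?_)
    · have : Measurable fun p : (C.carrier × C.carrier) × ℝ =>
          Real.exp (-p.2 ^ 2 * dist p.1.1 p.1.2 ^ 2) := by fun_prop
      exact (Complex.measurable_ofReal.comp this).aestronglyMeasurable
    · rw [Complex.norm_real, Real.norm_eq_abs, abs_of_pos (Real.exp_pos _), Real.exp_le_one_iff]
      have := mul_nonneg (sq_nonneg p.2) (sq_nonneg (dist p.1.1 p.1.2))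
      linarith
  have hinner : ⟪f, (C.smoothOp mu - C.smoothOp lam) f⟫_ℂ =
      (c : ℂ) * ∫ u in Ioi (0 : ℝ), ∫ z, F z u ∂ν := by
    rw [smoothOp_sub]
    refine (inner_kernelOp f f).trans ?_
    rw [← integral_integral_swap hint, ← integral_const_mul, ← integral_prod (fun z : C.carrier × C.carrier => (starRingEnd ℂ (f z.1)) *
      (((C.smoothKernel mu z.1 z.2 - C.smoothKernel lam z.1 z.2 : ℝ) : ℂ) * f z.2))
      (integrable_prod_kernel (m := fun x y => C.smoothKernel mu x y - C.smoothKernel lam x y)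
        ((C.measurable_smoothKernel mu).sub (C.measurable_smoothKernel lam))
      (C.abs_smoothKernel_sub_le mu lam) f f)]
    refine integral_congr_ae ?_
    filter_upwards [C.ae_prod_fst_ne_snd] with z hz
    simp only [hF, mul_assoc]
    rw [C.smoothKernel_sub_eq_integral hz, integral_const_mul, integral_const_mul, ← hc, ← ha,
      ← hb, Complex.ofReal_mul, ← integral_complex_ofReal]
    simp only [Complex.ofReal_mul]
    ring
  have hG : ∀ u ∈ Ioi (0 : ℝ), 0 < (∫ z, F z u ∂ν).re := by
    intro u hu
    have hu' : 0 < u := hu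
    -- This parameter makes the exponent `-‖·‖² / (4b)` equal to `-u² ‖·‖²`.
    have h1 := gaussian_form_pos C.measurableEmbedding_coe hfi hf0
      (b := (4 * u ^ 2)⁻¹) (by positivity)
    have h2 : ∫ z, F z u ∂ν = (yukawaWeight a b u : ℂ) *
        ∫ z : C.carrier × C.carrier, starRingEnd ℂ (f z.1) * f z.2 *
        ((Real.exp (-‖(z.2 : EuclideanSpace ℝ (Fin 3)) - z.1‖ ^ 2 / (4 * (4 * u ^ 2)⁻¹)) : ℝ) : ℂ)
          ∂ν := by
      rw [← integral_const_mul]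
      congr 1
      ext z
      simp only [hF]
      have h3 : -‖(z.2 : EuclideanSpace ℝ (Fin 3)) - z.1‖ ^ 2 / (4 * (4 * u ^ 2)⁻¹) =
          -u ^ 2 * dist z.1 z.2 ^ 2 := by
        rw [Subtype.dist_eq, dist_comm, dist_eq_norm]
        field_simp
      rw [h3]
      ring
    rw [h2, Complex.re_ofReal_mul]
    exact mul_pos (yukawaWeight_pos ha0 hab hu') h1
  have hGi : IntegrableOn (fun u => ∫ z, F z u ∂ν) (Ioi 0) := hint.integral_prod_right
  rw [hinner, Complex.re_ofReal_mul]
  refine mul_pos hc0 ?_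
  have h3 : (∫ u in Ioi (0 : ℝ), ∫ z, F z u ∂ν).re =
      ∫ u in Ioi (0 : ℝ), (∫ z, F z u ∂ν).re := (integral_re (𝕜 := ℂ) hGi).symm
  rw [h3, setIntegral_pos_iff_support_of_nonneg_ae
    ((ae_restrict_mem measurableSet_Ioi).mono fun u hu => (hG u hu).le) hGi.re]
  have h4 : Function.support (fun u => (∫ z, F z u ∂ν).re) ∩ Ioi 0 = Ioi 0 :=
    inter_eq_right.2 fun u hu => (hG u hu).ne'
  rw [h4]
  simp

end ClosedCurve

/-! ### Upper bounds for the quadratic form -/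

theorem MeasureTheory.integral_integral_eq_zero_of_antisymm {X : Type*} [MeasurableSpace X]
    {μ : Measure X} [SFinite μ] {D : X → X → ℝ}
    (hD : Integrable (Function.uncurry D) (μ.prod μ)) (hanti : ∀ x y, D x y = -D y x) :
    ∫ x, ∫ y, D x y ∂μ ∂μ = 0 := by
  have h := integral_integral_swap hD
  have h2 : ∫ y, ∫ x, D x y ∂μ ∂μ = -∫ x, ∫ y, D x y ∂μ ∂μ := by
    simp_rw [← integral_neg]
    congr 1
    ext y
    congr 1
    ext x
    exact hanti x y
  linarith

namespace ClosedCurve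

variable (C : ClosedCurve)

/-- The value of the operator at the constant function `1`. -/
def potential (lam : ℝ) (x : C.carrier) : ℝ :=
  (∫ y, C.smoothKernel lam x y ∂C.arcLength) + Real.log (C.len / 2) / (2 * Real.pi)

theorem integrable_smoothKernel (lam : ℝ) (x : C.carrier) :
    Integrable (C.smoothKernel lam x) C.arcLength := by
  obtain ⟨M, hM⟩ := C.exists_abs_smoothKernel_le lam
  exact Integrable.of_bound ((C.measurable_smoothKernel lam).comp
    measurable_prodMk_left).aestronglyMeasurable M (Eventually.of_forall (hM x))

theorem dist_mul_kernel_le (lam : ℝ) (x y : C.carrier) :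
    dist x y * C.kernel lam x y ≤ (4 * Real.pi)⁻¹ := by
  have hpi := Real.pi_pos
  by_cases hxy : x = y
  · simp [hxy]; positivity
  have hr : 0 < dist x y := dist_pos.2 hxy
  have h1 : Real.exp (-Real.sqrt (-lam) * dist x y) ≤ 1 :=
    Real.exp_le_one_iff.2 (by nlinarith [Real.sqrt_nonneg (-lam)])
  have h2 : dist x y * C.kernel lam x y =
      (4 * Real.pi)⁻¹ * Real.exp (-Real.sqrt (-lam) * dist x y) := by
    rw [kernel]; field_simp
  rw [h2]
  exact mul_le_of_le_one_right (by positivity) h1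

variable {C}

/-- Adding and subtracting `h x` in the smooth part recombines the two kernels, so the difference
term carries the full nonnegative Yukawa kernel. -/
theorem IsLip.arcFun_add_kernelFun_eq {h : C.carrier → ℂ} (hh : C.IsLip h) (lam : ℝ)
    (x : C.carrier) : Integrable (fun y => (h y - h x) * (C.kernel lam x y : ℂ)) C.arcLength ∧
    C.arcFun h x + kernelFun C.arcLength (C.smoothKernel lam) h x =
      (∫ y, (h y - h x) * (C.kernel lam x y : ℂ) ∂C.arcLength) +
        (C.potential lam x : ℂ) * h x := by
  have h1 := hh.integrable_arcIntegrand x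
  have h2 := hh.integrable_smoothKernel_mul lam x
  have h3 : Integrable (fun y => (C.smoothKernel lam x y : ℂ)) C.arcLength :=
    (C.integrable_smoothKernel lam x).ofReal
  have h4 : (fun y => (h y - h x) * (C.kernel lam x y : ℂ)) = fun y =>
      C.arcIntegrand h x y + (C.smoothKernel lam x y : ℂ) * h y -
        (C.smoothKernel lam x y : ℂ) * h x := by
    ext y
    simp only [arcIntegrand, smoothKernel]
    push_cast
    ring
  have h12 : Integrable (fun y => C.arcIntegrand h x y + (C.smoothKernel lam x y : ℂ) * h y)
    C.arcLength := h1.add h2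
  rw [h4]
  refine ⟨h12.sub (h3.mul_const _), ?_⟩
  rw [integral_sub h12 (h3.mul_const _), integral_add h1 h2, integral_mul_const,
    integral_complex_ofReal, arcFun, kernelFun, potential]
  push_cast
  ring

/-- Pointwise, `re (conj (h x) (h y - h x)) ≤ (|h y|² - |h x|²) / 2`. Against the nonnegative
symmetric kernel the right side is bounded and antisymmetric, so its double integral is zero and
only the potential survives. -/
theorem IsLip.re_inner_le {h : C.carrier → ℂ} (hh : C.IsLip h) {lam v : ℝ}
    (hv : ∀ x, C.potential lam x ≤ v) {f g : C.L2} (hf : f =ᵐ[C.arcLength] h)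
    (hg : g =ᵐ[C.arcLength] C.arcFun h + kernelFun C.arcLength (C.smoothKernel lam) h) :
    (⟪f, g⟫_ℂ).re ≤ v * ‖f‖ ^ 2 := by
  set D : C.carrier → C.carrier → ℝ := fun x y =>
    C.kernel lam x y * (‖h y‖ ^ 2 - ‖h x‖ ^ 2) with hDdef
  have hDm : Measurable (Function.uncurry D) := by
    have hm := hh.continuous.measurable
    exact (C.measurable_kernel lam).mul
      (((hm.comp measurable_snd).norm.pow_const 2).sub ((hm.comp measurable_fst).norm.pow_const 2))
  obtain ⟨A, hA⟩ := hh.exists_norm_le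
  have hDb : ∃ N, ∀ x y, |D x y| ≤ N := by
    obtain ⟨K, hK⟩ := hh
    refine ⟨(4 * Real.pi)⁻¹ * (K * (A + A)), fun x y => ?_⟩
    have h1 : |‖h y‖ - ‖h x‖| ≤ K * dist x y := by
      refine (abs_norm_sub_norm_le _ _).trans ?_
      rw [← dist_eq_norm, dist_comm]
      exact hK.dist_le_mul x y
    have h2 : |‖h y‖ + ‖h x‖| ≤ A + A := by
      rw [abs_of_nonneg (by positivity)]
      exact add_le_add (hA y) (hA x)
    have h3 : 0 ≤ A := (norm_nonneg _).trans (hA x)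
    have hk := C.kernel_nonneg lam x y
    calc |D x y| = C.kernel lam x y * (|‖h y‖ - ‖h x‖| * |‖h y‖ + ‖h x‖|) := by
          rw [hDdef]
          simp only
          rw [abs_mul, abs_of_nonneg hk, ← abs_mul]
          ring_nf
      _ ≤ C.kernel lam x y * ((K * dist x y) * (A + A)) := by gcongr
      _ = dist x y * C.kernel lam x y * (K * (A + A)) := by ring
      _ ≤ _ := by
          have := C.dist_mul_kernel_le lam x y
          gcongr
  obtain ⟨N, hN⟩ := hDb
  have hDi : Integrable (Function.uncurry D) (C.arcLength.prod C.arcLength) :=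
    Integrable.of_bound hDm.aestronglyMeasurable N (Eventually.of_forall fun z => hN z.1 z.2)
  have hD0 := integral_integral_eq_zero_of_antisymm hDi fun x y => by
    simp only [hDdef, C.kernel_comm lam x y]; ring
  have hpt : ∀ x, (starRingEnd ℂ (h x) *
      (C.arcFun h x + kernelFun C.arcLength (C.smoothKernel lam) h x)).re ≤
      (1 / 2) * (∫ y, D x y ∂C.arcLength) + v * ‖h x‖ ^ 2 := by
    intro x
    obtain ⟨hi, he⟩ := hh.arcFun_add_kernelFun_eq lam x
    have h1 : starRingEnd ℂ (h x) * ((C.potential lam x : ℂ) * h x) =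
        ((C.potential lam x * ‖h x‖ ^ 2 : ℝ) : ℂ) := by
      rw [mul_left_comm, Complex.conj_mul']; push_cast; rfl
    rw [he, mul_add, Complex.add_re, h1, Complex.ofReal_re, ← integral_const_mul]
    refine add_le_add ?_ (by gcongr; exact hv x)
    have h2 : (∫ y, starRingEnd ℂ (h x) * ((h y - h x) * (C.kernel lam x y : ℂ))
        ∂C.arcLength).re = ∫ y, (starRingEnd ℂ (h x) * ((h y - h x) * (C.kernel lam x y : ℂ))).re
        ∂C.arcLength := (integral_re (𝕜 := ℂ) (hi.const_mul (starRingEnd ℂ (h x)))).symm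
    rw [h2, ← integral_const_mul]
    refine integral_mono (hi.const_mul (starRingEnd ℂ (h x))).re
      ((Integrable.of_bound (hDm.comp measurable_prodMk_left).aestronglyMeasurable N
        (Eventually.of_forall (hN x))).const_mul _) fun y => ?_
    have h3 : (starRingEnd ℂ (h x) * ((h y - h x) * (C.kernel lam x y : ℂ))).re =
        C.kernel lam x y * ((starRingEnd ℂ (h x) * h y).re - ‖h x‖ ^ 2) := by
      rw [← mul_assoc, mul_comm, Complex.re_ofReal_mul, mul_sub, Complex.conj_mul', Complex.sub_re]
      norm_cast
    have h4 : (starRingEnd ℂ (h x) * h y).re ≤ ‖h x‖ * ‖h y‖ := by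
      refine (Complex.re_le_norm _).trans (le_of_eq ?_)
      rw [norm_mul, RCLike.norm_conj]
    have h5 : (starRingEnd ℂ (h x) * h y).re - ‖h x‖ ^ 2 ≤
        1 / 2 * (‖h y‖ ^ 2 - ‖h x‖ ^ 2) := by
      nlinarith [sq_nonneg (‖h x‖ - ‖h y‖)]
    change (starRingEnd ℂ (h x) * ((h y - h x) * (C.kernel lam x y : ℂ))).re ≤
      1 / 2 * (C.kernel lam x y * (‖h y‖ ^ 2 - ‖h x‖ ^ 2))
    rw [h3, mul_left_comm]
    exact mul_le_mul_of_nonneg_left h5 (C.kernel_nonneg lam x y)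
  have hfn : ‖f‖ ^ 2 = ∫ x, ‖h x‖ ^ 2 ∂C.arcLength := by
    have h1 : ⟪f, f⟫_ℂ = ∫ x, ((‖h x‖ ^ 2 : ℝ) : ℂ) ∂C.arcLength := by
      rw [L2.inner_def]
      refine integral_congr_ae ?_
      filter_upwards [hf] with x hx
      rw [hx, inner_self_eq_norm_sq_to_K]
      push_cast
      rfl
    rw [← inner_self_eq_norm_sq (𝕜 := ℂ), h1, integral_complex_ofReal]
    exact Complex.ofReal_re _
  have hin : ⟪f, g⟫_ℂ = ∫ x, starRingEnd ℂ (h x) *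
      (C.arcFun h x + kernelFun C.arcLength (C.smoothKernel lam) h x) ∂C.arcLength := by
    rw [L2.inner_def]
    refine integral_congr_ae ?_
    filter_upwards [hf, hg] with x h1 h2
    rw [h1, h2, RCLike.inner_apply, mul_comm]
    rfl
  have hii : Integrable (fun x => starRingEnd ℂ (h x) *
      (C.arcFun h x + kernelFun C.arcLength (C.smoothKernel lam) h x)) C.arcLength := by
    refine (L2.integrable_inner (𝕜 := ℂ) f g).congr ?_
    filter_upwards [hf, hg] with x h1 h2
    rw [h1, h2, RCLike.inner_apply, mul_comm]
    rfl
  have h5 : Integrable (fun x => ‖h x‖ ^ 2) C.arcLength := by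
    have := (hh.memLp (p := 2)).integrable_norm_pow (by norm_num)
    simpa using this
  have h6 : Integrable (fun x => ∫ y, D x y ∂C.arcLength) C.arcLength := hDi.integral_prod_left
  have h7 : (⟪f, g⟫_ℂ).re = ∫ x, (starRingEnd ℂ (h x) *
      (C.arcFun h x + kernelFun C.arcLength (C.smoothKernel lam) h x)).re ∂C.arcLength := by
    rw [hin]; exact (integral_re (𝕜 := ℂ) hii).symm
  rw [h7, hfn]
  refine (integral_mono hii.re ((h6.const_mul _).add (h5.const_mul _)) hpt).trans ?_
  rw [integral_add' (h6.const_mul _) (h5.const_mul _), integral_const_mul, integral_const_mul, hD0]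
  linarith

theorem re_inner_le_of_mem_graph_closure {lam v : ℝ} (hv : ∀ x, C.potential lam x ≤ v)
    {f g : C.L2} (hfg : (f, g) ∈ (C.B lam).closure.graph) : (⟪f, g⟫_ℂ).re ≤ v * ‖f‖ ^ 2 := by
  rw [← (HilbertBasis.isClosable_of_le (B_graph_le lam)).graph_closure_eq_closure_graph] at hfg
  have hcl : IsClosed {p : C.L2 × C.L2 | (⟪p.1, p.2⟫_ℂ).re ≤ v * ‖p.1‖ ^ 2} :=
    isClosed_le (by fun_prop) (by fun_prop)
  refine closure_minimal ?_ hcl hfg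
  rintro ⟨f, g⟩ hp
  obtain ⟨h, hh, hf, hg⟩ := mem_graph_B_iff.1 hp
  exact hh.re_inner_le hv hf hg

/-- At arc distance at least `δ = 1 / (κ c)` one has `κ r ≥ 1`, so damping removes at least the
fraction `1 - e⁻¹` of `1 / d`, up to `M`. The integral of `1 / d` over that region grows like `log
κ`. -/
theorem potential_le {c M : ℝ} (hc : 0 < c) (hM : 0 < M) (h : ∀ x y : C.carrier,
    c * C.arcDist x y ≤ dist x y ∧ (dist x y)⁻¹ - (C.arcDist x y)⁻¹ ≤ M) {lam : ℝ}
    (hlam : lam < 0) (hδ : (Real.sqrt (-lam) * c)⁻¹ ≤ C.len / 2) (x : C.carrier) :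
    C.potential lam x ≤ M / (4 * Real.pi) * C.len + Real.log (C.len / 2) / (2 * Real.pi) -
      (1 - Real.exp (-1)) * ((Real.log (C.len / 2) + Real.log (Real.sqrt (-lam) * c)) /
        (2 * Real.pi)) := by
  have hpi := Real.pi_pos
  set κ := Real.sqrt (-lam) with hκ
  have hκ0 : 0 < κ := Real.sqrt_pos.2 (by linarith)
  set δ := (κ * c)⁻¹ with hδdef
  have hδ0 : 0 < δ := by positivity
  set I := C.interval δ x with hI
  have hIm : MeasurableSet Iᶜ := (measurableSet_interval δ x).compl
  have h1 := integral_compl_interval_inv_arcDist x hδ0 hδ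
  have h2 := integrableOn_compl_interval_inv_arcDist x hδ0
  have he1 : Real.exp (-1) ≤ 1 := Real.exp_le_one_iff.2 (by norm_num)
  have hpt : ∀ y, C.smoothKernel lam x y ≤ M / (4 * Real.pi) -
      Iᶜ.indicator (fun y => (1 - Real.exp (-1)) * (4 * Real.pi * C.arcDist x y)⁻¹) y := by
    intro y
    by_cases hxy : x = y
    · have : y ∉ Iᶜ := by
        simp [hI, interval_eq, ← hxy, arcDist, hδ0]
      rw [← hxy, smoothKernel_self, hxy, indicator_of_notMem this]
      simp only [sub_zero]; positivity
    have hr : 0 < dist x y := dist_pos.2 hxy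
    have hd : 0 < C.arcDist x y := C.arcDist_pos hxy
    obtain ⟨ha, hb⟩ := h x y
    have hk : C.smoothKernel lam x y = (4 * Real.pi)⁻¹ *
        (Real.exp (-κ * dist x y) * (dist x y)⁻¹ - (C.arcDist x y)⁻¹) := by
      rw [smoothKernel, kernel, ← hκ]
      field_simp
    rw [hk, div_eq_inv_mul]
    have hdi : 0 < (C.arcDist x y)⁻¹ := inv_pos.2 hd
    have hri : 0 < (dist x y)⁻¹ := inv_pos.2 hr
    by_cases hy : y ∈ Iᶜ
    · rw [indicator_of_mem hy, mul_inv _ (C.arcDist x y), mul_left_comm, ← mul_sub]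
      refine mul_le_mul_of_nonneg_left ?_ (by positivity)
      have hy' : δ ≤ C.arcDist x y := by
        simpa [hI, interval_eq] using hy
      have h3 : 1 ≤ κ * dist x y := by
        have : κ * (c * δ) ≤ κ * dist x y := by
          have : c * δ ≤ dist x y := le_trans (by gcongr) ha
          gcongr
        refine le_trans (le_of_eq ?_) this
        rw [hδdef]; field_simp
      have h4 : Real.exp (-κ * dist x y) ≤ Real.exp (-1) := Real.exp_le_exp.2 (by linarith)
      have h5 : Real.exp (-κ * dist x y) * (dist x y)⁻¹ ≤
          Real.exp (-1) * (M + (C.arcDist x y)⁻¹) := by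
        have : (dist x y)⁻¹ ≤ M + (C.arcDist x y)⁻¹ := by linarith
        gcongr
      nlinarith
    · rw [indicator_of_notMem hy, sub_zero]
      refine mul_le_mul_of_nonneg_left ?_ (by positivity)
      have h4 : Real.exp (-κ * dist x y) ≤ 1 := Real.exp_le_one_iff.2 (by nlinarith)
      nlinarith
  have h3 : Integrable (Iᶜ.indicator
      (fun y => (1 - Real.exp (-1)) * (4 * Real.pi * C.arcDist x y)⁻¹)) C.arcLength :=
    (integrable_indicator_iff hIm).2 (h2.const_mul _)
  have h4 := integral_mono (C.integrable_smoothKernel lam x) ((integrable_const _).sub h3) hpt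
  have hlog : Real.log δ = -Real.log (κ * c) := Real.log_inv _
  rw [integral_sub' (integrable_const _) h3, integral_indicator hIm, integral_const_mul, h1,
    integral_const, C.arcLength_real_univ, hlog, sub_neg_eq_add, smul_eq_mul] at h4
  rw [potential]
  linarith

theorem eventually_potential_le (v : ℝ) :
    ∀ᶠ lam in atBot, ∀ x : C.carrier, C.potential lam x ≤ v := by
  obtain ⟨c, hc, M, hM, h⟩ := C.exists_chord_arc
  have hpi := Real.pi_pos
  have hL := C.len_pos
  have hκ : Tendsto (fun lam : ℝ => Real.sqrt (-lam) * c) atBot atTop :=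
    (Real.tendsto_sqrt_atTop.comp tendsto_neg_atBot_atTop).atTop_mul_const hc
  have he1 : 0 < 1 - Real.exp (-1) := sub_pos.2 (Real.exp_lt_one_iff.2 (by norm_num))
  have h1 : Tendsto (fun lam : ℝ => (1 - Real.exp (-1)) *
      ((Real.log (C.len / 2) + Real.log (Real.sqrt (-lam) * c)) / (2 * Real.pi))) atBot atTop :=
    ((tendsto_atTop_add_const_left _ _ (Real.tendsto_log_atTop.comp hκ)).atTop_div_const
      (by positivity)).const_mul_atTop he1
  have h2 : ∀ᶠ lam in atBot, (Real.sqrt (-lam) * c)⁻¹ ≤ C.len / 2 :=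
    (tendsto_inv_atTop_zero.comp hκ).eventually (ge_mem_nhds (by positivity))
  filter_upwards [h1.eventually_ge_atTop (M / (4 * Real.pi) * C.len +
    Real.log (C.len / 2) / (2 * Real.pi) - v), h2, eventually_lt_atBot 0] with lam a1 a2 a3 x
  have := potential_le hc hM h a3 a2 x
  linarith

end ClosedCurve

/-! ### Eigenvalues of the closure -/

namespace ClosedCurve

variable (C : ClosedCurve)

theorem not_finiteDimensional_L2 : ¬ FiniteDimensional ℂ C.L2 := fun _ =>
  not_finite_iff_infinite.2 inferInstance
    (LinearIndependent.finite C.modeBasis.orthonormal.linearIndependent)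

theorem exists_eigenbasis_closure_B (lam : ℝ) :
    ∃ (u : HilbertBasis ℕ ℂ C.L2) (ν : ℕ → ℝ), Antitone ν ∧ Tendsto ν atTop atBot ∧
      C.modeBasis.diagGraph C.multiplier (C.smoothOp lam) = u.diagGraph ν 0 :=
  C.modeBasis.exists_eigenbasis C.tendsto_multiplier (C.smoothOp_isSymmetric lam)
    C.not_finiteDimensional_L2

variable {C}

theorem domain_closure_B_le (lam mu : ℝ) :
    (C.B lam).closure.domain ≤ (C.B mu).closure.domain := by
  intro f hf
  have h := (C.B lam).closure.mem_graph ⟨f, hf⟩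
  rw [graph_closure_B] at h
  have h2 := HilbertBasis.mem_diagGraph_change (S' := C.smoothOp mu) h
  rw [← graph_closure_B] at h2
  exact LinearPMap.mem_domain_of_mem_graph h2

theorem domain_closure_B_eq (lam mu : ℝ) :
    (C.B lam).closure.domain = (C.B mu).closure.domain :=
  le_antisymm (domain_closure_B_le lam mu) (domain_closure_B_le mu lam)

/-- From below, the modes `|n| ≤ k` span more than `k` dimensions, a wasteful but sufficient trial
space. From above, orthogonality to about `k` low modes leaves frequencies of order `k / 2`; the
factor two costs `log 2 / (2π)`. -/
theorem eigenvalue_isBigO {lam : ℝ} {u : HilbertBasis ℕ ℂ C.L2} {ν : ℕ → ℝ} (hν : Antitone ν)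
    (hG : C.modeBasis.diagGraph C.multiplier (C.smoothOp lam) = u.diagGraph ν 0) :
    (fun k : ℕ => ν k - (-(Real.log ((k : ℝ) + 1) / (2 * Real.pi))))
      =O[atTop] (fun _ => (1 : ℝ)) := by
  obtain ⟨K, hK⟩ := C.exists_abs_multiplier_add_log_le
  have hpi := Real.pi_pos
  have hcard : ∀ m : ℕ, (Finset.Icc (-(m : ℤ)) m).card = 2 * m + 1 := fun m => by
    rw [Int.card_Icc]; omega
  set s := ‖C.smoothOp lam‖ with hs
  have hlow : ∀ k : ℕ, -(Real.log ((k : ℝ) + 1) / (2 * Real.pi)) - K - s ≤ ν k := by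
    intro k
    refine HilbertBasis.le_eigenvalue (u := u) hν
      (C.modeBasis.spanFinset (Finset.Icc (-(k : ℤ)) k)) ?_ fun f hf => ?_
    · rw [HilbertBasis.finrank_spanFinset, hcard]; omega
    obtain ⟨g, hg⟩ :=
      HilbertBasis.exists_mem_diagGraph_of_mem_spanFinset C.multiplier (C.smoothOp lam) hf
    refine ⟨g, hG ▸ hg, HilbertBasis.le_diagGraph_re hg fun n hn => ?_⟩
    have hmem : n ∈ Finset.Icc (-(k : ℤ)) k := by
      by_contra hcon
      exact hn (HilbertBasis.inner_eq_zero_of_mem_spanFinset hf hcon)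
    have habs : |(n : ℝ)| ≤ k := by
      rw [Finset.mem_Icc] at hmem
      exact_mod_cast abs_le.2 hmem
    have h1 := (abs_le.1 (hK n)).1
    have h2 : Real.log (1 + |(n : ℝ)|) / (2 * Real.pi) ≤
        Real.log ((k : ℝ) + 1) / (2 * Real.pi) := by
      refine div_le_div_of_nonneg_right (Real.log_le_log (by positivity) ?_) (by positivity)
      linarith
    linarith
  have hup : ∀ k : ℕ, 1 ≤ k →
      ν k ≤ -(Real.log ((k : ℝ) + 1) / (2 * Real.pi)) + (K + s + Real.log 2 / (2 * Real.pi)) := by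
    intro k hk
    -- The largest symmetric block of modes, `2m + 1` of them, that fits into `k` constraints;
    -- monotonicity of `ν` absorbs the parity gap.
    set m : ℕ := (k - 1) / 2 with hm
    set t := Finset.Icc (-(m : ℤ)) m with ht
    have h1 : t.card ≤ k := by rw [ht, hcard]; omega
    refine (hν h1).trans (HilbertBasis.eigenvalue_le (u := u) hν
      (fun j : Fin t.card => C.modeBasis (t.equivFin.symm j : ℤ)) fun f g hfg hf => ?_)
    rw [← hG] at hfg
    refine (HilbertBasis.diagGraph_re_le hfg
      (β := K - Real.log ((m : ℝ) + 2) / (2 * Real.pi)) fun n hn => ?_).trans ?_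
    · have hmem : n ∉ t := fun hmem => hn (by simpa using hf (t.equivFin ⟨n, hmem⟩))
      have habs : (m : ℝ) + 1 ≤ |(n : ℝ)| := by
        have : (m : ℤ) + 1 ≤ |n| := by
          by_contra hcon
          exact hmem (Finset.mem_Icc.2 (abs_le.1 (by omega)))
        exact_mod_cast this
      have h2 := (abs_le.1 (hK n)).2
      have h3 : Real.log ((m : ℝ) + 2) / (2 * Real.pi) ≤
          Real.log (1 + |(n : ℝ)|) / (2 * Real.pi) := by
        refine div_le_div_of_nonneg_right (Real.log_le_log (by positivity) ?_) (by positivity)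
        linarith
      linarith
    · refine mul_le_mul_of_nonneg_right ?_ (sq_nonneg _)
      have h2 : ((k : ℝ) + 1) ≤ 2 * ((m : ℝ) + 2) := by
        have : k + 1 ≤ 2 * (m + 2) := by omega
        exact_mod_cast this
      have h3 : Real.log ((k : ℝ) + 1) ≤ Real.log 2 + Real.log ((m : ℝ) + 2) := by
        rw [← Real.log_mul (by norm_num) (by positivity)]
        exact Real.log_le_log (by positivity) h2
      have h4 : Real.log ((k : ℝ) + 1) / (2 * Real.pi) ≤
          Real.log 2 / (2 * Real.pi) + Real.log ((m : ℝ) + 2) / (2 * Real.pi) := by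
        rw [← add_div]; gcongr
      linarith
  have hlog2 : 0 ≤ Real.log 2 / (2 * Real.pi) :=
    div_nonneg (Real.log_nonneg (by norm_num)) (by positivity)
  refine Asymptotics.IsBigO.of_bound (K + s + Real.log 2 / (2 * Real.pi)) ?_
  filter_upwards [eventually_ge_atTop 1] with k hk
  rw [norm_one, mul_one, Real.norm_eq_abs, abs_le]
  constructor
  · linarith [hlow k]
  · linarith [hup k hk]

end ClosedCurve

end

/-- The eigenvalue `ν_k(λ)`, `k = 1, 2, …`, is `ν (k - 1) λ` below. -/
theorem proposition4p5 (C : ClosedCurve) :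
    -- (i), well-definedness of `B_λ` on `C^{0,1}(Σ)`
    (∀ lam ≤ 0, ∀ h : C.carrier → ℂ, C.IsLip h →
      ∃ k : C.carrier → ℂ, C.IsRegularization lam h k ∧ MemLp k 2 C.arcLength ∧
        ∃ f : (C.B lam).domain,
          ((f : C.L2) : C.carrier → ℂ) =ᵐ[C.arcLength] h ∧
          (C.B lam f : C.carrier → ℂ) =ᵐ[C.arcLength] k) ∧
    (∀ lam ≤ 0, ∀ f : (C.B lam).domain, ∃ h : C.carrier → ℂ, C.IsLip h ∧
      ((f : C.L2) : C.carrier → ℂ) =ᵐ[C.arcLength] h) ∧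
    -- (i), essential selfadjointness and the domain of the closure
    (∀ lam ≤ 0, IsEssentiallySelfAdjoint (C.B lam) ∧
      (C.B lam).closure.domain = (C.B 0).closure.domain) ∧
    -- (ii)
    (∀ lam ≤ 0, IsBoundedAbove (C.B lam).closure ∧ HasCompactResolvent (C.B lam).closure) ∧
    -- (iii) and (iv)
    ∃ ν : ℕ → ℝ → ℝ,
      (∀ lam ≤ 0, IsEigenvalueSequence (C.B lam).closure (fun k => ν k lam)) ∧
      (∀ lam ≤ 0, (fun k : ℕ => ν k lam - (-(Real.log ((k : ℝ) + 1) / (2 * Real.pi))))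
        =O[atTop] (fun _ => (1 : ℝ))) ∧
      ∀ k : ℕ, ContinuousOn (ν k) (Set.Iic 0) ∧ StrictMonoOn (ν k) (Set.Iic 0) ∧
        Tendsto (ν k) atBot atBot := by
  refine ⟨fun lam _ h hh => ?_, fun lam _ f => ?_, fun lam _ => ⟨?_, ?_⟩, fun lam _ => ⟨?_, ?_⟩, ?_⟩
  · refine ⟨_, hh.isRegularization lam, hh.memLp_arcFun.add (hh.memLp_kernelFun lam), ?_⟩
    obtain ⟨f, hf, hg⟩ := (LinearPMap.mem_graph_iff _).1 (hh.toLp_mem_graph_B lam)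
    refine ⟨f, ?_, ?_⟩
    · rw [hf]; exact hh.memLp.coeFn_toLp
    · rw [hg]; exact (hh.memLp_arcFun.add (hh.memLp_kernelFun lam)).coeFn_toLp
  · obtain ⟨h, hh, hf, -⟩ := ClosedCurve.mem_graph_B_iff.1 ((C.B lam).mem_graph f)
    exact ⟨h, hh, hf⟩
  · exact HilbertBasis.isEssentiallySelfAdjoint (C.smoothOp_isSymmetric lam)
      (ClosedCurve.B_graph_le lam) (ClosedCurve.modeBasis_mem_domain lam)
  · exact ClosedCurve.domain_closure_B_eq lam 0
  · exact HilbertBasis.isBoundedAbove_of_graph C.tendsto_multiplier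
      (ClosedCurve.graph_closure_B lam)
  · exact HilbertBasis.hasCompactResolvent_of_graph C.tendsto_multiplier
      (C.smoothOp_isSymmetric lam) (ClosedCurve.graph_closure_B lam)
  -- All real `lam` are included. For `lam > 0` the square root of `-lam` is `0`, so the operator is
  -- that of `lam = 0`, and continuity can be proved on the whole line.
  choose u ν hν hν' hG using C.exists_eigenbasis_closure_B
  refine ⟨fun k lam => ν lam k, fun lam _ => ?_, fun lam _ => ?_, fun k => ⟨?_, ?_, ?_⟩⟩
  · exact HilbertBasis.isEigenvalueSequence_of_graph (hν lam) (hν' lam)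
      ((ClosedCurve.graph_closure_B lam).trans (hG lam))
  · exact ClosedCurve.eigenvalue_isBigO (hν lam) (hG lam)
  · refine Continuous.continuousOn (continuous_iff_continuousAt.2 fun lam => ?_)
    rw [ContinuousAt, tendsto_iff_dist_tendsto_zero]
    have h1 : Tendsto (fun mu => (4 * Real.pi)⁻¹ * |Real.sqrt (-mu) - Real.sqrt (-lam)| * C.len)
        (𝓝 lam) (𝓝 0) := by
      have : Continuous fun mu =>
          (4 * Real.pi)⁻¹ * |Real.sqrt (-mu) - Real.sqrt (-lam)| * C.len := by fun_prop
      simpa using this.tendsto lam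
    refine squeeze_zero (fun _ => dist_nonneg) (fun mu => ?_) h1
    exact (HilbertBasis.abs_eigenvalue_sub_le (hν lam) (hν mu) (hG lam) (hG mu) k).trans
      (C.norm_smoothOp_sub_le mu lam)
  · intro lam _ mu hmu hlm
    exact HilbertBasis.eigenvalue_lt (hν lam) (hν mu) (hG lam) (hG mu)
      (fun f hf => C.re_inner_smoothOp_sub_pos hlm hmu hf) k
  · refine tendsto_atBot.2 fun v => ?_
    filter_upwards [ClosedCurve.eventually_potential_le (C := C) v] with lam hlam
    -- The top eigenvalue dominates all others, and it is bounded by min-max with no constraint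
    -- vectors.
    refine (hν lam (Nat.zero_le k)).trans
      (HilbertBasis.eigenvalue_le (u := u lam) (hν lam) Fin.elim0 fun f g hfg _ => ?_)
    rw [← hG lam, ← ClosedCurve.graph_closure_B lam] at hfg
    exact ClosedCurve.re_inner_le_of_mem_graph_closure hlam hfg
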